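/- Write $B_\rho=\{z\in\mathbb{C}^n:|z|<\rho\}$. For a smooth Hermitian metric $g=(g_{i\bar j})$ on an open subset of $\mathbb{C}^n$, let $\partial_i=\partial/\partial z^i$, $\partial_{\bar j}=\partial/\partial\bar z^j$, let $(g^{\bar j i})$ be the inverse matrix of $(g_{i\bar j})$ (so $g_{k\bar s}g^{\bar s l}=\delta_k^l$), and sum over repeated indices. Put $\Gamma_{ik}^l=g^{\bar s l}\partial_i g_{k\bar s}$ (the Chern connection $\nabla$ of $g$), $R_{i\bar jk}{}^l=-\partial_{\bar j}\Gamma_{ik}^l$ and $R_{i\bar jk\bar l}=g_{r\bar l}R_{i\bar jk}{}^r$ (the Chern curvature tensor $\mathrm{Rm}$ of $g$), $R^C_{i\bar j}=-\partial_i\partial_{\bar j}\log\det g$ (the Chern-Ricci curvature), and $$|\mathrm{Rm}|_g^2=g^{\bar a i}g^{\bar j b}g^{\bar c k}g^{\bar l d}R_{i\bar jk\bar l}\overline{R_{a\bar bc\bar d}}.$$ For a second Hermitian metric $\hat g$ with Chern connection $\hat\nabla$ and Christoffel symbols $\hat\Gamma_{ij}^r$, put $$\hat\nabla_i g_{j\bar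 k}=\partial_i g_{j\bar k}-\hat\Gamma_{ij}^r g_{r\bar k},\qquad |\hat\nabla g|_g^2=g^{\bar a i}g^{\bar b j}g^{\bar k c}\,\hat\nabla_i g_{j\bar k}\,\overline{\hat\nabla_a g_{b\bar c}}.$$ **Theorem 1.1.** Let $U\subseteq\mathbb{C}^n$ be open and let $\hat g$ be a smooth Hermitian metric on $U$. Then there are constants $C,\alpha,\beta>0$, depending only on $\hat g$ (that is, on $(n,U,\hat g)$), such that the following holds. Let $0<r<1$, let $V$ be an open set with $B_r\subseteq V\subseteq U$, let $0<T<\infty$ and $N>1$, and let $g(t)$, $t\in[0,T]$, be a family of Hermitian metrics on $V$, smooth on $V\times[0,T]$, which solves the Chern-Ricci flow $$\frac{\partial}{\partial t}g_{i\bar j}=-R^C_{i\bar j}(g(t)),\qquad g_{i\bar j}|_{t=0}=\hat g_{i\bar j},$$ and satisfies $$\frac1N\hat g\le g(t)\le N\hat g\qquad\text{on }B_r\times[0,T].$$ Then 1. $\displaystyle|\hat\nabla g|_g^2\le\frac{CN^\alpha}{r^2}$ on $B_{r/2}\times[0,T]$; 2. $\displaystyle|\mathrm{Rm}|_g^2\le\frac{CN^\beta}{r^4}$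 on $B_{r/4}\times[0,T]$. In particular $C,\alpha,\beta$ do not depend on $r$, $T$, $N$ or on the solution $g(t)$. -/

import Mathlib

open scoped ContDiff ComplexOrder

namespace ChernRicci

noncomputable section

/-- `ℂⁿ` with its Euclidean norm. -/
abbrev Cn (n : ℕ) : Type := EuclideanSpace ℂ (Fin n)

/-- The `i`-th coordinate vector of `ℂⁿ`. -/
def coordVec {n : ℕ} (i : Fin n) : Cn n := EuclideanSpace.single i (1 : ℂ)

/-- `∂_i f = (1/2) (∂f/∂x_i - √-1 ∂f/∂y_i)`, where `z_i = x_i + √-1 y_i`. -/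
def dz {n : ℕ} (i : Fin n) (f : Cn n → ℂ) (x : Cn n) : ℂ :=
  (1 / 2 : ℂ) * (fderiv ℝ f x (coordVec i) - Complex.I * fderiv ℝ f x (Complex.I • coordVec i))

/-- `∂_{\bar i} f = (1/2) (∂f/∂x_i + √-1 ∂f/∂y_i)`. -/
def dzbar {n : ℕ} (i : Fin n) (f : Cn n → ℂ) (x : Cn n) : ℂ :=
  (1 / 2 : ℂ) * (fderiv ℝ f x (coordVec i) + Complex.I * fderiv ℝ f x (Complex.I • coordVec i))

/-- A field of `n × n` complex matrices on `ℂⁿ`; the entry `g x i j` stands for `g_{i \bar j}(x)`.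
The inverse metric `g^{\bar j i}` is then `(g x)⁻¹ j i`, since
`∑ s, g_{k \bar s} g^{\bar s l} = δ_k^l`. -/
abbrev MatField (n : ℕ) : Type := Cn n → Matrix (Fin n) (Fin n) ℂ

/-- `g` is a smooth Hermitian metric on the set `U`. -/
structure IsHermitianMetricOn {n : ℕ} (U : Set (Cn n)) (g : MatField n) : Prop where
  smooth : ∀ i j, ContDiffOn ℝ ∞ (fun x => g x i j) U
  posDef : ∀ x ∈ U, (g x).PosDef

/-- Christoffel symbols of the Chern connection, `Γ_{ik}^l = g^{\bar s l} ∂_i g_{k \bar s}`. -/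
def christoffel {n : ℕ} (g : MatField n) (i k l : Fin n) (x : Cn n) : ℂ :=
  ∑ s, (g x)⁻¹ s l * dz i (fun y => g y k s) x

/-- `∇_i h_{j \bar k} = ∂_i h_{j \bar k} - Γ_{ij}^r h_{r \bar k}`, the `(1,0)` covariant derivative,
for the Chern connection of `g`, of the tensor `h = h_{j \bar k}`. -/
def nabla {n : ℕ} (g h : MatField n) (i j k : Fin n) (x : Cn n) : ℂ :=
  dz i (fun y => h y j k) x - ∑ r, christoffel g i j r x * h x r k

/-- The Chern curvature `R_{i \bar j k}^l = - ∂_{\bar j} Γ_{ik}^l`. -/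
def chernCurvatureUp {n : ℕ} (g : MatField n) (i j k l : Fin n) (x : Cn n) : ℂ :=
  - dzbar j (fun y => christoffel g i k l y) x

/-- The Chern curvature with all indices lowered,
`R_{i \bar j k \bar l} = g_{r \bar l} R_{i \bar j k}^r`. -/
def chernCurvature {n : ℕ} (g : MatField n) (i j k l : Fin n) (x : Cn n) : ℂ :=
  ∑ r, g x r l * chernCurvatureUp g i j k r x

/-- The Chern-Ricci curvature `R^C_{i \bar j} = - ∂_i ∂_{\bar j} log det g`. -/
def chernRicci {n : ℕ} (g : MatField n) (i j : Fin n) (x : Cn n) : ℂ :=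
  - dz i (fun y => dzbar j (fun w => Complex.log (g w).det) y) x

/-- The squared norm
`g^{\bar a i} g^{\bar b j} g^{\bar k c} A_{i j \bar k} \overline{A_{a b \bar c}}` of a tensor
`A = A_{i j \bar k}` with respect to the Hermitian matrix `G = (g_{i \bar j})`.
The sum is a nonnegative real number when `G` is positive definite. -/
def normSq3 {n : ℕ} (G : Matrix (Fin n) (Fin n) ℂ) (A : Fin n → Fin n → Fin n → ℂ) : ℝ :=
  (∑ i, ∑ a, ∑ j, ∑ b, ∑ k, ∑ c,
    G⁻¹ a i * G⁻¹ b j * G⁻¹ k c * A i j k * starRingEnd ℂ (A a b c)).re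

/-- The squared norm `g^{\bar a i} g^{\bar j b} g^{\bar c k} g^{\bar l d}
A_{i \bar j k \bar l} \overline{A_{a \bar b c \bar d}}` of a tensor `A = A_{i \bar j k \bar l}`
with respect to the Hermitian matrix `G = (g_{i \bar j})`. -/
def normSq4 {n : ℕ} (G : Matrix (Fin n) (Fin n) ℂ)
    (A : Fin n → Fin n → Fin n → Fin n → ℂ) : ℝ :=
  (∑ i, ∑ a, ∑ j, ∑ b, ∑ k, ∑ c, ∑ l, ∑ d,
    G⁻¹ a i * G⁻¹ j b * G⁻¹ c k * G⁻¹ l d * A i j k l * starRingEnd ℂ (A a b c d)).re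

/-- `|∇^h g|²_g` at `x`, where `∇^h` is the Chern connection of the metric `h`. -/
def calabiNormSq {n : ℕ} (h g : MatField n) (x : Cn n) : ℝ :=
  normSq3 (g x) (fun i j k => nabla h g i j k x)

/-- `|Rm|²_g` at `x`, where `Rm` is the Chern curvature tensor of `g`. -/
def curvatureNormSq {n : ℕ} (g : MatField n) (x : Cn n) : ℝ :=
  normSq4 (g x) (fun i j k l => chernCurvature g i j k l x)

/-- `g = g(t)`, `t ∈ [0,T]`, is a smooth solution on the set `V` of the Chern-Ricci flow
`∂_t g_{i \bar j} = - R^C_{i \bar j}` starting at `h`. -/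
structure IsChernRicciFlow {n : ℕ} (V : Set (Cn n)) (T : ℝ) (h : MatField n)
    (g : ℝ → MatField n) : Prop where
  smooth : ∀ i j, ContDiffOn ℝ ∞ (fun p : ℝ × Cn n => g p.1 p.2 i j) (Set.Icc 0 T ×ˢ V)
  posDef : ∀ t ∈ Set.Icc 0 T, ∀ x ∈ V, (g t x).PosDef
  initial : ∀ x ∈ V, g 0 x = h x
  evolution : ∀ t ∈ Set.Icc 0 T, ∀ x ∈ V, ∀ i j,
    HasDerivWithinAt (fun s => g s x i j) (- chernRicci (g t) i j x) (Set.Icc 0 T) t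

/-- `A ≤ B` for Hermitian matrices: `B - A` is positive semidefinite. -/
def HermLE {n : ℕ} (A B : Matrix (Fin n) (Fin n) ℂ) : Prop := (B - A).PosSemidef

end

end ChernRicci

/-!
The proof follows Sherman and Weinkove, with two simplifications that keep it elementary.

**A polynomial calculus.** All smooth functions on the cylinder `[0, T] × V` form a commutative
ring `Cyl T V` on which `∂_i`, `∂_{\bar i}`, `∂_t` are commuting derivations (`cylOps`). The
identities are proved for matrices over any such ring (`DiffOps`), and the metric `g`, its inverse,
the matrices `Γ_i` and the curvature matrices `R_{i \bar j}` are matrices over it. Both hypotheses on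
the size of `g` and all bounds for the initial metric are absorbed into one number `M = c N`, where
`c` depends only on the initial metric on a fixed compact set; every estimate has the form
`M ^ k` times the correct power of `1 / r`.

**The first estimate.** The torsion `∂ω` does not depend on time (`IsFlow.dt_tor`), so it and its
derivatives are bounded by the initial metric. As a consequence `Γ`, the connection relative to the
flat one, satisfies a heat equation whose reaction term contains the curvature only linearly
(`heat_gam`), and for `S = |Γ|²` (`calabi`) the Bochner formula gives
`(∂_t - Δ) S ≤ M ^ k (s S ^ {3/2} + s ^ 4)`, whenever `s ≥ 1` (`heat_calabi_le_rpow`). On the other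
hand `u = tr g` satisfies `(∂_t - Δ) u ≤ - M ^ {-k} S + M ^ k` (`heat_trace_le`).

**The second estimate.** Once `|∂g| ≤ s`, the flow is a quasilinear system
`(∂_t - Δ) g = W * ∂T - W * W * ∂g * ∂̄g` with `T` the torsion (`heat_metric`), and Bernstein's
method needs no geometry any more: `v = ∑ |∂g|²` and `P = ∑ |∂∂g|²` satisfy
`(∂_t - Δ) v ≤ - M ^ {-k} P + M ^ k s ^ 4` and `(∂_t - Δ) P ≤ M ^ k (P ^ {3/2} + s ^ 6)`
(`heat_gradSq_le`, `heat_hessSq_le`). Therefore `u = v / s²` and `S = P / s²` satisfy the same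
pair of inequalities as in the first estimate.

**The maximum principle.** For such a pair `u`, `S`, at the maximum of `η² S / (2A - u)`, where `A`
is an upper bound of `u` and `η` a cutoff function at scale `1 / s`, the vanishing of the gradient
removes the cross terms, and the good term `-S / A` dominates. The result is `S ≤ C s²` on the set
where `η ≥ 1 / 2` (`maximum_principle`). It is applied on the ball of radius `3 r / 4` with
`s = 2 / r`, and then on the ball of radius `r / 2` with `s = M ^ k / r`. The closed ball of radius
`3 r / 4` stays in a compact subset of `U` which is independent of `r` (`exists_compact_balls`), and
this is what makes the constants independent of `r` even if `U` has a boundary near the ball.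
-/

namespace ChernRicci

/-! ### Matrices over a ring with commuting derivations -/

section MatrixDerivation

variable {R : Type*} [CommRing R] [Algebra ℂ R] {k l m : Type*}

/-- A derivation acting on a matrix entry by entry. -/
def matDeriv (δ : Derivation ℂ R R) : Matrix k l R →ₗ[ℂ] Matrix k l R where
  toFun A := A.map δ
  map_add' A B := by ext; simp
  map_smul' c A := by ext; simp

@[simp] lemma matDeriv_apply (δ : Derivation ℂ R R) (A : Matrix k l R) (i : k) (j : l) :
    matDeriv δ A i j = δ (A i j) := rfl

lemma matDeriv_mul [Fintype l] (δ : Derivation ℂ R R) (A : Matrix k l R) (B : Matrix l m R) :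
    matDeriv δ (A * B) = matDeriv δ A * B + A * matDeriv δ B := by
  ext i j
  simp only [matDeriv_apply, Matrix.mul_apply, map_sum, Matrix.add_apply,
    Derivation.leibniz, smul_eq_mul, Finset.sum_add_distrib]
  rw [add_comm]
  congr 1
  exact Finset.sum_congr rfl fun _ _ => mul_comm _ _

lemma matDeriv_smul (δ : Derivation ℂ R R) (c : R) (A : Matrix k l R) :
    matDeriv δ (c • A) = δ c • A + c • matDeriv δ A := by
  ext i j
  simp [mul_comm, add_comm]

lemma matDeriv_transpose (δ : Derivation ℂ R R) (A : Matrix k l R) :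
    matDeriv δ A.transpose = (matDeriv δ A).transpose := rfl

lemma matDeriv_one [DecidableEq k] (δ : Derivation ℂ R R) :
    matDeriv δ (1 : Matrix k k R) = 0 := by
  ext i j
  by_cases h : i = j <;> simp [h]

lemma matDeriv_comm {δ ε : Derivation ℂ R R} (h : ∀ f, δ (ε f) = ε (δ f)) (A : Matrix k l R) :
    matDeriv δ (matDeriv ε A) = matDeriv ε (matDeriv δ A) := by
  ext i j; exact h _

lemma matDeriv_inverse [Fintype k] [DecidableEq k] (δ : Derivation ℂ R R) {g W : Matrix k k R}
    (h : W * g = 1) : matDeriv δ W = -(W * matDeriv δ g * W) := by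
  have h' : g * W = 1 := mul_eq_one_comm.mp h
  have h1 : matDeriv δ W * g + W * matDeriv δ g = 0 := by
    rw [← matDeriv_mul, h, matDeriv_one]
  calc matDeriv δ W = matDeriv δ W * (g * W) := by rw [h', mul_one]
    _ = (matDeriv δ W * g + W * matDeriv δ g) * W - W * matDeriv δ g * W := by noncomm_ring
    _ = _ := by rw [h1]; simp

open scoped Kronecker in
lemma matDeriv_kronecker {k' l' : Type*} (δ : Derivation ℂ R R) (A : Matrix k l R)
    (B : Matrix k' l' R) :
    matDeriv δ (A ⊗ₖ B) = matDeriv δ A ⊗ₖ B + A ⊗ₖ matDeriv δ B := by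
  ext ⟨i, i'⟩ ⟨j, j'⟩
  simp [mul_comm, add_comm]

/-- Jacobi's formula. -/
lemma derivation_det [Fintype k] [DecidableEq k] (δ : Derivation ℂ R R) (A : Matrix k k R) :
    δ A.det = (A.adjugate * matDeriv δ A).trace := by
  have hprod : ∀ (s : Finset k) (f : k → R),
      δ (∏ i ∈ s, f i) = ∑ i ∈ s, (∏ j ∈ s.erase i, f j) * δ (f i) := by
    intro s f
    induction s using Finset.induction_on with
    | empty => simp
    | insert a s ha ih =>
      rw [Finset.prod_insert ha, Derivation.leibniz, ih, Finset.sum_insert ha,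
        Finset.erase_insert ha, smul_eq_mul, smul_eq_mul, Finset.mul_sum, add_comm]
      congr 1
      refine Finset.sum_congr rfl fun i hi => ?_
      have hia : a ≠ i := fun h => ha (h ▸ hi)
      rw [Finset.erase_insert_of_ne hia,
        Finset.prod_insert (fun h => ha (Finset.mem_of_mem_erase h)),
        mul_assoc]
  have hcol : ∀ i, (A.updateCol i fun j => δ (A j i)).det
      = ∑ σ : Equiv.Perm k, (Equiv.Perm.sign σ : ℤ) •
          ((∏ j ∈ Finset.univ.erase i, A (σ j) j) * δ (A (σ i) i)) := by
    intro i
    rw [Matrix.det_apply]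
    refine Finset.sum_congr rfl fun σ _ => ?_
    rw [← Finset.prod_erase_mul _ _ (Finset.mem_univ i)]
    congr 2
    · refine Finset.prod_congr rfl fun j hj => ?_
      rw [Matrix.updateCol_ne (Finset.ne_of_mem_erase hj)]
    · simp
  have hadj : (A.adjugate * matDeriv δ A).trace
      = ∑ i, (A.updateCol i fun j => δ (A j i)).det := by
    refine Finset.sum_congr rfl fun i _ => ?_
    rw [← Matrix.cramer_apply, Matrix.cramer_eq_adjugate_mulVec]
    rfl
  rw [hadj, Finset.sum_congr rfl fun i _ => hcol i, Finset.sum_comm, Matrix.det_apply, map_sum]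
  refine Finset.sum_congr rfl fun σ _ => ?_
  rw [← Finset.smul_sum, ← hprod]
  exact map_zsmul δ _ _

end MatrixDerivation

/-- The commuting operators `∂_i`, `∂_{\bar i}` and `∂_t` on a ring `R` of smooth complex valued
functions of `(t, z)`; `star` is complex conjugation. -/
structure DiffOps (n : ℕ) (R : Type*) [CommRing R] [StarRing R] [Algebra ℂ R] where
  d : Fin n → Derivation ℂ R R
  db : Fin n → Derivation ℂ R R
  dt : Derivation ℂ R R
  d_d : ∀ i j f, d i (d j f) = d j (d i f)
  d_db : ∀ i j f, d i (db j f) = db j (d i f)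
  dt_d : ∀ i f, dt (d i f) = d i (dt f)
  dt_db : ∀ i f, dt (db i f) = db i (dt f)
  star_d : ∀ i f, star (d i f) = db i (star f)
  star_dt : ∀ f, star (dt f) = dt (star f)

namespace DiffOps

variable {n : ℕ} {R : Type*} [CommRing R] [StarRing R] [Algebra ℂ R] (𝒟 : DiffOps n R)

lemma star_db (i : Fin n) (f : R) : star (𝒟.db i f) = 𝒟.d i (star f) := by
  rw [← star_star (𝒟.d i (star f)), 𝒟.star_d, star_star]

lemma db_db (i j : Fin n) (f : R) : 𝒟.db i (𝒟.db j f) = 𝒟.db j (𝒟.db i f) := by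
  have := congrArg star (𝒟.d_d i j (star f))
  simpa [𝒟.star_d] using this

lemma conjTranspose_d {k l : Type*} (i : Fin n) (A : Matrix k l R) :
    (matDeriv (𝒟.d i) A).conjTranspose = matDeriv (𝒟.db i) A.conjTranspose := by
  ext a b; simp [𝒟.star_d]

lemma conjTranspose_db {k l : Type*} (i : Fin n) (A : Matrix k l R) :
    (matDeriv (𝒟.db i) A).conjTranspose = matDeriv (𝒟.d i) A.conjTranspose := by
  ext a b; simp [𝒟.star_db]

lemma conjTranspose_dt {k l : Type*} (A : Matrix k l R) :
    (matDeriv 𝒟.dt A).conjTranspose = matDeriv 𝒟.dt A.conjTranspose := by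
  ext a b; simp [𝒟.star_dt]

/-- The matrices `(Γ_i)_k^l` of the Chern connection of `g`; here `W` is the inverse of `g`. -/
def gam (g W : Matrix (Fin n) (Fin n) R) (i : Fin n) : Matrix (Fin n) (Fin n) R :=
  matDeriv (𝒟.d i) g * W

/-- The curvature matrices `(R_{i \bar j})_k^l`. -/
def rm (g W : Matrix (Fin n) (Fin n) R) (i j : Fin n) : Matrix (Fin n) (Fin n) R :=
  -matDeriv (𝒟.db j) (𝒟.gam g W i)

/-- The trace `g^{\bar q p} R_{p \bar q}` of the curvature over its form indices. -/
def ricTwo (g W : Matrix (Fin n) (Fin n) R) : Matrix (Fin n) (Fin n) R :=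
  ∑ p, ∑ q, W q p • 𝒟.rm g W p q

/-- The covariant derivative `∂_i X - [Γ_i, X]` of a field of endomorphisms, in the convention
in which endomorphisms act on row vectors from the right. -/
def covEnd (g W : Matrix (Fin n) (Fin n) R) (i : Fin n) (X : Matrix (Fin n) (Fin n) R) :
    Matrix (Fin n) (Fin n) R :=
  matDeriv (𝒟.d i) X - 𝒟.gam g W i * X + X * 𝒟.gam g W i

/-- The torsion `T_{ik\bar j} = ∂_i g_{k \bar j} - ∂_k g_{i \bar j}`. -/
def tor (g : Matrix (Fin n) (Fin n) R) (i k j : Fin n) : R := 𝒟.d i (g k j) - 𝒟.d k (g i j)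

/-- The Laplacian `g^{\bar q p} ∂_p ∂_{\bar q}`. -/
def lap (W : Matrix (Fin n) (Fin n) R) (f : R) : R := ∑ p, ∑ q, W q p * 𝒟.d p (𝒟.db q f)

/-- The heat operator `∂_t - g^{\bar q p} ∂_p ∂_{\bar q}`. -/
def heat (W : Matrix (Fin n) (Fin n) R) (f : R) : R := 𝒟.dt f - 𝒟.lap W f

/-- The defect `∂_t g + g^{\bar q p} R_{p \bar q} g`, which vanishes for a Kähler flow. -/
def defect (g W : Matrix (Fin n) (Fin n) R) : Matrix (Fin n) (Fin n) R :=
  matDeriv 𝒟.dt g + 𝒟.ricTwo g W * g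

variable {g W : Matrix (Fin n) (Fin n) R}

lemma gam_mul (hW : W * g = 1) (i : Fin n) : 𝒟.gam g W i * g = matDeriv (𝒟.d i) g := by
  rw [gam, mul_assoc, hW, mul_one]

lemma d_inverse (hW : W * g = 1) (i : Fin n) :
    matDeriv (𝒟.d i) W = -(W * 𝒟.gam g W i) := by
  rw [matDeriv_inverse _ hW, gam, mul_assoc]

lemma d_gam_sub (hW : W * g = 1) (p i : Fin n) :
    matDeriv (𝒟.d p) (𝒟.gam g W i) - matDeriv (𝒟.d i) (𝒟.gam g W p)
      = 𝒟.gam g W p * 𝒟.gam g W i - 𝒟.gam g W i * 𝒟.gam g W p := by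
  have h : ∀ p i, matDeriv (𝒟.d p) (𝒟.gam g W i)
      = matDeriv (𝒟.d p) (matDeriv (𝒟.d i) g) * W - 𝒟.gam g W i * 𝒟.gam g W p := by
    intro p i
    rw [gam, matDeriv_mul, 𝒟.d_inverse hW]
    noncomm_ring
  rw [h, h, matDeriv_comm (𝒟.d_d p i)]
  abel

/-- The second Bianchi identity. -/
lemma bianchi (hW : W * g = 1) (p i q : Fin n) :
    𝒟.covEnd g W p (𝒟.rm g W i q) = 𝒟.covEnd g W i (𝒟.rm g W p q) := by
  have h := congrArg (matDeriv (𝒟.db q)) (𝒟.d_gam_sub hW p i)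
  simp only [map_sub, matDeriv_mul] at h
  rw [← matDeriv_comm (𝒟.d_db p q), ← matDeriv_comm (𝒟.d_db i q)] at h
  simp only [covEnd, rm, map_neg]
  rw [← sub_eq_zero] at h ⊢
  rw [← neg_eq_zero, ← h]
  noncomm_ring

lemma dt_gam (hW : W * g = 1) (i : Fin n) :
    matDeriv 𝒟.dt (𝒟.gam g W i) = 𝒟.covEnd g W i (matDeriv 𝒟.dt g * W) := by
  simp only [covEnd, matDeriv_mul, 𝒟.d_inverse hW]
  rw [gam, matDeriv_mul, matDeriv_inverse 𝒟.dt hW, matDeriv_comm (𝒟.dt_d i)]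
  noncomm_ring

lemma defect_mul (hW : W * g = 1) :
    𝒟.defect g W * W = matDeriv 𝒟.dt g * W + 𝒟.ricTwo g W := by
  rw [defect, add_mul, mul_assoc _ g W, mul_eq_one_comm.mp hW, mul_one]

lemma covEnd_add (i : Fin n) (X Y : Matrix (Fin n) (Fin n) R) :
    𝒟.covEnd g W i (X + Y) = 𝒟.covEnd g W i X + 𝒟.covEnd g W i Y := by
  simp only [covEnd, map_add]; noncomm_ring

lemma covEnd_ricTwo (hW : W * g = 1) (i : Fin n) :
    𝒟.covEnd g W i (𝒟.ricTwo g W)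
      = ∑ p, ∑ q, W q p • 𝒟.covEnd g W i (𝒟.rm g W p q)
        - ∑ p, ∑ q, ∑ r, (W q p * 𝒟.gam g W i p r) • 𝒟.rm g W r q := by
  have h1 : ∑ p, ∑ q, ∑ r, (W q p * 𝒟.gam g W i p r) • 𝒟.rm g W r q
      = -∑ p, ∑ q, 𝒟.d i (W q p) • 𝒟.rm g W p q := by
    have h2 : ∀ p q, 𝒟.d i (W q p) = -∑ r, W q r * 𝒟.gam g W i r p := by
      intro p q
      have := congrFun (congrFun (𝒟.d_inverse hW i) q) p
      simpa [Matrix.mul_apply] using this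
    simp only [h2, neg_smul, Finset.sum_smul, Finset.sum_neg_distrib, neg_neg]
    rw [Finset.sum_comm, Finset.sum_comm (s := (Finset.univ : Finset (Fin n))) (f := fun p q =>
      ∑ r, (W q r * 𝒟.gam g W i r p) • 𝒟.rm g W p q)]
    exact Finset.sum_congr rfl fun q _ => Finset.sum_comm
  rw [h1, sub_neg_eq_add, covEnd, ricTwo]
  simp only [map_sum, matDeriv_smul, Finset.mul_sum, Finset.sum_mul, covEnd, Finset.sum_add_distrib,
    smul_add, smul_sub, Finset.sum_sub_distrib, Matrix.mul_smul, Matrix.smul_mul]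
  abel

/-- The `(1,0)` covariant derivative `(D_p Γ)_i` of the tensor `Γ_{ik}^l`. -/
def covGam (g W : Matrix (Fin n) (Fin n) R) (p i : Fin n) (X : Fin n → Matrix (Fin n) (Fin n) R) :
    Matrix (Fin n) (Fin n) R :=
  𝒟.covEnd g W p (X i) - ∑ r, 𝒟.gam g W p i r • X r

/-- The rough heat operator on `Γ`: the third derivatives of the metric cancel. -/
lemma heat_gam (hW : W * g = 1) (i : Fin n) :
    matDeriv 𝒟.dt (𝒟.gam g W i)
        - ∑ p, ∑ q, W q p • 𝒟.covGam g W p i (fun r => matDeriv (𝒟.db q) (𝒟.gam g W r))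
      = 𝒟.covEnd g W i (𝒟.defect g W * W)
        + ∑ p, ∑ q, ∑ r, (W q p * (𝒟.gam g W i p r - 𝒟.gam g W p i r)) • 𝒟.rm g W r q := by
  have h : ∀ p q, 𝒟.covGam g W p i (fun r => matDeriv (𝒟.db q) (𝒟.gam g W r))
      = -𝒟.covEnd g W i (𝒟.rm g W p q) + ∑ r, 𝒟.gam g W p i r • 𝒟.rm g W r q := by
    intro p q
    rw [← 𝒟.bianchi hW p i q, covGam]
    simp only [rm, smul_neg, Finset.sum_neg_distrib, ← sub_eq_add_neg]
    congr 1
    simp only [covEnd, map_neg]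
    noncomm_ring
  simp only [h, defect_mul _ hW, covEnd_add, ← 𝒟.dt_gam hW, covEnd_ricTwo _ hW, smul_add, smul_neg,
    Finset.sum_add_distrib, Finset.sum_neg_distrib, mul_sub, sub_smul, Finset.sum_sub_distrib,
    Finset.smul_sum, mul_smul]
  abel

end DiffOps

/-! ### The flow equation and the evolution of Calabi's quantity -/

namespace DiffOps

variable {n : ℕ} {R : Type*} [CommRing R] [StarRing R] [Algebra ℂ R] (𝒟 : DiffOps n R)
variable {g W : Matrix (Fin n) (Fin n) R}

lemma star_tor (hg : g.IsHermitian) (i k j : Fin n) :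
    star (𝒟.tor g i k j) = 𝒟.db i (g j k) - 𝒟.db k (g j i) := by
  simp [tor, 𝒟.star_d, hg.apply]

/-- The Chern-Ricci flow equation `∂_t g_{i \bar j} = ∂_i ∂_{\bar j} log det g`, with
`∂_{\bar j} log det g` written as `g^{\bar l k} ∂_{\bar j} g_{k \bar l}`. -/
def IsFlow (g W : Matrix (Fin n) (Fin n) R) : Prop :=
  ∀ i j, 𝒟.dt (g i j) = 𝒟.d i (∑ k, ∑ l, W l k * 𝒟.db j (g k l))

variable {𝒟} in
/-- The torsion `∂ω` is constant along the flow. -/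
lemma IsFlow.dt_tor (h : 𝒟.IsFlow g W) (i k j : Fin n) : 𝒟.dt (𝒟.tor g i k j) = 0 := by
  rw [tor, map_sub, 𝒟.dt_d, 𝒟.dt_d, h, h, 𝒟.d_d, sub_self]

/-- The terms of the flow equation which are linear in the first derivatives of the torsion. -/
def torTerm (g W : Matrix (Fin n) (Fin n) R) (i j : Fin n) : R :=
  ∑ k, ∑ l, W l k * (𝒟.d i (star (𝒟.tor g j l k)) + 𝒟.db l (𝒟.tor g i k j))

variable {𝒟} in
/-- The flow as a quasilinear parabolic system. -/
lemma IsFlow.heat_metric (h : 𝒟.IsFlow g W) (hW : W * g = 1) (hg : g.IsHermitian) (i j : Fin n) :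
    𝒟.heat W (g i j) = 𝒟.torTerm g W i j
      - ∑ k, ∑ l, ∑ a, ∑ b, W l a * W b k * (𝒟.d i (g a b) * 𝒟.db j (g k l)) := by
  have hdW : ∀ k l, 𝒟.d i (W l k) = -∑ a, ∑ b, W l a * 𝒟.d i (g a b) * W b k := by
    intro k l
    have := congrFun (congrFun (matDeriv_inverse (𝒟.d i) hW) l) k
    rw [Finset.sum_comm]
    simpa [Matrix.mul_apply, Finset.sum_mul] using this
  rw [heat, h, lap, torTerm]
  simp only [star_tor _ hg]
  simp only [tor, map_sum, map_sub, Derivation.leibniz, smul_eq_mul, hdW,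
    ← Finset.sum_sub_distrib]
  refine Finset.sum_congr rfl fun k _ => Finset.sum_congr rfl fun l _ => ?_
  rw [𝒟.d_db i l, 𝒟.d_db k l]
  have : ∑ a, ∑ b, W l a * W b k * (𝒟.d i (g a b) * 𝒟.db j (g k l))
      = 𝒟.db j (g k l) * ∑ a, ∑ b, W l a * 𝒟.d i (g a b) * W b k := by
    simp only [Finset.mul_sum]
    exact Finset.sum_congr rfl fun a _ => Finset.sum_congr rfl fun b _ => by ring
  rw [this]
  ring

/-- The curvature with lowered index, `R_{p \bar q} g = Γ_p ∂_{\bar q} g - ∂_p ∂_{\bar q} g`. -/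
lemma rm_mul (hW : W * g = 1) (p q : Fin n) : 𝒟.rm g W p q * g
    = 𝒟.gam g W p * matDeriv (𝒟.db q) g - matDeriv (𝒟.d p) (matDeriv (𝒟.db q) g) := by
  have := congrArg (matDeriv (𝒟.db q)) (𝒟.gam_mul hW p)
  rw [matDeriv_mul, ← matDeriv_comm (𝒟.d_db p q)] at this
  rw [← this, rm]
  noncomm_ring

variable {𝒟} in
/-- The defect is controlled by the torsion, with only one derivative of the metric in each
quadratic term. -/
lemma IsFlow.defect_apply (h : 𝒟.IsFlow g W) (hW : W * g = 1) (hg : g.IsHermitian) (i j : Fin n) :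
    𝒟.defect g W i j = 𝒟.torTerm g W i j
      - ∑ k, ∑ l, ∑ a, ∑ b, W l a * W b k *
        (𝒟.tor g i a b * 𝒟.db j (g k l) + 𝒟.d a (g i b) * star (𝒟.tor g j l k)) := by
  have h2 : 𝒟.defect g W i j = 𝒟.heat W (g i j)
      + ∑ p, ∑ q, W q p * (𝒟.gam g W p * matDeriv (𝒟.db q) g) i j := by
    rw [defect, ricTwo, heat, lap]
    simp only [Finset.sum_mul, Matrix.smul_mul, 𝒟.rm_mul hW, smul_sub, Finset.sum_sub_distrib,
      Matrix.add_apply, Matrix.sub_apply, Matrix.sum_apply, Matrix.smul_apply, smul_eq_mul,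
      matDeriv_apply]
    ring
  have h3 : ∑ p, ∑ q, W q p * (𝒟.gam g W p * matDeriv (𝒟.db q) g) i j
      = ∑ k, ∑ l, ∑ a, ∑ b, W l a * W b k * (𝒟.d a (g i b) * 𝒟.db l (g k j)) := by
    simp only [gam, Matrix.mul_apply, matDeriv_apply, Finset.mul_sum, Finset.sum_mul]
    rw [Finset.sum_comm]
    rw [Finset.sum_comm (s := (Finset.univ : Finset (Fin n))) (f := fun k l =>
      ∑ a, ∑ b, W l a * W b k * (𝒟.d a (g i b) * 𝒟.db l (g k j)))]
    refine Finset.sum_congr rfl fun q _ => ?_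
    rw [Finset.sum_comm]
    refine Finset.sum_congr rfl fun k _ => Finset.sum_congr rfl fun p _ =>
      Finset.sum_congr rfl fun b _ => by ring
  rw [h2, h.heat_metric hW hg, h3, sub_add, ← Finset.sum_sub_distrib]
  congr 1
  refine Finset.sum_congr rfl fun k _ => ?_
  simp only [← Finset.sum_sub_distrib]
  refine Finset.sum_congr rfl fun l _ => Finset.sum_congr rfl fun a _ =>
    Finset.sum_congr rfl fun b _ => ?_
  rw [star_tor _ hg, tor]
  ring

section Bochner

variable {m : Type*} [Fintype m]

/-- The Bochner formula for a section `σ` (a row vector) of a trivial holomorphic bundle with fibre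
metric `H`, where `A p = ∂_p H H⁻¹` is the Chern connection of `H`. -/
lemma bochner (hWh : W.IsHermitian) (H : Matrix m m R) (hH : H.IsHermitian)
    (A : Fin n → Matrix m m R) (At : Matrix m m R) (hA : ∀ p, matDeriv (𝒟.d p) H = A p * H)
    (hAt : matDeriv 𝒟.dt H = At * H) (σ : Matrix Unit m R) :
    𝒟.heat W ((σ * H * σ.conjTranspose) () ())
      = (((matDeriv 𝒟.dt σ - ∑ p, ∑ q, W q p • (matDeriv (𝒟.d p) (matDeriv (𝒟.db q) σ)
            + matDeriv (𝒟.db q) σ * A p)) * H * σ.conjTranspose) () ())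
        + star (((matDeriv 𝒟.dt σ - ∑ p, ∑ q, W q p • (matDeriv (𝒟.d p) (matDeriv (𝒟.db q) σ)
            + matDeriv (𝒟.db q) σ * A p)) * H * σ.conjTranspose) () ())
        + (σ * H * (At - ∑ p, ∑ q, W q p • matDeriv (𝒟.db q) (A p)).conjTranspose
            * σ.conjTranspose) () ()
        - ∑ p, ∑ q, W q p * (((matDeriv (𝒟.d p) σ + σ * A p) * H
            * (matDeriv (𝒟.d q) σ + σ * A q).conjTranspose) () ())
        - ∑ p, ∑ q, W q p * ((matDeriv (𝒟.db q) σ * H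
            * (matDeriv (𝒟.db p) σ).conjTranspose) () ()) := by
  have hAb : ∀ q, matDeriv (𝒟.db q) H = H * (A q).conjTranspose := by
    intro q
    have := congrArg Matrix.conjTranspose (hA q)
    rwa [conjTranspose_d, Matrix.conjTranspose_mul, hH.eq] at this
  have hAt' : matDeriv 𝒟.dt H = H * At.conjTranspose := by
    have := congrArg Matrix.conjTranspose hAt
    rwa [conjTranspose_dt, Matrix.conjTranspose_mul, hH.eq] at this
  have h1 : ∀ p q, matDeriv (𝒟.d p) (matDeriv (𝒟.db q) (σ * H * σ.conjTranspose))
      = (matDeriv (𝒟.d p) (matDeriv (𝒟.db q) σ) + matDeriv (𝒟.db q) σ * A p) * H * σ.conjTranspose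
        + matDeriv (𝒟.db q) σ * H * (matDeriv (𝒟.db p) σ).conjTranspose
        + (matDeriv (𝒟.d p) σ + σ * A p) * H * (matDeriv (𝒟.d q) σ + σ * A q).conjTranspose
        + ((matDeriv (𝒟.d q) (matDeriv (𝒟.db p) σ) + matDeriv (𝒟.db p) σ * A q)
            * H * σ.conjTranspose).conjTranspose
        + σ * H * (matDeriv (𝒟.db p) (A q)).conjTranspose * σ.conjTranspose := by
    intro p q
    simp only [matDeriv_mul, hA, hAb, map_add, Matrix.conjTranspose_mul, Matrix.conjTranspose_add,
      Matrix.conjTranspose_conjTranspose, conjTranspose_d, conjTranspose_db, hH.eq,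
      Matrix.mul_add, Matrix.add_mul, Matrix.mul_assoc, matDeriv_comm (𝒟.d_db p q)]
    abel
  have h2 : matDeriv 𝒟.dt (σ * H * σ.conjTranspose)
      = matDeriv 𝒟.dt σ * H * σ.conjTranspose
        + (matDeriv 𝒟.dt σ * H * σ.conjTranspose).conjTranspose
        + σ * H * At.conjTranspose * σ.conjTranspose := by
    simp only [matDeriv_mul, hAt', Matrix.conjTranspose_mul,
      Matrix.conjTranspose_conjTranspose, conjTranspose_dt, hH.eq, Matrix.mul_add,
      Matrix.mul_assoc]
    abel
  have h3 : ∀ p q, 𝒟.d p (𝒟.db q ((σ * H * σ.conjTranspose) () ())) = _ :=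
    fun p q => congrFun (congrFun (h1 p q) ()) ()
  have h4 : 𝒟.dt ((σ * H * σ.conjTranspose) () ()) = _ := congrFun (congrFun h2 ()) ()
  have hs : ∀ X : Fin n → Fin n → R, ∑ p, ∑ q, W q p * star (X q p)
      = star (∑ p, ∑ q, W q p * X p q) := by
    intro X
    simp only [star_sum, star_mul']
    rw [Finset.sum_comm]
    refine Finset.sum_congr rfl fun q _ => Finset.sum_congr rfl fun p _ => ?_
    rw [hWh.apply]
  have hs' : ∀ X : Fin n → Fin n → Matrix m m R, ∑ p, ∑ q, W q p • (X q p).conjTranspose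
      = (∑ p, ∑ q, W q p • X p q).conjTranspose := by
    intro X
    simp only [Matrix.conjTranspose_sum, Matrix.conjTranspose_smul]
    rw [Finset.sum_comm]
    refine Finset.sum_congr rfl fun q _ => Finset.sum_congr rfl fun p _ => ?_
    rw [hWh.apply]
  rw [heat, lap, h4]
  simp only [h3]
  simp only [Matrix.sub_mul, Matrix.sum_mul, Matrix.smul_mul, Matrix.conjTranspose_sub,
    Matrix.mul_sub, ← hs', Matrix.mul_sum, Matrix.mul_smul, Matrix.add_apply, Matrix.sub_apply,
    Matrix.sum_apply, Matrix.smul_apply, smul_eq_mul, Matrix.conjTranspose_apply, mul_add,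
    Finset.sum_add_distrib, star_sub, hs]
  ring

end Bochner

end DiffOps

section Triple

open scoped Kronecker

variable {n : ℕ} {R : Type*} [CommRing R] {g W : Matrix (Fin n) (Fin n) R}

/-- The metric `g^{\bar a i} g^{\bar b j} g_{k \bar c}` on tensors of the type of `Γ_{ij}^k`. -/
def triple (g W : Matrix (Fin n) (Fin n) R) :
    Matrix (Fin n × Fin n × Fin n) (Fin n × Fin n × Fin n) R :=
  W.transpose ⊗ₖ (W.transpose ⊗ₖ g)

/-- The action of an endomorphism `X` on tensors of the type of `Γ_{ij}^k`. -/
def tripleDer (X : Matrix (Fin n) (Fin n) R) :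
    Matrix (Fin n × Fin n × Fin n) (Fin n × Fin n × Fin n) R :=
  -(X.transpose ⊗ₖ (1 ⊗ₖ 1)) - 1 ⊗ₖ (X.transpose ⊗ₖ 1) + 1 ⊗ₖ (1 ⊗ₖ X)

/-- A tensor of the type of `Γ_{ij}^k` as a row vector. -/
def row (X : Fin n → Matrix (Fin n) (Fin n) R) : Matrix Unit (Fin n × Fin n × Fin n) R :=
  Matrix.of fun _ I => X I.1 I.2.1 I.2.2

lemma neg_kron {a b c d : Type*} (A : Matrix a b R) (B : Matrix c d R) :
    (-A) ⊗ₖ B = -(A ⊗ₖ B) := by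
  ext; simp

lemma kron_neg {a b c d : Type*} (A : Matrix a b R) (B : Matrix c d R) :
    A ⊗ₖ (-B) = -(A ⊗ₖ B) := by
  ext; simp

lemma matDeriv_triple [Algebra ℂ R] (hW : W * g = 1) (δ : Derivation ℂ R R) :
    matDeriv δ (triple g W) = tripleDer (matDeriv δ g * W) * triple g W := by
  have h : matDeriv δ W.transpose = -((matDeriv δ g * W).transpose * W.transpose) := by
    rw [matDeriv_transpose, matDeriv_inverse δ hW, ← Matrix.transpose_mul, mul_assoc]; rfl
  have h' : matDeriv δ g = matDeriv δ g * W * g := by rw [mul_assoc, hW, mul_one]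
  generalize matDeriv δ g * W = Y at h h'
  rw [triple, matDeriv_kronecker, matDeriv_kronecker, h, h', tripleDer]
  simp only [add_mul, sub_mul, neg_mul, ← Matrix.mul_kronecker_mul, one_mul, neg_kron, kron_neg,
    Matrix.kronecker_add]
  abel

lemma matDeriv_tripleDer [Algebra ℂ R] (δ : Derivation ℂ R R) (X : Matrix (Fin n) (Fin n) R) :
    matDeriv δ (tripleDer X) = tripleDer (matDeriv δ X) := by
  simp only [tripleDer, map_sub, map_add, map_neg, matDeriv_kronecker, matDeriv_one,
    matDeriv_transpose, Matrix.kronecker_zero, Matrix.zero_kronecker, add_zero, zero_add]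

lemma tripleDer_add (X Y : Matrix (Fin n) (Fin n) R) :
    tripleDer (X + Y) = tripleDer X + tripleDer Y := by
  simp only [tripleDer, Matrix.transpose_add, Matrix.kronecker_add, Matrix.add_kronecker]
  abel

lemma tripleDer_neg (X : Matrix (Fin n) (Fin n) R) : tripleDer (-X) = -tripleDer X := by
  simp only [tripleDer, Matrix.transpose_neg, neg_kron, kron_neg]
  abel

lemma tripleDer_smul (c : R) (X : Matrix (Fin n) (Fin n) R) :
    tripleDer (c • X) = c • tripleDer X := by
  simp only [tripleDer, Matrix.transpose_smul, Matrix.kronecker_smul, Matrix.smul_kronecker,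
    smul_add, smul_sub, smul_neg]

lemma tripleDer_sum {ι : Type*} (s : Finset ι) (X : ι → Matrix (Fin n) (Fin n) R) :
    tripleDer (∑ i ∈ s, X i) = ∑ i ∈ s, tripleDer (X i) :=
  map_sum ({ toFun := tripleDer, map_zero' := by simp [tripleDer], map_add' := tripleDer_add } :
    Matrix (Fin n) (Fin n) R →+ _) X s

lemma triple_isHermitian [StarRing R] (hg : g.IsHermitian) (hWh : W.IsHermitian) :
    (triple g W).IsHermitian := by
  rw [Matrix.IsHermitian, triple, Matrix.conjTranspose_kronecker, Matrix.conjTranspose_kronecker,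
    hg.eq, hWh.transpose.eq]

lemma row_mul_tripleDer (X : Fin n → Matrix (Fin n) (Fin n) R) (Y : Matrix (Fin n) (Fin n) R) :
    row X * tripleDer Y = row fun i => X i * Y - Y * X i - ∑ r, Y i r • X r := by
  rw [tripleDer, Matrix.mul_add, Matrix.mul_sub, Matrix.mul_neg]
  ext u ⟨i, j, k⟩
  simp only [Matrix.add_apply, Matrix.sub_apply, Matrix.neg_apply, row, Matrix.of_apply,
    Matrix.mul_apply, Matrix.sum_apply,
    Fintype.sum_prod_type, Matrix.kroneckerMap_apply, Matrix.one_apply, Matrix.smul_apply,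
    Matrix.transpose_apply, smul_eq_mul, mul_ite, ite_mul, mul_one, one_mul, mul_zero, zero_mul,
    Finset.sum_ite_irrel, Finset.sum_ite_eq', Finset.mem_univ, if_true, Finset.sum_const_zero]
  simp only [mul_comm]
  ring

end Triple

namespace DiffOps

variable {n : ℕ} {R : Type*} [CommRing R] [StarRing R] [Algebra ℂ R] (𝒟 : DiffOps n R)
variable {g W : Matrix (Fin n) (Fin n) R}

lemma row_covGam (p : Fin n) (X : Fin n → Matrix (Fin n) (Fin n) R) :
    matDeriv (𝒟.d p) (row X) + row X * tripleDer (𝒟.gam g W p)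
      = row fun i => 𝒟.covGam g W p i X := by
  rw [row_mul_tripleDer]
  ext u ⟨i, j, k⟩
  simp only [row, covGam, covEnd, Matrix.add_apply, Matrix.sub_apply, Matrix.of_apply,
    matDeriv_apply]
  ring

/-- Calabi's quantity `|Γ|²`, the squared norm of the Chern connection relative to the flat one. -/
def calabi (g W : Matrix (Fin n) (Fin n) R) : R :=
  (row (𝒟.gam g W) * triple g W * (row (𝒟.gam g W)).conjTranspose) () ()

/-- The lower order part of the evolution of the Chern connection. -/
def reaction (g W : Matrix (Fin n) (Fin n) R) (i : Fin n) : Matrix (Fin n) (Fin n) R :=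
  𝒟.covEnd g W i (𝒟.defect g W * W)
    + ∑ p, ∑ q, ∑ r, (W q p * (𝒟.gam g W i p r - 𝒟.gam g W p i r)) • 𝒟.rm g W r q

/-- Evolution of Calabi's quantity. -/
lemma heat_calabi (hW : W * g = 1) (hg : g.IsHermitian) (hWh : W.IsHermitian) :
    𝒟.heat W (𝒟.calabi g W)
      = (row (𝒟.reaction g W) * triple g W * (row (𝒟.gam g W)).conjTranspose) () ()
        + star ((row (𝒟.reaction g W) * triple g W * (row (𝒟.gam g W)).conjTranspose) () ())
        + (row (𝒟.gam g W) * triple g W * (tripleDer (𝒟.defect g W * W)).conjTranspose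
            * (row (𝒟.gam g W)).conjTranspose) () ()
        - ∑ p, ∑ q, W q p * ((row (fun i => 𝒟.covGam g W p i (𝒟.gam g W)) * triple g W
            * (row fun i => 𝒟.covGam g W q i (𝒟.gam g W)).conjTranspose) () ())
        - ∑ p, ∑ q, W q p * ((matDeriv (𝒟.db q) (row (𝒟.gam g W)) * triple g W
            * (matDeriv (𝒟.db p) (row (𝒟.gam g W))).conjTranspose) () ()) := by
  have hdt : matDeriv 𝒟.dt (row (𝒟.gam g W))
      - ∑ p, ∑ q, W q p • (matDeriv (𝒟.d p) (matDeriv (𝒟.db q) (row (𝒟.gam g W)))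
            + matDeriv (𝒟.db q) (row (𝒟.gam g W)) * tripleDer (𝒟.gam g W p))
      = row (𝒟.reaction g W) := by
    have h : ∀ q, matDeriv (𝒟.db q) (row (𝒟.gam g W))
        = row fun r => matDeriv (𝒟.db q) (𝒟.gam g W r) := fun q => rfl
    simp only [h, row_covGam]
    ext u ⟨i, j, k⟩
    have := congrFun (congrFun (𝒟.heat_gam hW i) j) k
    simp only [reaction, row, Matrix.sub_apply, Matrix.of_apply, matDeriv_apply, Matrix.sum_apply,
      Matrix.smul_apply] at this ⊢
    exact this
  have hcurv : tripleDer (matDeriv 𝒟.dt g * W)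
      - ∑ p, ∑ q, W q p • matDeriv (𝒟.db q) (tripleDer (𝒟.gam g W p))
      = tripleDer (𝒟.defect g W * W) := by
    rw [defect_mul _ hW, tripleDer_add, ricTwo]
    simp only [matDeriv_tripleDer, ← tripleDer_smul, tripleDer_sum, rm, smul_neg, tripleDer_neg,
      Finset.sum_neg_distrib, sub_eq_add_neg]
  have h := 𝒟.bochner hWh (triple g W) (triple_isHermitian hg hWh)
    (fun p => tripleDer (𝒟.gam g W p)) (tripleDer (matDeriv 𝒟.dt g * W))
    (fun p => matDeriv_triple hW _) (matDeriv_triple hW _) (row (𝒟.gam g W))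
  rw [hdt, hcurv] at h
  rw [calabi, h]
  simp only [row_covGam]

end DiffOps

/-! ### Weighted bounds for jets at a point; quadratic forms -/

namespace DiffOps

variable {n : ℕ} {R : Type*} [CommRing R] [StarRing R] [Algebra ℂ R] (𝒟 : DiffOps n R)

/-- All first order spatial operators: `∂_i` on the left summand, `∂_{\bar i}` on the right one. -/
def D : Fin n ⊕ Fin n → Derivation ℂ R R := Sum.elim 𝒟.d 𝒟.db

lemma D_comm (α β : Fin n ⊕ Fin n) (f : R) : 𝒟.D α (𝒟.D β f) = 𝒟.D β (𝒟.D α f) := by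
  rcases α with i | i <;> rcases β with j | j
  exacts [𝒟.d_d i j f, 𝒟.d_db i j f, (𝒟.d_db j i f).symm, 𝒟.db_db i j f]

lemma D_star (α : Fin n ⊕ Fin n) (f : R) : 𝒟.D α (star f) = star (𝒟.D α.swap f) := by
  rcases α with i | i
  exacts [(𝒟.star_db i f).symm, (𝒟.star_d i f).symm]

/-- Evaluation at a point: `|f| ≤ M ^ k a`. -/
def Jet0 (ev : R →⋆ₐ[ℂ] ℂ) (M : ℝ) (k : ℕ) (a : ℝ) (f : R) : Prop := ‖ev f‖ ≤ M ^ k * a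

/-- At a point, `|f| ≤ M ^ k a` and the first spatial derivatives are at most `M ^ k b`. -/
def Jet1 (ev : R →⋆ₐ[ℂ] ℂ) (M : ℝ) (k : ℕ) (a b : ℝ) (f : R) : Prop :=
  Jet0 ev M k a f ∧ ∀ α, Jet0 ev M k b (𝒟.D α f)

/-- At a point, `f` and its first and second spatial derivatives are at most `M ^ k a`, `M ^ k b`
and `M ^ k c` respectively. -/
def Jet2 (ev : R →⋆ₐ[ℂ] ℂ) (M : ℝ) (k : ℕ) (a b c : ℝ) (f : R) : Prop :=
  Jet0 ev M k a f ∧ ∀ α, 𝒟.Jet1 ev M k b c (𝒟.D α f)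

variable {𝒟} {ev : R →⋆ₐ[ℂ] ℂ} {M : ℝ} [hM : Fact (4 ≤ M)] {k l : ℕ} {a b c a' b' c' A B C : ℝ}
  {f h : R}

omit hM in
lemma Jet2.jet1 (hf : 𝒟.Jet2 ev M k a b c f) : 𝒟.Jet1 ev M k a b f :=
  ⟨hf.1, fun α => (hf.2 α).1⟩

omit hM in
lemma Jet2.D (hf : 𝒟.Jet2 ev M k a b c f) (α) : 𝒟.Jet1 ev M k b c (𝒟.D α f) := hf.2 α

lemma one_le_of_fact : 1 ≤ M := by have := hM.out; linarith

lemma Jet0.mono (hf : Jet0 ev M k a f) (hkl : k ≤ l) (hab : a ≤ A) (hA : 0 ≤ A := by positivity) :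
    Jet0 ev M l A f := by
  have h1 : (1 : ℝ) ≤ M := one_le_of_fact
  refine hf.trans ?_
  calc M ^ k * a ≤ M ^ k * A := by gcongr
    _ ≤ M ^ l * A := by gcongr

lemma Jet1.mono (hf : 𝒟.Jet1 ev M k a b f) (hkl : k ≤ l) (hab : a ≤ A) (hB : b ≤ B)
    (hA : 0 ≤ A := by positivity) (hB0 : 0 ≤ B := by positivity) : 𝒟.Jet1 ev M l A B f :=
  ⟨hf.1.mono hkl hab hA, fun α => (hf.2 α).mono hkl hB hB0⟩

lemma Jet2.mono (hf : 𝒟.Jet2 ev M k a b c f) (hkl : k ≤ l) (hab : a ≤ A) (hB : b ≤ B) (hC : c ≤ C)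
    (hA : 0 ≤ A := by positivity) (hB0 : 0 ≤ B := by positivity) (hC0 : 0 ≤ C := by positivity) :
    𝒟.Jet2 ev M l A B C f :=
  ⟨hf.1.mono hkl hab hA, fun α => (hf.2 α).mono hkl hB hC hB0 hC0⟩

lemma Jet0.mul (hf : Jet0 ev M k a f) (hh : Jet0 ev M l a' h) (hA : a * a' ≤ A) :
    Jet0 ev M (k + l) A (f * h) := by
  have h1 : (1 : ℝ) ≤ M := one_le_of_fact
  rw [Jet0, map_mul, norm_mul]
  calc _ ≤ (M ^ k * a) * (M ^ l * a') :=
        mul_le_mul hf hh (norm_nonneg _) ((norm_nonneg _).trans hf)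
    _ = M ^ (k + l) * (a * a') := by rw [pow_add]; ring
    _ ≤ _ := by gcongr

lemma Jet0.add' (hf : Jet0 ev M k a f) (hh : Jet0 ev M k a h) : Jet0 ev M (k + 1) a (f + h) := by
  have h0 : 0 ≤ M ^ k * a := (norm_nonneg _).trans hf
  have h4 := hM.out
  rw [Jet0, map_add]
  calc _ ≤ M ^ k * a + M ^ k * a := (norm_add_le _ _).trans (add_le_add hf hh)
    _ ≤ M * (M ^ k * a) := by nlinarith
    _ = _ := by ring

lemma Jet1.add' (hf : 𝒟.Jet1 ev M k a b f) (hh : 𝒟.Jet1 ev M k a b h) :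
    𝒟.Jet1 ev M (k + 1) a b (f + h) :=
  ⟨hf.1.add' hh.1, fun α => by rw [map_add]; exact (hf.2 α).add' (hh.2 α)⟩

lemma Jet2.add' (hf : 𝒟.Jet2 ev M k a b c f) (hh : 𝒟.Jet2 ev M k a b c h) :
    𝒟.Jet2 ev M (k + 1) a b c (f + h) :=
  ⟨hf.1.add' hh.1, fun α => by rw [map_add]; exact (hf.2 α).add' (hh.2 α)⟩

lemma Jet0.add (hf : Jet0 ev M k a f) (hh : Jet0 ev M l a h) (ha : 0 ≤ a := by positivity) :
    Jet0 ev M (max k l + 1) a (f + h) :=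
  (hf.mono (le_max_left _ _) le_rfl ha).add' (hh.mono (le_max_right _ _) le_rfl ha)

lemma Jet1.add (hf : 𝒟.Jet1 ev M k a b f) (hh : 𝒟.Jet1 ev M l a b h)
    (ha : 0 ≤ a := by positivity) (hb : 0 ≤ b := by positivity) :
    𝒟.Jet1 ev M (max k l + 1) a b (f + h) :=
  (hf.mono (le_max_left _ _) le_rfl le_rfl ha hb).add'
    (hh.mono (le_max_right _ _) le_rfl le_rfl ha hb)

lemma Jet2.add (hf : 𝒟.Jet2 ev M k a b c f) (hh : 𝒟.Jet2 ev M l a b c h)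
    (ha : 0 ≤ a := by positivity) (hb : 0 ≤ b := by positivity) (hc : 0 ≤ c := by positivity) :
    𝒟.Jet2 ev M (max k l + 1) a b c (f + h) :=
  (hf.mono (le_max_left _ _) le_rfl le_rfl le_rfl ha hb hc).add'
    (hh.mono (le_max_right _ _) le_rfl le_rfl le_rfl ha hb hc)

omit hM in
lemma Jet0.neg (hf : Jet0 ev M k a f) : Jet0 ev M k a (-f) := by
  rw [Jet0, map_neg, norm_neg]; exact hf

omit hM in
lemma Jet1.neg (hf : 𝒟.Jet1 ev M k a b f) : 𝒟.Jet1 ev M k a b (-f) :=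
  ⟨hf.1.neg, fun α => by rw [map_neg]; exact (hf.2 α).neg⟩

omit hM in
lemma Jet2.neg (hf : 𝒟.Jet2 ev M k a b c f) : 𝒟.Jet2 ev M k a b c (-f) :=
  ⟨hf.1.neg, fun α => by rw [map_neg]; exact (hf.2 α).neg⟩

lemma Jet0.sub (hf : Jet0 ev M k a f) (hh : Jet0 ev M l a h) (ha : 0 ≤ a := by positivity) :
    Jet0 ev M (max k l + 1) a (f - h) := by
  rw [sub_eq_add_neg]; exact hf.add hh.neg ha

lemma Jet1.sub (hf : 𝒟.Jet1 ev M k a b f) (hh : 𝒟.Jet1 ev M l a b h)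
    (ha : 0 ≤ a := by positivity) (hb : 0 ≤ b := by positivity) :
    𝒟.Jet1 ev M (max k l + 1) a b (f - h) := by
  rw [sub_eq_add_neg]; exact hf.add hh.neg ha hb

lemma Jet2.sub (hf : 𝒟.Jet2 ev M k a b c f) (hh : 𝒟.Jet2 ev M l a b c h)
    (ha : 0 ≤ a := by positivity) (hb : 0 ≤ b := by positivity) (hc : 0 ≤ c := by positivity) :
    𝒟.Jet2 ev M (max k l + 1) a b c (f - h) := by
  rw [sub_eq_add_neg]; exact hf.add hh.neg ha hb hc

omit hM in
lemma Jet0.star (hf : Jet0 ev M k a f) : Jet0 ev M k a (star f) := by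
  rw [Jet0, map_star, norm_star]; exact hf

omit hM in
lemma Jet1.star (hf : 𝒟.Jet1 ev M k a b f) : 𝒟.Jet1 ev M k a b (star f) :=
  ⟨hf.1.star, fun α => by rw [D_star]; exact (hf.2 _).star⟩

omit hM in
lemma Jet2.star (hf : 𝒟.Jet2 ev M k a b c f) : 𝒟.Jet2 ev M k a b c (star f) :=
  ⟨hf.1.star, fun α => by rw [D_star]; exact (hf.2 _).star⟩

lemma Jet1.mul (hf : 𝒟.Jet1 ev M k a b f) (hh : 𝒟.Jet1 ev M l a' b' h) (hA : a * a' ≤ A)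
    (hB : a * b' ≤ B) (hB' : b * a' ≤ B) : 𝒟.Jet1 ev M (k + l + 1) A B (f * h) := by
  refine ⟨(hf.1.mul hh.1 le_rfl).mono (by omega) hA ?_, fun α => ?_⟩
  · have h1 : (1 : ℝ) ≤ M := one_le_of_fact
    have h0 := mul_nonneg ((norm_nonneg _).trans hf.1) ((norm_nonneg _).trans hh.1)
    have : 0 ≤ M ^ (k + l) * (a * a') := by rw [pow_add]; linarith
    exact (nonneg_of_mul_nonneg_right this (by positivity)).trans hA
  · rw [Derivation.leibniz, smul_eq_mul, smul_eq_mul]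
    refine (hf.1.mul (hh.2 α) hB).add' ?_
    rw [add_comm k l]
    exact hh.1.mul (hf.2 α) (by linarith)

lemma Jet2.mul (hf : 𝒟.Jet2 ev M k a b c f) (hh : 𝒟.Jet2 ev M l a' b' c' h) (hA : a * a' ≤ A)
    (hB : a * b' ≤ B) (hB' : b * a' ≤ B) (hC : a * c' ≤ C) (hC' : b * b' ≤ C) (hC'' : c * a' ≤ C) :
    𝒟.Jet2 ev M (k + l + 2) A B C (f * h) := by
  refine ⟨(hf.1.mul hh.1 le_rfl).mono (by omega) hA ?_, fun α => ?_⟩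
  · have h1 : (1 : ℝ) ≤ M := one_le_of_fact
    have h0 := mul_nonneg ((norm_nonneg _).trans hf.1) ((norm_nonneg _).trans hh.1)
    have : 0 ≤ M ^ (k + l) * (a * a') := by rw [pow_add]; linarith
    exact (nonneg_of_mul_nonneg_right this (by positivity)).trans hA
  · rw [Derivation.leibniz, smul_eq_mul, smul_eq_mul]
    refine (hf.jet1.mul (hh.2 α) hB hC hC').add' ?_
    rw [add_comm k l]
    exact hh.jet1.mul (hf.2 α) (by linarith) (by linarith) (by linarith)

lemma Jet0.sum' {ι : Type*} [Fintype ι] {e : ℕ} (he : (Fintype.card ι : ℝ) ≤ M ^ e) {F : ι → R}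
    (hF : ∀ i, Jet0 ev M k a (F i)) (ha : 0 ≤ a := by positivity) :
    Jet0 ev M (k + e) a (∑ i, F i) := by
  have h1 : (1 : ℝ) ≤ M := one_le_of_fact
  rw [Jet0, map_sum]
  calc _ ≤ ∑ i : ι, M ^ k * a := (norm_sum_le _ _).trans (Finset.sum_le_sum fun i _ => hF i)
    _ = Fintype.card ι * (M ^ k * a) := by simp
    _ ≤ M ^ e * (M ^ k * a) := by gcongr
    _ = _ := by rw [pow_add]; ring

variable [hn : Fact ((n : ℝ) ≤ M)]

omit hM in
lemma card_fin_le : (Fintype.card (Fin n) : ℝ) ≤ M ^ 1 := by simpa using hn.out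

lemma Jet0.sum {F : Fin n → R} (hF : ∀ i, Jet0 ev M k a (F i)) (ha : 0 ≤ a := by positivity) :
    Jet0 ev M (k + 1) a (∑ i, F i) := Jet0.sum' card_fin_le hF ha

lemma Jet1.sum {F : Fin n → R} (hF : ∀ i, 𝒟.Jet1 ev M k a b (F i)) (ha : 0 ≤ a := by positivity)
    (hb : 0 ≤ b := by positivity) : 𝒟.Jet1 ev M (k + 1) a b (∑ i, F i) :=
  ⟨Jet0.sum (fun i => (hF i).1) ha, fun α => by
    rw [map_sum]; exact Jet0.sum (fun i => (hF i).2 α) hb⟩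

lemma Jet2.sum {F : Fin n → R} (hF : ∀ i, 𝒟.Jet2 ev M k a b c (F i)) (ha : 0 ≤ a := by positivity)
    (hb : 0 ≤ b := by positivity) (hc : 0 ≤ c := by positivity) :
    𝒟.Jet2 ev M (k + 1) a b c (∑ i, F i) :=
  ⟨Jet0.sum (fun i => (hF i).1) ha, fun α => by
    rw [map_sum]; exact Jet1.sum (fun i => (hF i).2 α) hb hc⟩

end DiffOps

section QuadraticForm

open scoped Kronecker

variable {ι κ : Type*} [Fintype ι] [DecidableEq ι] [Fintype κ] [DecidableEq κ]

/-- If `A ≥ a` and `B ≥ b` then `A ⊗ B ≥ a b`. -/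
lemma posSemidef_kronecker_sub {A : Matrix ι ι ℂ} {B : Matrix κ κ ℂ} {a b : ℝ} (ha : 0 ≤ a)
    (hb : 0 ≤ b) (hA : (A - (a : ℂ) • (1 : Matrix ι ι ℂ)).PosSemidef)
    (hB : (B - (b : ℂ) • (1 : Matrix κ κ ℂ)).PosSemidef) :
    (A ⊗ₖ B - ((a * b : ℝ) : ℂ) • (1 : Matrix (ι × κ) (ι × κ) ℂ)).PosSemidef := by
  have ha' : (0 : ℂ) ≤ a := by exact_mod_cast ha
  have hb' : (0 : ℂ) ≤ b := by exact_mod_cast hb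
  have hB' : B.PosSemidef := by
    have := hB.add (Matrix.PosSemidef.one.smul hb')
    simpa using this
  have h := (hA.kronecker hB').add (((Matrix.PosSemidef.one (n := ι) (R := ℂ)).smul
      ha').kronecker hB)
  have e : A ⊗ₖ B - ((a * b : ℝ) : ℂ) • (1 : Matrix (ι × κ) (ι × κ) ℂ)
      = (A - (a : ℂ) • (1 : Matrix ι ι ℂ)) ⊗ₖ B
        + ((a : ℂ) • (1 : Matrix ι ι ℂ)) ⊗ₖ (B - (b : ℂ) • (1 : Matrix κ κ ℂ)) := by
    ext ⟨i, j⟩ ⟨i', j'⟩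
    simp only [Matrix.sub_apply, Matrix.add_apply, Matrix.kroneckerMap_apply, Matrix.smul_apply,
      smul_eq_mul, ← Matrix.one_kronecker_one]
    push_cast
    ring
  rw [e]
  exact h

omit [DecidableEq ι] in
lemma posSemidef_quadForm {A : Matrix ι ι ℂ} (hA : A.PosSemidef) (x : ι → ℂ) :
    0 ≤ (∑ i, ∑ j, x i * A i j * star (x j)).re := by
  have h := hA.dotProduct_mulVec_nonneg (star x)
  have h2 : star (star x) ⬝ᵥ A.mulVec (star x) = ∑ i, ∑ j, x i * A i j * star (x j) := by
    simp [dotProduct, Matrix.mulVec, Finset.mul_sum, mul_assoc]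
  rw [h2] at h
  exact (Complex.le_def.mp h).1

lemma le_quadForm {A : Matrix ι ι ℂ} {a : ℝ} (hA : (A - (a : ℂ) • (1 : Matrix ι ι ℂ)).PosSemidef)
    (x : ι → ℂ) : a * ∑ i, ‖x i‖ ^ 2 ≤ (∑ i, ∑ j, x i * A i j * star (x j)).re := by
  have h := posSemidef_quadForm hA x
  have h2 : ∑ i, ∑ j, x i * (A - (a : ℂ) • (1 : Matrix ι ι ℂ)) i j * star (x j)
      = ∑ i, ∑ j, x i * A i j * star (x j) - ((a * ∑ i, ‖x i‖ ^ 2 : ℝ) : ℂ) := by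
    have : ∀ i, ∑ j, x i * (a * (1 : Matrix ι ι ℂ) i j) * star (x j) =
        ((a * ‖x i‖ ^ 2 : ℝ) : ℂ) := by
      intro i
      simp only [Matrix.one_apply, mul_ite, mul_one, mul_zero, ite_mul, zero_mul, Finset.sum_ite_eq,
        Finset.mem_univ, if_true]
      push_cast
      rw [← Complex.mul_conj']
      simp only [RCLike.star_def]
      ring
    simp only [Matrix.sub_apply, Matrix.smul_apply, smul_eq_mul, mul_sub, sub_mul,
      Finset.sum_sub_distrib, this]
    rw [Finset.mul_sum, ← Complex.ofReal_sum]
  rw [h2, Complex.sub_re, Complex.ofReal_re] at h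
  linarith

end QuadraticForm

/-! ### Estimates in terms of the Chern connection -/

namespace DiffOps

variable {n : ℕ} {R : Type*} [CommRing R] [StarRing R] [Algebra ℂ R]

/-- At the point where `ev` evaluates, the solution `g` of the flow with inverse `W` lies between
`M⁻¹` and `M` times the Euclidean metric, and its torsion has derivatives bounded by `M`. -/
structure MetricBound (𝒟 : DiffOps n R) (ev : R →⋆ₐ[ℂ] ℂ) (M : ℝ)
    (g W : Matrix (Fin n) (Fin n) R) : Prop where
  inv : W * g = 1
  hermG : g.IsHermitian
  hermW : W.IsHermitian
  flow : 𝒟.IsFlow g W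
  g_le : ∀ i j, Jet0 ev M 1 1 (g i j)
  W_le : ∀ i j, Jet0 ev M 1 1 (W i j)
  g_ge : (g.map ev - ((M⁻¹ : ℝ) : ℂ) • (1 : Matrix (Fin n) (Fin n) ℂ)).PosSemidef
  W_ge : (W.map ev - ((M⁻¹ : ℝ) : ℂ) • (1 : Matrix (Fin n) (Fin n) ℂ)).PosSemidef
  tor_le : ∀ i k j, 𝒟.Jet1 ev M 1 1 1 (𝒟.tor g i k j)
  D_tor_le : ∀ α i k j, 𝒟.Jet2 ev M 1 1 1 1 (𝒟.D α (𝒟.tor g i k j))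

variable {𝒟 : DiffOps n R} {ev : R →⋆ₐ[ℂ] ℂ} {M : ℝ} [hM : Fact (4 ≤ M)] [hn : Fact ((n : ℝ) ≤ M)]
  {g W : Matrix (Fin n) (Fin n) R}

lemma Jet0.matMul {ι κ μ : Type*} [Fintype κ] {e k l : ℕ} {a b c : ℝ}
    (he : (Fintype.card κ : ℝ) ≤ M ^ e) {A : Matrix ι κ R} {B : Matrix κ μ R}
    (hA : ∀ i j, Jet0 ev M k a (A i j)) (hB : ∀ i j, Jet0 ev M l b (B i j)) (hc : a * b ≤ c)
    (i : ι) (j : μ) (h0 : 0 ≤ c := by positivity) : Jet0 ev M (k + l + e) c ((A * B) i j) := by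
  rw [Matrix.mul_apply]
  exact Jet0.sum' he (fun x => (hA i x).mul (hB x j) hc) h0

lemma Jet0.matMul_fin {ι μ : Type*} {k l : ℕ} {a b c : ℝ} {A : Matrix ι (Fin n) R}
    {B : Matrix (Fin n) μ R} (hA : ∀ i j, Jet0 ev M k a (A i j))
    (hB : ∀ i j, Jet0 ev M l b (B i j)) (hc : a * b ≤ c) (i : ι) (j : μ)
    (h0 : 0 ≤ c := by positivity) : Jet0 ev M (k + l + 1) c ((A * B) i j) :=
  Jet0.matMul card_fin_le hA hB hc i j h0

lemma Jet1.matMul_fin {ι μ : Type*} {k l : ℕ} {a b a' b' c d : ℝ} {A : Matrix ι (Fin n) R}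
    {B : Matrix (Fin n) μ R} (hA : ∀ i j, 𝒟.Jet1 ev M k a b (A i j))
    (hB : ∀ i j, 𝒟.Jet1 ev M l a' b' (B i j)) (hc : a * a' ≤ c) (hd : a * b' ≤ d) (hd' : b * a' ≤ d)
    (i : ι) (j : μ) (h0 : 0 ≤ c := by positivity) (h1 : 0 ≤ d := by positivity) :
    𝒟.Jet1 ev M (k + l + 1 + 1) c d ((A * B) i j) := by
  rw [Matrix.mul_apply]
  exact Jet1.sum (fun x => (hA i x).mul (hB x j) hc hd hd') h0 h1

omit hM hn in
lemma D_star_tor_jet (H : 𝒟.MetricBound ev M g W) (α) (i k j : Fin n) :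
    𝒟.Jet2 ev M 1 1 1 1 (𝒟.D α (star (𝒟.tor g i k j))) := by
  rw [D_star]; exact (H.D_tor_le _ _ _ _).star

namespace MetricBound

omit hM hn in
lemma D_W_eq (H : 𝒟.MetricBound ev M g W) (α) :
    matDeriv (𝒟.D α) W = -(W * matDeriv (𝒟.D α) g * W) := matDeriv_inverse _ H.inv

/-- The inverse metric satisfies the same first order bound as the metric, since `∂W = -W ∂g W`.
-/
lemma D_W (H : 𝒟.MetricBound ev M g W) {k : ℕ} {s : ℝ} (hs : 0 ≤ s)
    (hg : ∀ α i j, Jet0 ev M k s (𝒟.D α (g i j))) (α) (i j : Fin n) :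
    Jet0 ev M (k + 4) s (𝒟.D α (W i j)) := by
  have h := congrFun (congrFun (H.D_W_eq α) i) j
  rw [matDeriv_apply, Matrix.neg_apply] at h
  rw [h]
  refine (Jet0.mono (Jet0.matMul_fin (c := s) (Jet0.matMul_fin (c := s) H.W_le (hg α)
    (by linarith)) H.W_le (by linarith) i j) (by omega) le_rfl hs).neg

section Calabi

variable {s q Q : ℝ}

/-- Bounds for `Γ` are bounds for all first derivatives of the metric: `∂_i g = Γ_i g`, and
`∂_{\bar i} g` is its conjugate. -/
lemma D_g (H : 𝒟.MetricBound ev M g W) (h0 : 0 ≤ s) (hΓ : ∀ i j k, Jet0 ev M 0 s (𝒟.gam g W i j k))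
    (α) (j k : Fin n) : Jet0 ev M 2 s (𝒟.D α (g j k)) := by
  have h : ∀ i j k, Jet0 ev M 2 s (𝒟.d i (g j k)) := by
    intro i j k
    rw [← matDeriv_apply, ← 𝒟.gam_mul H.inv]
    exact Jet0.matMul_fin (hΓ i) H.g_le (by linarith) j k
  rcases α with i | i
  · exact h i j k
  · change Jet0 ev M 2 s (𝒟.db i (g j k))
    rw [← H.hermG.apply, ← 𝒟.star_d]
    exact (h i k j).star

/-- Here `s` bounds `Γ` and `q` its covariant derivatives and `∂_{\bar p} Γ`. The covariant and
the plain derivative differ by terms quadratic in `Γ`, hence `Q = s² + q` bounds the latter. -/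
lemma gam_jet (hs : 1 ≤ s) (hq : 0 ≤ q) (hQ : s ^ 2 + q ≤ Q)
    (hΓ : ∀ i j k, Jet0 ev M 0 s (𝒟.gam g W i j k))
    (hd : ∀ p i j k, Jet0 ev M 0 q (𝒟.covGam g W p i (𝒟.gam g W) j k))
    (hdb : ∀ p i j k, Jet0 ev M 0 q (𝒟.db p (𝒟.gam g W i j k))) (i j k : Fin n) :
    𝒟.Jet1 ev M 4 s Q (𝒟.gam g W i j k) := by
  have hQ0 : 0 ≤ Q := by nlinarith
  have hqQ : q ≤ Q := by nlinarith
  have hsQ : s * s ≤ Q := by nlinarith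
  refine ⟨(hΓ i j k).mono (by omega) le_rfl, fun α => ?_⟩
  rcases α with p | p
  · have e : 𝒟.d p (𝒟.gam g W i j k) = 𝒟.covGam g W p i (𝒟.gam g W) j k
        + ((𝒟.gam g W p * 𝒟.gam g W i) j k - (𝒟.gam g W i * 𝒟.gam g W p) j k
          + ∑ r, 𝒟.gam g W p i r * 𝒟.gam g W r j k) := by
      simp only [covGam, covEnd, Matrix.sub_apply, Matrix.add_apply, Matrix.sum_apply,
        Matrix.smul_apply, smul_eq_mul, matDeriv_apply]
      ring
    change Jet0 ev M 4 Q (𝒟.d p (𝒟.gam g W i j k))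
    rw [e]
    refine ((hd p i j k).mono le_rfl hqQ).add ?_ (l := 3)
    refine Jet0.add (k := 2) (l := 1) ?_ ?_
    · exact (Jet0.matMul_fin (hΓ p) (hΓ i) hsQ j k).sub (Jet0.matMul_fin (hΓ i) (hΓ p) hsQ j k)
    · exact Jet0.sum fun r => (hΓ p i r).mul (hΓ r j k) hsQ
  · exact (hdb p i j k).mono (by omega) hqQ

lemma D_g_jet (H : 𝒟.MetricBound ev M g W) (hs : 1 ≤ s) (hQ : s ^ 2 ≤ Q)
    (hΓ : ∀ i j k, 𝒟.Jet1 ev M 4 s Q (𝒟.gam g W i j k))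
    (hg : ∀ i j, 𝒟.Jet1 ev M 2 1 s (g i j)) (α) (j k : Fin n) :
    𝒟.Jet1 ev M 8 s Q (𝒟.D α (g j k)) := by
  have h0 : 0 ≤ s := by linarith
  have hQ0 : 0 ≤ Q := by nlinarith
  have h : ∀ i j k, 𝒟.Jet1 ev M 8 s Q (𝒟.d i (g j k)) := by
    intro i j k
    rw [← matDeriv_apply, ← 𝒟.gam_mul H.inv]
    exact Jet1.matMul_fin (hΓ i) hg (by linarith) (by nlinarith) (by linarith) j k
  rcases α with i | i
  · exact h i j k
  · change 𝒟.Jet1 ev M 8 s Q (𝒟.db i (g j k))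
    rw [← H.hermG.apply, ← 𝒟.star_d]
    exact (h i k j).star

lemma torTerm_jet (H : 𝒟.MetricBound ev M g W) (hs : 1 ≤ s) (hQ : s ^ 2 ≤ Q)
    (hW : ∀ i j, 𝒟.Jet1 ev M 6 1 s (W i j)) (i j : Fin n) :
    𝒟.Jet1 ev M 11 s Q (𝒟.torTerm g W i j) := by
  have h0 : 0 ≤ s := by linarith
  have hQ0 : 0 ≤ Q := by nlinarith
  have h1 : 1 ≤ Q := by nlinarith
  refine Jet1.sum (k := 10) fun k => Jet1.sum (k := 9) fun l => ?_
  refine Jet1.mul (a' := s) (b' := Q) (l := 2) (hW l k) ?_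
    (by linarith) (by linarith) (by nlinarith)
  exact ((D_star_tor_jet H (.inl i) j l k).jet1.mono le_rfl hs h1).add'
    ((H.D_tor_le (.inr l) i k j).jet1.mono le_rfl hs h1)

lemma defect_jet (H : 𝒟.MetricBound ev M g W) (hs : 1 ≤ s) (hQ : s ^ 2 ≤ Q)
    (hW : ∀ i j, 𝒟.Jet1 ev M 6 1 s (W i j))
    (hDg : ∀ α i j, 𝒟.Jet1 ev M 8 s Q (𝒟.D α (g i j))) (i j : Fin n) :
    𝒟.Jet1 ev M 30 s Q (𝒟.defect g W i j) := by
  have h0 : 0 ≤ s := by linarith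
  have hQ0 : 0 ≤ Q := by nlinarith
  rw [H.flow.defect_apply H.inv H.hermG]
  refine Jet1.sub (k := 11) (l := 29) (H.torTerm_jet hs hQ hW i j) ?_
  refine Jet1.sum (k := 28) fun k => Jet1.sum (k := 27) fun l => Jet1.sum (k := 26) fun a =>
    Jet1.sum (k := 25) fun b => ?_
  refine Jet1.mul (k := 13) (l := 11) (a := 1) (b := s) (a' := s) (b' := Q)
    ((hW l a).mul (hW b k) (by norm_num) (by linarith) (by linarith)) ?_ (by linarith)
    (by linarith) (by nlinarith)
  refine Jet1.add' (k := 10) ?_ ?_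
  · exact Jet1.mul (k := 1) (l := 8) ((H.tor_le i a b).mono le_rfl le_rfl hs) (hDg (.inr j) k l)
      (by linarith) (by linarith) (by nlinarith)
  · exact Jet1.mul (k := 8) (l := 1) (hDg (.inl a) i b)
      ((H.tor_le j l k).mono le_rfl le_rfl hs).star
      (by linarith) (by nlinarith) (by linarith)

lemma defect_mul_jet (H : 𝒟.MetricBound ev M g W) (hs : 1 ≤ s) (hQ : s ^ 2 ≤ Q)
    (hW : ∀ i j, 𝒟.Jet1 ev M 6 1 s (W i j))
    (hDg : ∀ α i j, 𝒟.Jet1 ev M 8 s Q (𝒟.D α (g i j))) (i j : Fin n) :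
    𝒟.Jet1 ev M 38 s Q ((𝒟.defect g W * W) i j) := by
  have h0 : 0 ≤ s := by linarith
  have hQ0 : 0 ≤ Q := by nlinarith
  exact Jet1.matMul_fin (H.defect_jet hs hQ hW hDg) hW (by linarith) (by nlinarith)
    (by linarith) i j

lemma reaction_jet (H : 𝒟.MetricBound ev M g W) (hs : 1 ≤ s) (hQ : s ^ 2 ≤ Q)
    (hΓ0 : ∀ i j k, Jet0 ev M 0 s (𝒟.gam g W i j k))
    (hΓ : ∀ i j k, 𝒟.Jet1 ev M 4 s Q (𝒟.gam g W i j k))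
    (hEW : ∀ i j, 𝒟.Jet1 ev M 38 s Q ((𝒟.defect g W * W) i j)) (i j k : Fin n) :
    Jet0 ev M 42 Q (𝒟.reaction g W i j k) := by
  have h0 : 0 ≤ s := by linarith
  have hQ0 : 0 ≤ Q := by nlinarith
  simp only [reaction, covEnd, Matrix.add_apply, Matrix.sub_apply, Matrix.sum_apply,
    Matrix.smul_apply, smul_eq_mul, matDeriv_apply]
  refine Jet0.add (k := 41) (l := 11) (Jet0.add (k := 40) (l := 39) (Jet0.sub (k := 38) (l := 39)
    ((hEW j k).2 (.inl i)) ?_) ?_) ?_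
  · exact Jet0.matMul_fin (hΓ0 i) (fun a b => (hEW a b).1) (by linarith) j k
  · exact Jet0.matMul_fin (fun a b => (hEW a b).1) (hΓ0 i) (by linarith) j k
  · refine Jet0.sum (k := 10) fun p => Jet0.sum (k := 9) fun q => Jet0.sum (k := 8) fun r => ?_
    refine Jet0.mul (k := 4) (l := 4) (a := 1) (a' := Q) ?_ ?_ (by linarith)
    · refine Jet0.mul (k := 1) (l := 3) (H.W_le q p) (a' := 1) ?_ (by norm_num)
      have e : 𝒟.gam g W i p r - 𝒟.gam g W p i r = ∑ b, 𝒟.tor g i p b * W b r := by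
        simp only [gam, Matrix.mul_apply, matDeriv_apply, tor, sub_mul, Finset.sum_sub_distrib]
      rw [e]
      exact Jet0.sum fun b => (H.tor_le i p b).1.mul (H.W_le b r) (by norm_num)
    · exact ((hΓ r j k).2 (.inr q)).neg

end Calabi

end MetricBound

lemma card_triple_le : (Fintype.card (Fin n × Fin n × Fin n) : ℝ) ≤ M ^ 3 := by
  have h := hn.out
  have h4 := hM.out
  simp only [Fintype.card_prod, Fintype.card_fin, Nat.cast_mul]
  calc (n : ℝ) * (n * n) ≤ M * (M * M) := by gcongr
    _ = M ^ 3 := by ring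

omit hM hn in
lemma jet0_one_apply {ι : Type*} [DecidableEq ι] (i j : ι) :
    Jet0 ev M 0 1 ((1 : Matrix ι ι R) i j) := by
  rw [Jet0, Matrix.one_apply]
  split_ifs <;> simp

omit hn in
lemma tripleDer_jet {X : Matrix (Fin n) (Fin n) R} {k : ℕ} {a : ℝ} (ha : 0 ≤ a)
    (hX : ∀ i j, Jet0 ev M k a (X i j)) (I J) : Jet0 ev M (k + 2) a (tripleDer X I J) := by
  obtain ⟨i, i', i''⟩ := I
  obtain ⟨j, j', j''⟩ := J
  simp only [tripleDer, Matrix.add_apply, Matrix.sub_apply, Matrix.neg_apply,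
    Matrix.kroneckerMap_apply, Matrix.transpose_apply]
  rw [sub_eq_add_neg]
  have h1 : ∀ a b : Fin n, Jet0 ev M 0 1 ((1 : Matrix (Fin n) (Fin n) R) a b) := jet0_one_apply
  refine Jet0.add' (k := k + 1) (Jet0.add' (k := k) ?_ ?_) ?_
  · exact ((hX j i).mul (l := 0) (a' := 1) ((h1 _ _).mul (h1 _ _) (by norm_num)) (by linarith)).neg
  · refine (((h1 i j).mul (k := 0) (l := k) (a' := a) (A := a) ((hX j' i').mul (h1 _ _)
      (by linarith)) (by linarith)).mono (by omega) le_rfl).neg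
  · exact ((h1 i j).mul (k := 0) (l := k) (a' := a) (A := a) (((h1 _ _).mul (hX i'' j'') (A := a)
      (by linarith)).mono (by omega) le_rfl) (by linarith)).mono (by omega) le_rfl

namespace MetricBound

omit hn in
lemma triple_jet (H : 𝒟.MetricBound ev M g W) (I J) : Jet0 ev M 3 1 (triple g W I J) := by
  simp only [triple, Matrix.kroneckerMap_apply, Matrix.transpose_apply]
  exact (H.W_le _ _).mul ((H.W_le _ _).mul (H.g_le _ _) (A := 1) (by norm_num)) (by norm_num)

/-- The crude upper bound for the inner product of two tensors of the type of `Γ`. -/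
lemma quad_jet (H : 𝒟.MetricBound ev M g W) {k l : ℕ} {a b c : ℝ}
    {X Y : Matrix Unit (Fin n × Fin n × Fin n) R} (ha : 0 ≤ a) (hX : ∀ u I, Jet0 ev M k a (X u I))
    (hY : ∀ u I, Jet0 ev M l b (Y u I)) (hc : a * b ≤ c) (h0 : 0 ≤ c) :
    Jet0 ev M (k + l + 9) c ((X * triple g W * Y.conjTranspose) () ()) :=
  (Jet0.matMul card_triple_le (a := a) (b := b) (k := k + 3 + 3) (l := l)
    (Jet0.matMul card_triple_le hX H.triple_jet (by linarith)) (fun I u => (hY u I).star)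
    hc () () h0).mono (by omega) le_rfl h0

open scoped Kronecker

omit hn in
lemma triple_ge (H : 𝒟.MetricBound ev M g W) :
    ((triple (g.map ev) (W.map ev)) - ((M⁻¹ * (M⁻¹ * M⁻¹) : ℝ) : ℂ) •
      (1 : Matrix (Fin n × Fin n × Fin n) (Fin n × Fin n × Fin n) ℂ)).PosSemidef := by
  have h0 : 0 ≤ M⁻¹ := by have := hM.out; positivity
  have hWT : ((W.map ev).transpose - ((M⁻¹ : ℝ) : ℂ) • (1 : Matrix (Fin n) (Fin n) ℂ)).PosSemidef
      := by
    have := H.W_ge.transpose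
    rwa [Matrix.transpose_sub, Matrix.transpose_smul, Matrix.transpose_one] at this
  exact posSemidef_kronecker_sub h0 (by positivity) hWT
    (posSemidef_kronecker_sub h0 h0 hWT H.g_ge)

omit hn in
/-- The good terms of the Bochner formula dominate the sum of squares of their entries. -/
lemma sum_sq_le (H : 𝒟.MetricBound ev M g W) {W' : Matrix (Fin n) (Fin n) R}
    (hW' : (W'.map ev - ((M⁻¹ : ℝ) : ℂ) • (1 : Matrix (Fin n) (Fin n) ℂ)).PosSemidef)
    (X : Fin n → Matrix Unit (Fin n × Fin n × Fin n) R) :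
    M⁻¹ * (M⁻¹ * (M⁻¹ * M⁻¹)) * ∑ p, ∑ I, ‖ev (X p () I)‖ ^ 2
      ≤ (ev (∑ p, ∑ q, W' p q * (X p * triple g W * (X q).conjTranspose) () ())).re := by
  have h0 : 0 ≤ M⁻¹ := by have := hM.out; positivity
  have h := le_quadForm (posSemidef_kronecker_sub h0 (by positivity) hW' H.triple_ge)
    (fun P : Fin n × (Fin n × Fin n × Fin n) => ev (X P.1 () P.2))
  rw [Fintype.sum_prod_type] at h
  refine h.trans (le_of_eq (congrArg Complex.re ?_))
  have ht : ∀ I J, ev (triple g W I J) = triple (g.map ev) (W.map ev) I J := by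
    intro I J; simp [triple]
  simp only [map_sum, map_mul, Matrix.mul_apply, Matrix.conjTranspose_apply, map_star, ht,
    Fintype.sum_prod_type (f := fun P : Fin n × (Fin n × Fin n × Fin n) => _),
    Matrix.kroneckerMap_apply, Matrix.map_apply, Finset.mul_sum, Finset.sum_mul]
  refine Finset.sum_congr rfl fun p _ => ?_
  rw [Finset.sum_comm]
  refine Finset.sum_congr rfl fun q _ => ?_
  rw [Finset.sum_comm]
  refine Finset.sum_congr rfl fun J _ => Finset.sum_congr rfl fun I _ => ?_
  ring

/-- In the Bochner formula for `|Γ|²` the reaction term is at most linear in the derivatives of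
`Γ`, with a factor `|Γ|`. Cauchy-Schwarz absorbs it in the two good terms `|∇Γ|²` and `|∂̄Γ|²`;
what remains is cubic. -/
lemma heat_calabi_le (H : 𝒟.MetricBound ev M g W) {s : ℝ} (hs : 1 ≤ s)
    (hΓ : ∀ i j k, Jet0 ev M 0 s (𝒟.gam g W i j k)) :
    (ev (𝒟.heat W (𝒟.calabi g W))).re ≤ M ^ 108 * s ^ 3 := by
  have hM4 := hM.out
  have h0 : 0 ≤ s := by linarith
  set X : Fin n → Matrix Unit (Fin n × Fin n × Fin n) R :=
    fun p => row fun i => 𝒟.covGam g W p i (𝒟.gam g W) with hX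
  set Y : Fin n → Matrix Unit (Fin n × Fin n × Fin n) R :=
    fun p => matDeriv (𝒟.db p) (row (𝒟.gam g W)) with hY
  set A := ∑ p, ∑ I, ‖ev (X p () I)‖ ^ 2 with hA
  set B := ∑ p, ∑ I, ‖ev (Y p () I)‖ ^ 2 with hB
  have hA0 : 0 ≤ A := by positivity
  have hB0 : 0 ≤ B := by positivity
  have hle : ∀ (Z : Fin n → Matrix Unit (Fin n × Fin n × Fin n) R) p I,
      ‖ev (Z p () I)‖ ^ 2 ≤ ∑ p, ∑ I, ‖ev (Z p () I)‖ ^ 2 := fun Z p I =>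
    (Finset.single_le_sum (f := fun I => ‖ev (Z p () I)‖ ^ 2) (fun _ _ => by positivity)
      (Finset.mem_univ I)).trans
    (Finset.single_le_sum (f := fun p => ∑ I, ‖ev (Z p () I)‖ ^ 2) (fun _ _ => by positivity)
      (Finset.mem_univ p))
  set q := Real.sqrt (A + B) with hq
  have hq0 : 0 ≤ q := Real.sqrt_nonneg _
  have hq2 : q ^ 2 = A + B := Real.sq_sqrt (by positivity)
  have hd : ∀ p i j k, Jet0 ev M 0 q (𝒟.covGam g W p i (𝒟.gam g W) j k) := by
    intro p i j k
    rw [Jet0, pow_zero, one_mul]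
    exact Real.le_sqrt_of_sq_le ((hle X p (i, j, k)).trans (by linarith))
  have hdb : ∀ p i j k, Jet0 ev M 0 q (𝒟.db p (𝒟.gam g W i j k)) := by
    intro p i j k
    rw [Jet0, pow_zero, one_mul]
    exact Real.le_sqrt_of_sq_le ((hle Y p (i, j, k)).trans (by linarith))
  set Q := s ^ 2 + q with hQ
  have hQ0 : 0 ≤ Q := by positivity
  have hsQ : s ^ 2 ≤ Q := by linarith
  have hDg0 := H.D_g h0 hΓ
  have hg : ∀ i j, 𝒟.Jet1 ev M 2 1 s (g i j) := fun i j =>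
    ⟨(H.g_le i j).mono (by omega) le_rfl, fun α => hDg0 α i j⟩
  have hW : ∀ i j, 𝒟.Jet1 ev M 6 1 s (W i j) := fun i j =>
    ⟨(H.W_le i j).mono (by omega) le_rfl, fun α => H.D_W h0 hDg0 α i j⟩
  have hΓ1 := gam_jet hs hq0 le_rfl hΓ hd hdb
  have hDg := H.D_g_jet hs hsQ hΓ1 hg
  have hEW := H.defect_mul_jet hs hsQ hW hDg
  have hθ := H.reaction_jet hs hsQ hΓ hΓ1 hEW
  -- the cross terms
  have h1 : ‖ev ((row (𝒟.reaction g W) * triple g W * (row (𝒟.gam g W)).conjTranspose) () ())‖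
      ≤ M ^ 51 * (Q * s) :=
    H.quad_jet hQ0 (k := 42) (l := 0) (fun u I => hθ _ _ _) (fun u I => hΓ _ _ _) le_rfl
      (by positivity)
  have h2 : ‖ev ((row (𝒟.gam g W) * triple g W * (tripleDer (𝒟.defect g W * W)).conjTranspose
            * (row (𝒟.gam g W)).conjTranspose) () ())‖ ≤ M ^ 52 * s ^ 3 := by
    refine Jet0.matMul card_triple_le (k := 49) (l := 0) (a := s ^ 2) (b := s) ?_
      (fun I u => (hΓ _ _ _).star) (by nlinarith) () ()
    exact Jet0.matMul card_triple_le (k := 6) (l := 40) (a := s) (b := s)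
      (Jet0.matMul card_triple_le (k := 0) (l := 3) (fun u I => hΓ _ _ _)
        H.triple_jet (by linarith))
      (fun I J => (tripleDer_jet h0 (fun i j => (hEW i j).1) J I).star) (by nlinarith)
  have h3 := H.sum_sq_le (W' := W.transpose) (by
    have := H.W_ge.transpose
    rwa [Matrix.transpose_sub, Matrix.transpose_smul, Matrix.transpose_one] at this) X
  have h4 := H.sum_sq_le H.W_ge Y
  rw [← hA] at h3
  rw [← hB, Finset.sum_comm] at h4
  rw [𝒟.heat_calabi H.inv H.hermG H.hermW]
  simp only [map_sub, map_add, map_star, Complex.sub_re, Complex.add_re, RCLike.star_def,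
    Complex.conj_re]
  have h1' := (Complex.re_le_norm _).trans h1
  have h2' := (Complex.re_le_norm _).trans h2
  simp only [Matrix.transpose_apply] at h3
  refine (sub_le_sub (sub_le_sub (add_le_add (add_le_add h1' h1') h2') h3) h4).trans ?_
  have hMi : M⁻¹ * (M⁻¹ * (M⁻¹ * M⁻¹)) = (M ^ 4)⁻¹ := by rw [← mul_inv, ← mul_inv, ← mul_inv]; ring
  rw [hMi]
  have hy : 2 * M ^ 51 * (q * s) ≤ (M ^ 4)⁻¹ * q ^ 2 + M ^ 106 * s ^ 2 := by
    have hsq := sq_nonneg ((M ^ 2)⁻¹ * q - M ^ 53 * s)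
    have e : ((M ^ 2)⁻¹ * q - M ^ 53 * s) ^ 2
        = (M ^ 4)⁻¹ * q ^ 2 + M ^ 106 * s ^ 2 - 2 * M ^ 51 * (q * s) := by
      field_simp
      ring
    linarith
  have hs3 : s ^ 2 ≤ s ^ 3 := pow_le_pow_right₀ hs (by norm_num)
  have hp1 : M ^ 51 ≤ M ^ 106 := pow_le_pow_right₀ (by linarith) (by norm_num)
  have hp2 : M ^ 52 ≤ M ^ 106 := pow_le_pow_right₀ (by linarith) (by norm_num)
  have hp3 : 4 * M ^ 106 ≤ M ^ 108 := by
    calc 4 * M ^ 106 = M ^ 106 * 4 := mul_comm _ _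
      _ ≤ M ^ 106 * (M * M) := by gcongr; nlinarith
      _ = M ^ 108 := by ring
  have hs0 : 0 ≤ s ^ 3 := by positivity
  have e1 := mul_le_mul_of_nonneg_right hp1 hs0
  have e2 := mul_le_mul_of_nonneg_right hp2 hs0
  have e3 := mul_le_mul_of_nonneg_right hp3 hs0
  have e4 := mul_le_mul_of_nonneg_left hs3 (show 0 ≤ M ^ 106 by positivity)
  have e5 : M ^ 51 * (Q * s) + M ^ 51 * (Q * s) + M ^ 52 * s ^ 3 - (M ^ 4)⁻¹ * A - (M ^ 4)⁻¹ * B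
      = 2 * (M ^ 51 * s ^ 3) + 2 * M ^ 51 * (q * s) + M ^ 52 * s ^ 3 - (M ^ 4)⁻¹ * (A + B) := by
    rw [hQ]; ring
  rw [e5, ← hq2]
  linarith

end MetricBound

end DiffOps

/-! ### The differential inequalities for the trace and for Calabi's quantity -/

namespace DiffOps

variable {n : ℕ} {R : Type*} [CommRing R] [StarRing R] [Algebra ℂ R]
  {𝒟 : DiffOps n R} {ev : R →⋆ₐ[ℂ] ℂ} {M : ℝ} [hM : Fact (4 ≤ M)] [hn : Fact ((n : ℝ) ≤ M)]
  {g W : Matrix (Fin n) (Fin n) R}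

omit [CommRing R] [StarRing R] [Algebra ℂ R] hM hn in
lemma heat_sum [CommRing R] [StarRing R] [Algebra ℂ R] (𝒟 : DiffOps n R)
    (W : Matrix (Fin n) (Fin n) R) {ι : Type*} (t : Finset ι) (f : ι → R) :
    𝒟.heat W (∑ i ∈ t, f i) = ∑ i ∈ t, 𝒟.heat W (f i) := by
  simp only [heat, lap, map_sum, Finset.mul_sum, Finset.sum_sub_distrib]
  congr 1
  calc _ = ∑ p, ∑ i ∈ t, ∑ q, W q p * 𝒟.d p (𝒟.db q (f i)) :=
        Finset.sum_congr rfl fun p _ => Finset.sum_comm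
    _ = _ := Finset.sum_comm

lemma jet_torTerm (H : 𝒟.MetricBound ev M g W) (i j : Fin n) :
    Jet0 ev M 5 1 (𝒟.torTerm g W i j) := by
  refine Jet0.sum (k := 4) fun k => Jet0.sum (k := 3) fun l => ?_
  exact Jet0.mul (k := 1) (l := 2) (H.W_le l k) ((D_star_tor_jet H (.inl i) j l k).1.add'
    (H.D_tor_le (.inr l) i k j).1) (by norm_num)

namespace MetricBound

omit hn in
lemma sum_gam_sq_le (H : 𝒟.MetricBound ev M g W) :
    M⁻¹ * (M⁻¹ * M⁻¹) * ∑ I : Fin n × Fin n × Fin n, ‖ev (𝒟.gam g W I.1 I.2.1 I.2.2)‖ ^ 2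
      ≤ (ev (𝒟.calabi g W)).re := by
  refine (le_quadForm H.triple_ge fun I => ev (𝒟.gam g W I.1 I.2.1 I.2.2)).trans
    (le_of_eq (congrArg Complex.re ?_))
  have ht : ∀ I J, ev (triple g W I J) = triple (g.map ev) (W.map ev) I J := by
    intro I J; simp [triple]
  simp only [calabi, Matrix.mul_apply, map_sum, map_mul, ht, Matrix.conjTranspose_apply, map_star,
    Finset.sum_mul, row, Matrix.of_apply]
  exact Finset.sum_comm

omit hn in
lemma calabi_nonneg (H : 𝒟.MetricBound ev M g W) : 0 ≤ (ev (𝒟.calabi g W)).re := by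
  have := hM.out
  exact le_trans (by positivity) H.sum_gam_sq_le

omit hn in
lemma gam_le_calabi (H : 𝒟.MetricBound ev M g W) (i j k : Fin n) :
    ‖ev (𝒟.gam g W i j k)‖ ^ 2 ≤ M ^ 3 * (ev (𝒟.calabi g W)).re := by
  have hM4 := hM.out
  have h2 := H.sum_gam_sq_le
  set F : Fin n × Fin n × Fin n → ℝ := fun I => ‖ev (𝒟.gam g W I.1 I.2.1 I.2.2)‖ ^ 2 with hF
  have h1 : F (i, j, k) ≤ ∑ I, F I :=
    Finset.single_le_sum (fun I _ => by rw [hF]; positivity) (Finset.mem_univ _)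
  have h3 : M⁻¹ * (M⁻¹ * M⁻¹) = (M ^ 3)⁻¹ := by rw [← mul_inv, ← mul_inv]; ring
  rw [h3, inv_mul_le_iff₀ (show 0 < M ^ 3 by positivity)] at h2
  exact h1.trans h2

omit hn in
lemma gam_le_sqrt_calabi (H : 𝒟.MetricBound ev M g W) (i j k : Fin n) :
    Jet0 ev M 0 (M ^ 2 * √(ev (𝒟.calabi g W)).re) (𝒟.gam g W i j k) := by
  have hM4 := hM.out
  have h0 := H.calabi_nonneg
  rw [Jet0, pow_zero, one_mul]
  refine le_of_sq_le_sq ((H.gam_le_calabi i j k).trans ?_) (by positivity)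
  rw [mul_pow, Real.sq_sqrt h0]
  gcongr
  rw [← pow_mul]
  exact pow_le_pow_right₀ (by linarith) (by norm_num)

lemma calabi_le (H : 𝒟.MetricBound ev M g W) {k : ℕ} {s : ℝ} (hs : 0 ≤ s)
    (hΓ : ∀ i j l, Jet0 ev M k s (𝒟.gam g W i j l)) :
    (ev (𝒟.calabi g W)).re ≤ M ^ (2 * k + 9) * s ^ 2 := by
  refine (Complex.re_le_norm _).trans ?_
  rw [two_mul]
  exact H.quad_jet hs (fun u I => hΓ _ _ _) (fun u I => hΓ _ _ _) (by nlinarith) (by positivity)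

/-- The evolution of Calabi's quantity closes up at order `3/2`. -/
lemma heat_calabi_le_rpow (H : 𝒟.MetricBound ev M g W) {s : ℝ} (hs : 1 ≤ s) :
    (ev (𝒟.heat W (𝒟.calabi g W))).re
      ≤ M ^ 116 * (s * (ev (𝒟.calabi g W)).re * √(ev (𝒟.calabi g W)).re + s ^ 4) := by
  have hM4 := hM.out
  set y := √(ev (𝒟.calabi g W)).re with hy
  have hy0 : 0 ≤ y := Real.sqrt_nonneg _
  have hS : (ev (𝒟.calabi g W)).re = y ^ 2 := (Real.sq_sqrt H.calabi_nonneg).symm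
  have hM2 : 1 ≤ M ^ 2 := one_le_pow₀ (by linarith)
  have h := H.heat_calabi_le (s := 1 + M ^ 2 * y)
      (by nlinarith [mul_nonneg (by positivity : 0 ≤ M ^ 2) hy0])
    (fun i j k => (H.gam_le_sqrt_calabi i j k).mono le_rfl (by linarith))
  refine h.trans ?_
  rw [hS]
  have hz : 0 ≤ M ^ 2 * y := by positivity
  have h1 : (1 + M ^ 2 * y) ^ 3 ≤ 4 * (1 + (M ^ 2 * y) ^ 3) := by
    nlinarith [mul_nonneg (add_nonneg zero_le_one hz) (sq_nonneg (1 - M ^ 2 * y))]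
  have h2 : 4 * (1 + (M ^ 2 * y) ^ 3) ≤ M ^ 8 * (s * y ^ 2 * y + s ^ 4) := by
    have e1 : (1 : ℝ) ≤ s ^ 4 := one_le_pow₀ hs
    have e2 : (M ^ 2 * y) ^ 3 ≤ M ^ 6 * (s * y ^ 2 * y) := by
      have : y ^ 3 ≤ s * y ^ 3 := le_mul_of_one_le_left (by positivity) hs
      calc (M ^ 2 * y) ^ 3 = M ^ 6 * y ^ 3 := by ring
        _ ≤ M ^ 6 * (s * y ^ 3) := by gcongr
        _ = _ := by ring
    have e3 : (1 : ℝ) ≤ M ^ 6 := one_le_pow₀ (by linarith)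
    have e4 : 1 ≤ M ^ 6 * s ^ 4 := by nlinarith
    have e5 : 4 ≤ M ^ 2 := by nlinarith
    calc 4 * (1 + (M ^ 2 * y) ^ 3) ≤ 4 * (M ^ 6 * s ^ 4 + M ^ 6 * (s * y ^ 2 * y)) := by gcongr
      _ ≤ M ^ 2 * (M ^ 6 * s ^ 4 + M ^ 6 * (s * y ^ 2 * y)) := by gcongr
      _ = _ := by ring
  calc _ ≤ M ^ 108 * (M ^ 8 * (s * y ^ 2 * y + s ^ 4)) := by gcongr; exact h1.trans h2
    _ = _ := by ring

/-- The trace of the metric is a subsolution with Calabi's quantity as a good term. -/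
lemma heat_trace_le (H : 𝒟.MetricBound ev M g W) :
    (ev (𝒟.heat W g.trace)).re ≤ -(M ^ 15)⁻¹ * (ev (𝒟.calabi g W)).re + M ^ 6 := by
  have hM4 := hM.out
  have h0 : 0 ≤ M⁻¹ := by positivity
  have hWT : ((W.transpose.map ev) - ((M⁻¹ : ℝ) : ℂ) • (1 : Matrix (Fin n) (Fin n) ℂ)).PosSemidef
      := by
    have := H.W_ge.transpose
    rwa [Matrix.transpose_sub, Matrix.transpose_smul, Matrix.transpose_one] at this
  set m2 := ∑ i, ∑ I : Fin n × Fin n, ‖ev (𝒟.d i (g I.1 I.2))‖ ^ 2 with hm2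
  have hm0 : 0 ≤ m2 := by positivity
  have hgood : ∀ i, M⁻¹ * M⁻¹ * ∑ I : Fin n × Fin n, ‖ev (𝒟.d i (g I.1 I.2))‖ ^ 2
      ≤ (ev (∑ k, ∑ l, ∑ a, ∑ b, W l a * W b k * (𝒟.d i (g a b) * 𝒟.db i (g k l)))).re := by
    intro i
    refine (le_quadForm (posSemidef_kronecker_sub h0 h0 hWT H.W_ge)
      fun I : Fin n × Fin n => ev (𝒟.d i (g I.1 I.2))).trans (le_of_eq (congrArg Complex.re ?_))
    have e : ∀ k l, 𝒟.db i (g k l) = star (𝒟.d i (g l k)) := fun k l => by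
      rw [𝒟.star_d, H.hermG.apply]
    simp only [Fintype.sum_prod_type, map_sum, map_mul, e, map_star, Matrix.kroneckerMap_apply,
      Matrix.map_apply, Matrix.transpose_apply]
    calc _ = ∑ a, ∑ l, ∑ b, ∑ k, ev (𝒟.d i (g a b)) * (ev (W l a) * ev (W b k))
          * star (ev (𝒟.d i (g l k))) := Finset.sum_congr rfl fun a _ => Finset.sum_comm
      _ = ∑ a, ∑ l, ∑ k, ∑ b, ev (𝒟.d i (g a b)) * (ev (W l a) * ev (W b k))
          * star (ev (𝒟.d i (g l k))) :=
        Finset.sum_congr rfl fun a _ => Finset.sum_congr rfl fun l _ => Finset.sum_comm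
      _ = ∑ a, ∑ k, ∑ l, ∑ b, ev (𝒟.d i (g a b)) * (ev (W l a) * ev (W b k))
          * star (ev (𝒟.d i (g l k))) := Finset.sum_congr rfl fun a _ => Finset.sum_comm
      _ = ∑ k, ∑ a, ∑ l, ∑ b, ev (𝒟.d i (g a b)) * (ev (W l a) * ev (W b k))
          * star (ev (𝒟.d i (g l k))) := Finset.sum_comm
      _ = ∑ k, ∑ l, ∑ a, ∑ b, ev (𝒟.d i (g a b)) * (ev (W l a) * ev (W b k))
          * star (ev (𝒟.d i (g l k))) := Finset.sum_congr rfl fun k _ => Finset.sum_comm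
      _ = _ := by
        refine Finset.sum_congr rfl fun k _ => Finset.sum_congr rfl fun l _ =>
          Finset.sum_congr rfl fun a _ => Finset.sum_congr rfl fun b _ => ?_
        ring
  have hm : ∀ i a b, Jet0 ev M 0 (√m2) (𝒟.d i (g a b)) := by
    intro i a b
    rw [Jet0, pow_zero, one_mul]
    refine Real.le_sqrt_of_sq_le ?_
    exact (Finset.single_le_sum (f := fun I : Fin n × Fin n => ‖ev (𝒟.d i (g I.1 I.2))‖ ^ 2)
      (fun _ _ => by positivity) (Finset.mem_univ (a, b))).trans
      (Finset.single_le_sum (f := fun i => ∑ I : Fin n × Fin n, ‖ev (𝒟.d i (g I.1 I.2))‖ ^ 2)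
        (fun _ _ => by positivity) (Finset.mem_univ i))
  have hΓ : ∀ i j l, Jet0 ev M 2 (√m2) (𝒟.gam g W i j l) := fun i j l =>
    Jet0.matMul_fin (A := matDeriv (𝒟.d i) g) (hm i) H.W_le (by linarith) j l
  have hS := H.calabi_le (Real.sqrt_nonneg m2) hΓ
  rw [Real.sq_sqrt hm0] at hS
  have htr : 𝒟.heat W g.trace = ∑ i, 𝒟.torTerm g W i i
      - ∑ i, ∑ k, ∑ l, ∑ a, ∑ b, W l a * W b k * (𝒟.d i (g a b) * 𝒟.db i (g k l)) := by
    rw [Matrix.trace, heat_sum, ← Finset.sum_sub_distrib]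
    exact Finset.sum_congr rfl fun i _ => H.flow.heat_metric H.inv H.hermG i i
  have ht : ‖ev (∑ i, 𝒟.torTerm g W i i)‖ ≤ M ^ 6 * 1 := Jet0.sum fun i => jet_torTerm H i i
  have hg := Finset.sum_le_sum fun i (_ : i ∈ Finset.univ) => hgood i
  rw [← Finset.mul_sum, ← Complex.re_sum, ← map_sum] at hg
  rw [htr, map_sub, Complex.sub_re]
  have ht' := (Complex.re_le_norm _).trans ht
  have e : (M ^ 15)⁻¹ * (ev (𝒟.calabi g W)).re ≤ M⁻¹ * M⁻¹ * m2 := by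
    rw [inv_mul_le_iff₀ (by positivity)]
    calc _ ≤ M ^ (2 * 2 + 9) * m2 := hS
      _ = M ^ 15 * (M⁻¹ * M⁻¹ * m2) := by
        norm_num only
        field_simp
  linarith

lemma d_trace_le (H : 𝒟.MetricBound ev M g W) (p : Fin n) :
    ‖ev (𝒟.d p g.trace)‖ ≤ M ^ 5 * √(ev (𝒟.calabi g W)).re := by
  have h : Jet0 ev M 3 (M ^ 2 * √(ev (𝒟.calabi g W)).re) (𝒟.d p g.trace) := by
    have := hM.out
    rw [Matrix.trace, map_sum]
    exact Jet0.sum (fun i => H.D_g (by positivity) H.gam_le_sqrt_calabi (.inl p) i i)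
  refine h.trans (le_of_eq ?_)
  ring

end MetricBound

end DiffOps

/-! ### The differential inequalities for the first and second derivatives of the metric -/

/-- Absorbing the top order term in the evolution of the second derivatives. -/
lemma bernstein_arith {M s p h : ℝ} (hM : 4 ≤ M) (hp : 0 ≤ p) :
    M ^ 6 * (2 * (p * (M ^ 42 * ((s ^ 2 + p) ^ 2 + s * h)))) - M⁻¹ * h ^ 2
      ≤ M ^ 102 * (p ^ 2 * p + s ^ 6) := by
  have hM0 : 0 < M := by linarith
  have hM1 : 1 ≤ M := by linarith
  have hy : 2 * M ^ 48 * (s * p * h) ≤ M⁻¹ * h ^ 2 + M ^ 97 * (s * p) ^ 2 := by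
    have hsq := mul_nonneg (inv_nonneg.mpr hM0.le) (sq_nonneg (h - M ^ 49 * (s * p)))
    have e : M⁻¹ * (h - M ^ 49 * (s * p)) ^ 2
        = M⁻¹ * h ^ 2 + M ^ 97 * (s * p) ^ 2 - 2 * M ^ 48 * (s * p * h) := by
      field_simp
      ring
    linarith
  have e1 : M ^ 6 * (2 * (p * (M ^ 42 * ((s ^ 2 + p) ^ 2 + s * h))))
      = 2 * M ^ 48 * (s * p * h) + 2 * M ^ 48 * (p * (s ^ 2 + p) ^ 2) := by ring
  have ht : 0 ≤ s ^ 2 := sq_nonneg s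
  have e0 : s ^ 6 = (s ^ 2) ^ 3 := by ring
  have e0' : (s * p) ^ 2 = s ^ 2 * p ^ 2 := by ring
  rw [e1, e0]
  rw [e0'] at hy
  generalize s ^ 2 = t at *
  have ht3 : 0 ≤ t ^ 3 := by positivity
  have hp3 : 0 ≤ p ^ 3 := by positivity
  -- both `a b²` and `a² b` are at most `a³ + b³`
  have k1 : t * p ^ 2 ≤ p ^ 2 * p + t ^ 3 := by
    rcases le_total t p with hle | hle
    · have := mul_le_mul_of_nonneg_right hle (sq_nonneg p); linarith
    · have := mul_le_mul_of_nonneg_left (pow_le_pow_left₀ hp hle 2) ht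
      have e : t * t ^ 2 = t ^ 3 := by ring
      have e' : p ^ 2 * p = p ^ 3 := by ring
      linarith
  have k2 : p * t ^ 2 ≤ p ^ 2 * p + t ^ 3 := by
    rcases le_total p t with hle | hle
    · have := mul_le_mul_of_nonneg_right hle (sq_nonneg t)
      have e : t * t ^ 2 = t ^ 3 := by ring
      have e' : p ^ 2 * p = p ^ 3 := by ring
      linarith
    · have := mul_le_mul_of_nonneg_left (pow_le_pow_left₀ ht hle 2) hp
      have e : p * p ^ 2 = p ^ 2 * p := by ring
      linarith
  set Z := p ^ 2 * p + t ^ 3 with hZ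
  have hZ0 : 0 ≤ Z := by positivity
  have k3 : p * (t + p) ^ 2 ≤ 4 * Z := by
    have : p * (t + p) ^ 2 = p * t ^ 2 + 2 * (t * p ^ 2) + p ^ 2 * p := by ring
    linarith
  have e4 : 2 * M ^ 48 * (p * (t + p) ^ 2) ≤ M ^ 100 * Z := by
    calc 2 * M ^ 48 * (p * (t + p) ^ 2) ≤ 2 * M ^ 48 * (4 * Z) := by gcongr
      _ = (2 * 4) * (M ^ 48 * Z) := by ring
      _ ≤ (M * M) * (M ^ 48 * Z) := by
        gcongr
        linarith
      _ = M ^ 50 * Z := by ring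
      _ ≤ M ^ 100 * Z := by
        gcongr
        norm_num
  have e5 : M ^ 97 * (t * p ^ 2) ≤ M ^ 100 * Z := by
    calc M ^ 97 * (t * p ^ 2) ≤ M ^ 97 * Z := by gcongr
      _ ≤ M ^ 100 * Z := by
        gcongr
        norm_num
  have e6 : M ^ 100 * Z + M ^ 100 * Z ≤ M ^ 102 * Z := by
    calc M ^ 100 * Z + M ^ 100 * Z = (2 * 1) * (M ^ 100 * Z) := by ring
      _ ≤ (M * M) * (M ^ 100 * Z) := by
        gcongr
        linarith
      _ = _ := by ring
  linarith

namespace DiffOps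

variable {n : ℕ} {R : Type*} [CommRing R] [StarRing R] [Algebra ℂ R]

section

variable (𝒟 : DiffOps n R) {W : Matrix (Fin n) (Fin n) R}

lemma dt_D (α) (f : R) : 𝒟.dt (𝒟.D α f) = 𝒟.D α (𝒟.dt f) := by
  rcases α with i | i
  exacts [𝒟.dt_d i f, 𝒟.dt_db i f]

lemma heat_D (W : Matrix (Fin n) (Fin n) R) (α) (f : R) :
    𝒟.heat W (𝒟.D α f) = 𝒟.D α (𝒟.heat W f)
      + ∑ p, ∑ q, 𝒟.D α (W q p) * 𝒟.d p (𝒟.db q f) := by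
  have h : ∀ p q, 𝒟.d p (𝒟.db q (𝒟.D α f)) = 𝒟.D α (𝒟.d p (𝒟.db q f)) := by
    intro p q
    have h1 : 𝒟.db q (𝒟.D α f) = 𝒟.D α (𝒟.db q f) := 𝒟.D_comm (.inr q) α f
    rw [h1]
    exact 𝒟.D_comm (.inl p) α _
  simp only [heat, lap, map_sub, map_sum, Derivation.leibniz, smul_eq_mul, dt_D, h,
    Finset.sum_add_distrib]
  have : ∀ p q, 𝒟.d p (𝒟.db q f) * 𝒟.D α (W q p) = 𝒟.D α (W q p) * 𝒟.d p (𝒟.db q f) :=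
    fun _ _ => mul_comm _ _
  simp only [this]
  ring

lemma heat_star (hW : W.IsHermitian) (f : R) : 𝒟.heat W (star f) = star (𝒟.heat W f) := by
  simp only [heat, lap, star_sub, 𝒟.star_dt, star_sum, star_mul', 𝒟.star_d, 𝒟.star_db, hW.apply]
  congr 1
  rw [Finset.sum_comm]
  simp only [𝒟.d_db]

lemma heat_mul (W : Matrix (Fin n) (Fin n) R) (f h : R) :
    𝒟.heat W (f * h) = 𝒟.heat W f * h + f * 𝒟.heat W h
      - ∑ p, ∑ q, W q p * (𝒟.d p f * 𝒟.db q h + 𝒟.db q f * 𝒟.d p h) := by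
  have e : ∀ p q, W q p * 𝒟.d p (𝒟.db q (f * h))
      = W q p * 𝒟.d p (𝒟.db q f) * h + f * (W q p * 𝒟.d p (𝒟.db q h))
        + W q p * (𝒟.d p f * 𝒟.db q h + 𝒟.db q f * 𝒟.d p h) := by
    intro p q
    simp only [Derivation.leibniz, map_add, smul_eq_mul]
    ring
  simp only [heat, lap]
  simp only [e]
  simp only [Finset.sum_add_distrib, ← Finset.sum_mul, ← Finset.mul_sum]
  rw [Derivation.leibniz, smul_eq_mul, smul_eq_mul]
  ring

end

variable {𝒟 : DiffOps n R} {ev : R →⋆ₐ[ℂ] ℂ} {M : ℝ} [hM : Fact (4 ≤ M)] [hn : Fact ((n : ℝ) ≤ M)]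
  {g W : Matrix (Fin n) (Fin n) R}

namespace MetricBound

omit hM hn in
lemma W_ge_transpose (H : 𝒟.MetricBound ev M g W) :
    (W.transpose.map ev - ((M⁻¹ : ℝ) : ℂ) • (1 : Matrix (Fin n) (Fin n) ℂ)).PosSemidef := by
  have := H.W_ge.transpose
  rwa [Matrix.transpose_sub, Matrix.transpose_smul, Matrix.transpose_one] at this

omit hM hn in
/-- Bochner's inequality for the squared modulus of a function. -/
lemma heat_normSq_le (H : 𝒟.MetricBound ev M g W) (f : R) :
    (ev (𝒟.heat W (star f * f))).re
      ≤ 2 * (‖ev f‖ * ‖ev (𝒟.heat W f)‖) - M⁻¹ * ∑ α, ‖ev (𝒟.D α f)‖ ^ 2 := by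
  have h1 : M⁻¹ * ∑ p, ‖ev (𝒟.d p f)‖ ^ 2
      ≤ (ev (∑ p, ∑ q, W q p * (𝒟.d p f * 𝒟.db q (star f)))).re := by
    refine (le_quadForm H.W_ge_transpose fun p => ev (𝒟.d p f)).trans
      (le_of_eq (congrArg Complex.re ?_))
    simp only [map_sum, map_mul, ← 𝒟.star_d, map_star, Matrix.map_apply, Matrix.transpose_apply]
    exact Finset.sum_congr rfl fun p _ => Finset.sum_congr rfl fun q _ => by ring
  have h2 : M⁻¹ * ∑ p, ‖ev (𝒟.db p f)‖ ^ 2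
      ≤ (ev (∑ p, ∑ q, W q p * (𝒟.db q f * 𝒟.d p (star f)))).re := by
    refine (le_quadForm H.W_ge fun p => ev (𝒟.db p f)).trans
      (le_of_eq (congrArg Complex.re ?_))
    rw [Finset.sum_comm]
    simp only [map_sum, map_mul, ← 𝒟.star_db, map_star, Matrix.map_apply]
    exact Finset.sum_congr rfl fun p _ => Finset.sum_congr rfl fun q _ => by ring
  have h3 : 𝒟.heat W (star f * f) = star f * 𝒟.heat W f + star (star f * 𝒟.heat W f)
      - ∑ p, ∑ q, W q p * (𝒟.d p f * 𝒟.db q (star f))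
      - ∑ p, ∑ q, W q p * (𝒟.db q f * 𝒟.d p (star f)) := by
    rw [mul_comm (star f) f, heat_mul, heat_star _ H.hermW]
    simp only [mul_add, Finset.sum_add_distrib, star_mul', star_star]
    ring
  have h4 : (ev (star f * 𝒟.heat W f)).re ≤ ‖ev f‖ * ‖ev (𝒟.heat W f)‖ := by
    refine (Complex.re_le_norm _).trans (le_of_eq ?_)
    rw [map_mul, map_star, norm_mul, norm_star]
  rw [h3, map_sub, map_sub, map_add, map_star, Complex.sub_re, Complex.sub_re, Complex.add_re,
    RCLike.star_def, Complex.conj_re, Fintype.sum_sum_type, mul_add]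
  change _ ≤ _ - (M⁻¹ * ∑ p, ‖ev (𝒟.d p f)‖ ^ 2 + M⁻¹ * ∑ p, ‖ev (𝒟.db p f)‖ ^ 2)
  linarith

section Bernstein

variable {s q C : ℝ}

lemma W_jet2 (H : 𝒟.MetricBound ev M g W) (hs : 1 ≤ s) (hq : s ^ 2 ≤ q)
    (hg : ∀ α i j, 𝒟.Jet1 ev M 0 s q (𝒟.D α (g i j))) (i j : Fin n) :
    𝒟.Jet2 ev M 12 1 s q (W i j) := by
  have h0 : 0 ≤ s := by linarith
  have hq0 : 0 ≤ q := by nlinarith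
  have hW : ∀ i j, 𝒟.Jet1 ev M 4 1 s (W i j) := fun i j =>
    ⟨(H.W_le i j).mono (by omega) le_rfl, fun α =>
      (H.D_W h0 (fun α i j => (hg α i j).1) α i j).mono (by omega) le_rfl⟩
  refine ⟨(H.W_le i j).mono (by omega) le_rfl, fun α => ?_⟩
  have h := congrFun (congrFun (H.D_W_eq α) i) j
  rw [matDeriv_apply, Matrix.neg_apply] at h
  rw [h]
  refine (Jet1.mono (Jet1.matMul_fin (c := s) (d := q) (Jet1.matMul_fin (c := s) (d := q) hW (hg α)
    (by linarith) (by linarith) (by nlinarith)) hW (by linarith) (by nlinarith) (by linarith) i j)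
    (by omega) le_rfl le_rfl).neg

/-- The right hand side of the flow, as a quasilinear system, and its derivatives. -/
lemma heat_metric_jet (H : 𝒟.MetricBound ev M g W) (hs : 1 ≤ s) (hq : s ^ 2 ≤ q)
    (hC : s * q ≤ C) (hC' : q ^ 2 ≤ C) {h : ℝ} (hh : s * h ≤ C)
    (hg : ∀ α i j, 𝒟.Jet2 ev M 0 s q h (𝒟.D α (g i j))) (i j : Fin n) :
    𝒟.Jet2 ev M 40 (s ^ 2) (s * q) C (𝒟.heat W (g i j)) := by
  have h0 : 0 ≤ s := by linarith
  have hq0 : 0 ≤ q := by nlinarith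
  have hq1 : 1 ≤ q := by nlinarith
  have hC0 : 0 ≤ C := by nlinarith
  have hsq : s ≤ s * q := by nlinarith
  have hs2 : s ≤ s ^ 2 := by nlinarith
  have hqC : q ≤ C := by nlinarith
  have hW := H.W_jet2 hs hq fun α i j => (hg α i j).jet1
  rw [H.flow.heat_metric H.inv H.hermG]
  refine Jet2.sub (k := 39) (l := 39) ?_ ?_
  · refine (Jet2.sum (k := 17) (a := s ^ 2) (b := s * q) (c := C) fun k =>
      Jet2.sum (k := 16) fun l => ?_).mono (by omega) le_rfl le_rfl le_rfl
    refine Jet2.mul (l := 2) (a' := 1) (b' := 1) (c' := 1) (hW l k) ?_ (by nlinarith) (by nlinarith)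
      (by nlinarith) (by nlinarith) (by nlinarith) (by nlinarith)
    exact (D_star_tor_jet H (.inl i) j l k).add' (H.D_tor_le (.inr l) i k j)
  · refine (Jet2.sum (k := 33) fun k => Jet2.sum (k := 32) fun l => Jet2.sum (k := 31) fun a =>
      Jet2.sum (k := 30) fun b => ?_).mono (by omega) le_rfl le_rfl le_rfl
    have hWW : 𝒟.Jet2 ev M 26 1 s q (W l a * W b k) :=
      (hW l a).mul (hW b k) (by linarith) (by linarith) (by linarith) (by linarith) (by nlinarith)
        (by linarith)
    have hgg : 𝒟.Jet2 ev M 2 (s ^ 2) (s * q) C (𝒟.d i (g a b) * 𝒟.db j (g k l)) :=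
      (hg (.inl i) a b).mul (hg (.inr j) k l) (by nlinarith) le_rfl (by linarith) hh (by nlinarith)
        (by linarith)
    refine hWW.mul hgg (by linarith) (by linarith) ?_ (by linarith) ?_ ?_
    · nlinarith
    · nlinarith
    · nlinarith

/-- Differentiating `heat_metric` once; the commutator of `∂_α` with the Laplacian costs `∂W *
∂∂g`. -/
lemma heat_D_jet (H : 𝒟.MetricBound ev M g W) (hs : 1 ≤ s) (hq : s ^ 2 ≤ q)
    (hC : s * q ≤ C) (hC' : q ^ 2 ≤ C) {h : ℝ} (hh : s * h ≤ C)
    (hg : ∀ α i j, 𝒟.Jet2 ev M 0 s q h (𝒟.D α (g i j))) (α) (i j : Fin n) :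
    𝒟.Jet1 ev M 41 (s * q) C (𝒟.heat W (𝒟.D α (g i j))) := by
  have h0 : 0 ≤ s := by linarith
  have hq0 : 0 ≤ q := by nlinarith
  have hC0 : 0 ≤ C := by nlinarith
  have hW := H.W_jet2 hs hq fun α i j => (hg α i j).jet1
  rw [heat_D]
  refine Jet1.add' (k := 40) ((H.heat_metric_jet hs hq hC hC' hh hg i j).D α) ?_
  refine (Jet1.sum (k := 14) fun p => Jet1.sum (k := 13) fun r => ?_).mono (by omega) le_rfl le_rfl
  exact Jet1.mul (k := 12) (l := 0) ((hW r p).D α) ((hg (.inr r) i j).D (.inl p)) (by linarith) hh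
    (by nlinarith)

/-- Differentiating `heat_metric` twice. The third derivatives of `g`, bounded by `h`, enter
linearly and with a factor `s`. -/
lemma heat_D_D_jet (H : 𝒟.MetricBound ev M g W) (hs : 1 ≤ s) (hq : s ^ 2 ≤ q)
    (hC : s * q ≤ C) (hC' : q ^ 2 ≤ C) {h : ℝ} (hh : s * h ≤ C)
    (hg : ∀ α i j, 𝒟.Jet2 ev M 0 s q h (𝒟.D α (g i j))) (α β) (i j : Fin n) :
    Jet0 ev M 42 C (𝒟.heat W (𝒟.D α (𝒟.D β (g i j)))) := by
  have h0 : 0 ≤ s := by linarith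
  have hC0 : 0 ≤ C := by nlinarith
  have hW := H.W_jet2 hs hq fun α i j => (hg α i j).jet1
  rw [heat_D]
  refine Jet0.add' (k := 41) ((H.heat_D_jet hs hq hC hC' hh hg β i j).2 α) ?_
  refine (Jet0.sum (k := 13) fun p => Jet0.sum (k := 12) fun r => ?_).mono (by omega) le_rfl
  refine Jet0.mul (k := 12) (l := 0) ((hW r p).jet1.2 α) (a' := h) ?_ hh
  change Jet0 ev M 0 h (𝒟.D (.inl p) (𝒟.D (.inr r) (𝒟.D β (g i j))))
  exact ((hg β i j).2 (.inr r)).2 (.inl p)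

end Bernstein

end MetricBound

/-- The squared length `∑ |∂_α g_{i \bar j}|²` of all first derivatives of the metric. -/
def gradSq (𝒟 : DiffOps n R) (g : Matrix (Fin n) (Fin n) R) : R :=
  ∑ I : (Fin n ⊕ Fin n) × Fin n × Fin n,
    star (𝒟.D I.1 (g I.2.1 I.2.2)) * 𝒟.D I.1 (g I.2.1 I.2.2)

/-- The squared length `∑ |∂_α ∂_β g_{i \bar j}|²` of all second derivatives of the metric. -/
def hessSq (𝒟 : DiffOps n R) (g : Matrix (Fin n) (Fin n) R) : R :=
  ∑ I : ((Fin n ⊕ Fin n) × (Fin n ⊕ Fin n)) × Fin n × Fin n,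
    star (𝒟.D I.1.1 (𝒟.D I.1.2 (g I.2.1 I.2.2))) * 𝒟.D I.1.1 (𝒟.D I.1.2 (g I.2.1 I.2.2))

omit hM hn in
lemma ev_sum_star_mul {ι : Type*} (t : Finset ι) (f : ι → R) :
    ev (∑ i ∈ t, star (f i) * f i) = ((∑ i ∈ t, ‖ev (f i)‖ ^ 2 : ℝ) : ℂ) := by
  rw [map_sum, Complex.ofReal_sum]
  refine Finset.sum_congr rfl fun i _ => ?_
  rw [map_mul, map_star, RCLike.star_def, Complex.conj_mul']
  push_cast
  rfl

omit hM hn in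
lemma norm_sq_le_of_ev_sum {ι : Type*} [Fintype ι] (f : ι → R) (i : ι) :
    ‖ev (f i)‖ ≤ √(ev (∑ i, star (f i) * f i)).re := by
  rw [ev_sum_star_mul, Complex.ofReal_re]
  exact Real.le_sqrt_of_sq_le (Finset.single_le_sum (f := fun i => ‖ev (f i)‖ ^ 2)
    (fun _ _ => by positivity) (Finset.mem_univ i))

lemma card_grad_le : (Fintype.card ((Fin n ⊕ Fin n) × Fin n × Fin n) : ℝ) ≤ M ^ 4 := by
  have h := hn.out
  have h4 := hM.out
  simp only [Fintype.card_prod, Fintype.card_sum, Fintype.card_fin, Nat.cast_mul, Nat.cast_add]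
  calc ((n : ℝ) + n) * (n * n) ≤ (M + M) * (M * M) := by gcongr
    _ ≤ (M * M) * (M * M) := by gcongr; nlinarith
    _ = M ^ 4 := by ring

lemma card_hess_le :
    (Fintype.card (((Fin n ⊕ Fin n) × (Fin n ⊕ Fin n)) × Fin n × Fin n) : ℝ) ≤ M ^ 6 := by
  have h := hn.out
  have h4 := hM.out
  simp only [Fintype.card_prod, Fintype.card_sum, Fintype.card_fin, Nat.cast_mul, Nat.cast_add]
  calc (((n : ℝ) + n) * (n + n)) * (n * n) ≤ ((M + M) * (M + M)) * (M * M) := by gcongr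
    _ ≤ ((M * M) * (M * M)) * (M * M) := by gcongr <;> nlinarith
    _ = M ^ 6 := by ring

omit hM hn in
lemma MetricBound.heat_sum_le (H : 𝒟.MetricBound ev M g W) {ι : Type*} [Fintype ι] {e : ℕ}
    (he : (Fintype.card ι : ℝ) ≤ M ^ e) (f : ι → R) {a b : ℝ} (ha : ∀ i, ‖ev (f i)‖ ≤ a)
    (hb : ∀ i, ‖ev (𝒟.heat W (f i))‖ ≤ b) (ha0 : 0 ≤ a) (hb0 : 0 ≤ b) :
    (ev (𝒟.heat W (∑ i, star (f i) * f i))).re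
      ≤ M ^ e * (2 * (a * b)) - M⁻¹ * ∑ i, ∑ α, ‖ev (𝒟.D α (f i))‖ ^ 2 := by
  rw [heat_sum, map_sum, Complex.re_sum]
  calc _ ≤ ∑ i, (2 * (a * b) - M⁻¹ * ∑ α, ‖ev (𝒟.D α (f i))‖ ^ 2) := by
        refine Finset.sum_le_sum fun i _ => (H.heat_normSq_le (f i)).trans ?_
        have := mul_le_mul (ha i) (hb i) (norm_nonneg _) ha0
        linarith
    _ = Fintype.card ι * (2 * (a * b)) - M⁻¹ * ∑ i, ∑ α, ‖ev (𝒟.D α (f i))‖ ^ 2 := by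
        rw [Finset.sum_sub_distrib, Finset.sum_const, Finset.card_univ, nsmul_eq_mul,
          Finset.mul_sum]
    _ ≤ _ := by gcongr

namespace MetricBound

section

variable {s : ℝ}

/-- Bernstein's estimate for the first derivatives. -/
lemma heat_gradSq_le (H : 𝒟.MetricBound ev M g W) (hs : 1 ≤ s)
    (hg : ∀ α i j, Jet0 ev M 0 s (𝒟.D α (g i j))) :
    (ev (𝒟.heat W (𝒟.gradSq g))).re ≤ -(M ^ 2)⁻¹ * (ev (𝒟.hessSq g)).re + M ^ 94 * s ^ 4 := by
  have hM4 := hM.out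
  have h0 : 0 ≤ s := by linarith
  have hP : (ev (𝒟.hessSq g)).re = ∑ I : (Fin n ⊕ Fin n) × Fin n × Fin n,
      ∑ α, ‖ev (𝒟.D α (𝒟.D I.1 (g I.2.1 I.2.2)))‖ ^ 2 := by
    rw [hessSq, ev_sum_star_mul, Complex.ofReal_re, Fintype.sum_prod_type, Fintype.sum_prod_type,
      Finset.sum_comm, Fintype.sum_prod_type]
    exact Finset.sum_congr rfl fun α _ => Finset.sum_comm
  set P := (ev (𝒟.hessSq g)).re with hPdef
  have hP0 : 0 ≤ P := by rw [hP]; positivity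
  set p := √P with hp
  have hp0 : 0 ≤ p := Real.sqrt_nonneg _
  have hp2 : p ^ 2 = P := Real.sq_sqrt hP0
  have hpα : ∀ α β i j, ‖ev (𝒟.D α (𝒟.D β (g i j)))‖ ≤ p := fun α β i j =>
    norm_sq_le_of_ev_sum (fun I : ((Fin n ⊕ Fin n) × (Fin n ⊕ Fin n)) × Fin n × Fin n =>
      𝒟.D I.1.1 (𝒟.D I.1.2 (g I.2.1 I.2.2))) ((α, β), i, j)
  -- any bound for the third derivatives will do, as they do not enter the conclusion
  obtain ⟨h, hh0, hh⟩ : ∃ h : ℝ, 0 ≤ h ∧ ∀ γ α β i j,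
      ‖ev (𝒟.D γ (𝒟.D α (𝒟.D β (g i j))))‖ ≤ h := by
    refine ⟨∑ γ, ∑ α, ∑ β, ∑ i, ∑ j, ‖ev (𝒟.D γ (𝒟.D α (𝒟.D β (g i j))))‖, by positivity, ?_⟩
    intro γ α β i j
    refine le_trans ?_ (Finset.single_le_sum (fun _ _ => by positivity) (Finset.mem_univ γ))
    refine le_trans ?_ (Finset.single_le_sum (fun _ _ => by positivity) (Finset.mem_univ α))
    refine le_trans ?_ (Finset.single_le_sum (fun _ _ => by positivity) (Finset.mem_univ β))
    refine le_trans ?_ (Finset.single_le_sum (fun _ _ => by positivity) (Finset.mem_univ i))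
    exact Finset.single_le_sum (f := fun j => ‖ev (𝒟.D γ (𝒟.D α (𝒟.D β (g i j))))‖)
      (fun _ _ => by positivity) (Finset.mem_univ j)
  set q := s ^ 2 + p with hq
  have hq0 : 0 ≤ q := by positivity
  have hjet : ∀ α i j, 𝒟.Jet2 ev M 0 s q h (𝒟.D α (g i j)) := fun α i j =>
    ⟨hg α i j, fun β => ⟨by
      rw [Jet0, pow_zero, one_mul]
      exact (hpα _ _ _ _).trans (by linarith [sq_nonneg s]),
      fun γ => by rw [Jet0, pow_zero, one_mul]; exact hh _ _ _ _ _⟩⟩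
  have hH : ∀ α i j, ‖ev (𝒟.heat W (𝒟.D α (g i j)))‖ ≤ M ^ 41 * (s * q) := fun α i j =>
    (H.heat_D_jet hs (by linarith) (C := s * q + q ^ 2 + s * h) (by nlinarith) (by nlinarith)
      (by nlinarith) hjet α i j).1
  have := H.heat_sum_le card_grad_le (fun I : (Fin n ⊕ Fin n) × Fin n × Fin n =>
    𝒟.D I.1 (g I.2.1 I.2.2)) (a := s) (b := M ^ 41 * (s * q))
    (fun I => by simpa [Jet0] using hg I.1 I.2.1 I.2.2) (fun I => hH _ _ _) h0 (by positivity)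
  rw [← hP] at this
  refine this.trans ?_
  have hy : 2 * M ^ 45 * (s ^ 2 * p) ≤ (M ^ 2)⁻¹ * p ^ 2 + M ^ 92 * s ^ 4 := by
    have hsq := sq_nonneg (M⁻¹ * p - M ^ 46 * s ^ 2)
    have e : (M⁻¹ * p - M ^ 46 * s ^ 2) ^ 2
        = (M ^ 2)⁻¹ * p ^ 2 + M ^ 92 * s ^ 4 - 2 * M ^ 45 * (s ^ 2 * p) := by
      field_simp
      ring
    linarith
  have e1 : M ^ 4 * (2 * (s * (M ^ 41 * (s * q)))) =
      2 * M ^ 45 * (s ^ 2 * p) + 2 * M ^ 45 * s ^ 4 := by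
    rw [hq]; ring
  have e2 : 2 * (M ^ 2)⁻¹ * P ≤ M⁻¹ * P := by
    have : 2 * (M ^ 2)⁻¹ ≤ M⁻¹ := by
      rw [← div_eq_mul_inv, div_le_iff₀ (by positivity)]
      have : M⁻¹ * M ^ 2 = M := by field_simp
      linarith
    gcongr
  have e3 : 2 * M ^ 45 * s ^ 4 + M ^ 92 * s ^ 4 ≤ M ^ 94 * s ^ 4 := by
    have h1 : M ^ 45 ≤ M ^ 92 := pow_le_pow_right₀ (by linarith) (by norm_num)
    have h2 : M ^ 92 * 3 ≤ M ^ 92 * (M * M) := by gcongr; nlinarith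
    have h3 : M ^ 92 * (M * M) = M ^ 94 := by ring
    have h4 : 0 ≤ s ^ 4 := by positivity
    nlinarith
  rw [e1]
  rw [hp2] at hy
  linarith

/-- Bernstein's estimate for the second derivatives. -/
lemma heat_hessSq_le (H : 𝒟.MetricBound ev M g W) (hs : 1 ≤ s)
    (hg : ∀ α i j, Jet0 ev M 0 s (𝒟.D α (g i j))) :
    (ev (𝒟.heat W (𝒟.hessSq g))).re
      ≤ M ^ 102 * ((ev (𝒟.hessSq g)).re * √(ev (𝒟.hessSq g)).re + s ^ 6) := by
  have hM4 := hM.out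
  have h0 : 0 ≤ s := by linarith
  set F : ((Fin n ⊕ Fin n) × (Fin n ⊕ Fin n)) × Fin n × Fin n → R :=
    fun I => 𝒟.D I.1.1 (𝒟.D I.1.2 (g I.2.1 I.2.2)) with hF
  set P := (ev (𝒟.hessSq g)).re with hPdef
  have hP0 : 0 ≤ P := by
    rw [hPdef, hessSq, ev_sum_star_mul, Complex.ofReal_re]; positivity
  set p := √P with hp
  have hp0 : 0 ≤ p := Real.sqrt_nonneg _
  have hp2 : P = p ^ 2 := (Real.sq_sqrt hP0).symm
  have hpα : ∀ α β i j, ‖ev (𝒟.D α (𝒟.D β (g i j)))‖ ≤ p := fun α β i j =>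
    norm_sq_le_of_ev_sum F ((α, β), i, j)
  set B := ∑ I, ∑ γ, ‖ev (𝒟.D γ (F I))‖ ^ 2 with hB
  have hB0 : 0 ≤ B := by positivity
  set h := √B with hh
  have hh0 : 0 ≤ h := Real.sqrt_nonneg _
  have hh2 : h ^ 2 = B := Real.sq_sqrt hB0
  have hhα : ∀ γ α β i j, ‖ev (𝒟.D γ (𝒟.D α (𝒟.D β (g i j))))‖ ≤ h := by
    intro γ α β i j
    refine Real.le_sqrt_of_sq_le ?_
    exact (Finset.single_le_sum (f := fun γ => ‖ev (𝒟.D γ (F ((α, β), i, j)))‖ ^ 2)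
      (fun _ _ => by positivity) (Finset.mem_univ γ)).trans
      (Finset.single_le_sum (f := fun I => ∑ γ, ‖ev (𝒟.D γ (F I))‖ ^ 2)
        (fun _ _ => by positivity) (Finset.mem_univ ((α, β), i, j)))
  set q := s ^ 2 + p with hq
  have hq0 : 0 ≤ q := by positivity
  have hsq : s ≤ q := by nlinarith
  have hjet : ∀ α i j, 𝒟.Jet2 ev M 0 s q h (𝒟.D α (g i j)) := fun α i j =>
    ⟨hg α i j, fun β => ⟨by
      rw [Jet0, pow_zero, one_mul]
      exact (hpα _ _ _ _).trans (by linarith [sq_nonneg s]),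
      fun γ => by rw [Jet0, pow_zero, one_mul]; exact hhα _ _ _ _ _⟩⟩
  have hsh : 0 ≤ s * h := by positivity
  have hH : ∀ I, ‖ev (𝒟.heat W (F I))‖ ≤ M ^ 42 * (q ^ 2 + s * h) := fun I =>
    H.heat_D_D_jet hs (by linarith) (C := q ^ 2 + s * h) (by nlinarith) (by linarith)
      (by nlinarith) hjet _ _ _ _
  have := H.heat_sum_le card_hess_le F (a := p) (b := M ^ 42 * (q ^ 2 + s * h))
    (fun I => hpα _ _ _ _) hH hp0 (by positivity)
  refine this.trans ?_
  rw [← hB, ← hh2, hp2]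
  exact bernstein_arith hM4 hp0

lemma d_gradSq_le (hg : ∀ α i j, Jet0 ev M 0 s (𝒟.D α (g i j))) (hs : 0 ≤ s) (p : Fin n) :
    ‖ev (𝒟.d p (𝒟.gradSq g))‖ ≤ M ^ 5 * (s * √(ev (𝒟.hessSq g)).re) := by
  have hP : ∀ α β i j, ‖ev (𝒟.D α (𝒟.D β (g i j)))‖ ≤ √(ev (𝒟.hessSq g)).re := fun α β i j =>
    norm_sq_le_of_ev_sum (fun I : ((Fin n ⊕ Fin n) × (Fin n ⊕ Fin n)) × Fin n × Fin n =>
      𝒟.D I.1.1 (𝒟.D I.1.2 (g I.2.1 I.2.2))) ((α, β), i, j)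
  have hj : ∀ α i j, 𝒟.Jet1 ev M 0 s (√(ev (𝒟.hessSq g)).re) (𝒟.D α (g i j)) := fun α i j =>
    ⟨hg α i j, fun β => by rw [Jet0, pow_zero, one_mul]; exact hP _ _ _ _⟩
  rw [gradSq, map_sum]
  refine Jet0.sum' (k := 1) card_grad_le (fun I => ?_)
  exact ((hj I.1 I.2.1 I.2.2).star.mul (hj I.1 I.2.1 I.2.2) (le_refl (s * s)) le_rfl
    (by linarith)).2 (.inl p)

end

end MetricBound

end DiffOps

/-! ### The ring of smooth functions on a cylinder -/

noncomputable section

/-- The complex operators `∂_i = (X_i - √-1 Y_i) / 2` and `∂_{\bar i} = (X_i + √-1 Y_i) / 2` built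
from commuting real ones. -/
def DiffOps.ofReal {n : ℕ} {R : Type*} [CommRing R] [StarRing R] [Algebra ℂ R] [StarModule ℂ R]
    (X Y : Fin n → Derivation ℂ R R) (dt : Derivation ℂ R R)
    (hXX : ∀ i j f, X i (X j f) = X j (X i f)) (hXY : ∀ i j f, X i (Y j f) = Y j (X i f))
    (hYY : ∀ i j f, Y i (Y j f) = Y j (Y i f)) (hX : ∀ i f, dt (X i f) = X i (dt f))
    (hY : ∀ i f, dt (Y i f) = Y i (dt f)) (sX : ∀ i f, star (X i f) = X i (star f))
    (sY : ∀ i f, star (Y i f) = Y i (star f)) (st : ∀ f, star (dt f) = dt (star f)) :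
    DiffOps n R where
  d i := (1 / 2 : ℂ) • (X i - Complex.I • Y i)
  db i := (1 / 2 : ℂ) • (X i + Complex.I • Y i)
  dt := dt
  d_d i j f := by
    simp only [Derivation.smul_apply, Derivation.sub_apply, Derivation.map_smul,
      Derivation.map_sub, hXX i j, hYY i j, hXY i j, ← hXY j i]
    module
  d_db i j f := by
    simp only [Derivation.smul_apply, Derivation.sub_apply, Derivation.add_apply,
      Derivation.map_smul, Derivation.map_sub, Derivation.map_add, hXX i j, hYY i j, hXY i j,
      ← hXY j i]
    module
  dt_d i f := by
    simp only [Derivation.smul_apply, Derivation.sub_apply, Derivation.map_smul,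
      Derivation.map_sub, hX, hY]
  dt_db i f := by
    simp only [Derivation.smul_apply, Derivation.add_apply, Derivation.map_smul,
      Derivation.map_add, hX, hY]
  star_d i f := by
    simp [Derivation.smul_apply, star_smul, sX, sY]
  star_dt := st

section SmoothAlgebra

variable {E : Type*} [NormedAddCommGroup E] [NormedSpace ℝ E]

/-- The algebra of smooth complex valued functions on a set `Ω`, that is, of those functions on `Ω`
which have an extension that is smooth on `Ω` in the sense of `ContDiffOn`. -/
def smoothAlg (Ω : Set E) : StarSubalgebra ℂ (Ω → ℂ) where
  carrier := {f | ∃ F : E → ℂ, ContDiffOn ℝ ∞ F Ω ∧ ∀ p : Ω, f p = F p}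
  mul_mem' := by
    rintro f h ⟨F, hF, hf⟩ ⟨H, hH, hh⟩
    exact ⟨F * H, hF.mul hH, fun p => by simp [hf, hh]⟩
  one_mem' := ⟨1, contDiffOn_const, fun p => rfl⟩
  add_mem' := by
    rintro f h ⟨F, hF, hf⟩ ⟨H, hH, hh⟩
    exact ⟨F + H, hF.add hH, fun p => by simp [hf, hh]⟩
  zero_mem' := ⟨0, contDiffOn_const, fun p => rfl⟩
  algebraMap_mem' c := ⟨fun _ => c, contDiffOn_const, fun p => rfl⟩
  star_mem' := by
    rintro f ⟨F, hF, hf⟩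
    exact ⟨fun x => star (F x),
      (starL' ℝ (A := ℂ)).toContinuousLinearMap.contDiff.comp_contDiffOn hF,
      fun p => by simp [hf]⟩

variable {Ω : Set E}

/-- A smooth extension of an element of `smoothAlg Ω`. -/
def rep (f : smoothAlg Ω) : E → ℂ := f.2.choose

lemma contDiffOn_rep (f : smoothAlg Ω) : ContDiffOn ℝ ∞ (rep f) Ω := f.2.choose_spec.1

lemma rep_eq (f : smoothAlg Ω) (p : Ω) : f.1 p = rep f p := f.2.choose_spec.2 p

/-- A function which is smooth on `Ω`, as an element of `smoothAlg Ω`. -/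
def mkSmooth {F : E → ℂ} (hF : ContDiffOn ℝ ∞ F Ω) : smoothAlg Ω :=
  ⟨fun p => F p, F, hF, fun _ => rfl⟩

/-- Evaluation at a point of `Ω`. -/
def evalAt (p : Ω) : smoothAlg Ω →⋆ₐ[ℂ] ℂ where
  toFun f := f.1 p
  map_one' := rfl
  map_mul' _ _ := rfl
  map_zero' := rfl
  map_add' _ _ := rfl
  commutes' _ := rfl
  map_star' _ := rfl

lemma evalAt_mkSmooth {F : E → ℂ} (hF : ContDiffOn ℝ ∞ F Ω) (p : Ω) :
    evalAt p (mkSmooth hF) = F p := rfl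

lemma evalAt_eq_rep (f : smoothAlg Ω) (p : Ω) : evalAt p f = rep f p := rep_eq f p

lemma smoothAlg_ext {f h : smoothAlg Ω} (H : ∀ p, evalAt p f = evalAt p h) : f = h :=
  Subtype.ext (funext H)

lemma fderivWithin_rep (f : smoothAlg Ω) {F : E → ℂ} (hF : ∀ p : Ω, evalAt p f = F p) (p : Ω) :
    fderivWithin ℝ (rep f) Ω p = fderivWithin ℝ F Ω p :=
  fderivWithin_congr (fun x hx => by
    have h1 := evalAt_eq_rep f ⟨x, hx⟩
    have h2 := hF ⟨x, hx⟩
    rw [← h1, h2]) (by rw [← evalAt_eq_rep, hF])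

lemma differentiableWithinAt_rep (f : smoothAlg Ω) (p : Ω) :
    DifferentiableWithinAt ℝ (rep f) Ω p :=
  ((contDiffOn_rep f).differentiableOn (by simp)) p p.2

/-- The directional derivative of an element of `smoothAlg Ω`. -/
def dirDerivFun (hΩ : UniqueDiffOn ℝ Ω) (v : E) (f : smoothAlg Ω) : smoothAlg Ω :=
  mkSmooth (F := fun x => fderivWithin ℝ (rep f) Ω x v)
    (((contDiffOn_rep f).fderivWithin hΩ (m := ∞) (by simp)).clm_apply contDiffOn_const)

lemma evalAt_dirDerivFun (hΩ : UniqueDiffOn ℝ Ω) (v : E) (f : smoothAlg Ω) {F : E → ℂ}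
    (hF : ∀ p : Ω, evalAt p f = F p) (p : Ω) :
    evalAt p (dirDerivFun hΩ v f) = fderivWithin ℝ F Ω p v := by
  rw [← fderivWithin_rep f hF]; rfl

/-- The directional derivative, as a derivation of `smoothAlg Ω`. -/
def dirDeriv (hΩ : UniqueDiffOn ℝ Ω) (v : E) : Derivation ℂ (smoothAlg Ω) (smoothAlg Ω) :=
  Derivation.mk'
    { toFun := dirDerivFun hΩ v
      map_add' := fun f h => smoothAlg_ext fun p => by
        rw [map_add, evalAt_dirDerivFun hΩ v f (evalAt_eq_rep f),
          evalAt_dirDerivFun hΩ v h (evalAt_eq_rep h),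
          evalAt_dirDerivFun hΩ v (f + h) (F := rep f + rep h)
          (fun q => by simp [evalAt_eq_rep f, evalAt_eq_rep h]),
          fderivWithin_add (hΩ p p.2) (differentiableWithinAt_rep f p)
          (differentiableWithinAt_rep h p)]
        rfl
      map_smul' := fun c f => smoothAlg_ext fun p => by
        rw [RingHom.id_apply, map_smul, evalAt_dirDerivFun hΩ v f (evalAt_eq_rep f),
          evalAt_dirDerivFun hΩ v (c • f) (F := c • rep f) (fun q => by simp [evalAt_eq_rep f]),
          fderivWithin_const_smul (hΩ p p.2) (differentiableWithinAt_rep f p)]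
        rfl }
    fun f h => smoothAlg_ext fun p => by
      change evalAt p (dirDerivFun hΩ v (f * h))
        = evalAt p (f * dirDerivFun hΩ v h + h * dirDerivFun hΩ v f)
      rw [map_add, map_mul, map_mul, evalAt_dirDerivFun hΩ v f (evalAt_eq_rep f),
        evalAt_dirDerivFun hΩ v h (evalAt_eq_rep h),
        evalAt_dirDerivFun hΩ v (f * h) (F := rep f * rep h)
          (fun q => by simp [evalAt_eq_rep f, evalAt_eq_rep h]),
        fderivWithin_mul (hΩ p p.2) (differentiableWithinAt_rep f p)
        (differentiableWithinAt_rep h p), evalAt_eq_rep, evalAt_eq_rep]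
      simp

lemma evalAt_dirDeriv (hΩ : UniqueDiffOn ℝ Ω) (v : E) (f : smoothAlg Ω) {F : E → ℂ}
    (hF : ∀ p : Ω, evalAt p f = F p) (p : Ω) :
    evalAt p (dirDeriv hΩ v f) = fderivWithin ℝ F Ω p v := by
  exact evalAt_dirDerivFun hΩ v f hF p

lemma dirDeriv_comm (hΩ : UniqueDiffOn ℝ Ω) (hΩ' : Ω ⊆ closure (interior Ω)) (v w : E)
    (f : smoothAlg Ω) : dirDeriv hΩ v (dirDeriv hΩ w f) = dirDeriv hΩ w (dirDeriv hΩ v f) := by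
  have h : ∀ (v w : E) (p : Ω), evalAt p (dirDeriv hΩ v (dirDeriv hΩ w f))
      = fderivWithin ℝ (fderivWithin ℝ (rep f) Ω) Ω p v w := by
    intro v w p
    rw [evalAt_dirDeriv hΩ v _ (F := fun x => fderivWithin ℝ (rep f) Ω x w) (fun q => rfl)]
    have hd : DifferentiableWithinAt ℝ (fderivWithin ℝ (rep f) Ω) Ω p :=
      (((contDiffOn_rep f).fderivWithin hΩ (m := ∞) (by simp)).differentiableOn (by simp)) p p.2
    rw [fderivWithin_clm_apply (hΩ p p.2) hd (differentiableWithinAt_const w)]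
    simp
  refine smoothAlg_ext fun p => ?_
  rw [h, h]
  exact ((contDiffOn_rep f p p.2).isSymmSndFDerivWithinAt
    (by rw [minSmoothness_of_isRCLikeNormedField]; exact WithTop.coe_le_coe.2 (le_top : (2 : ℕ∞) ≤ ⊤))
      hΩ (hΩ' p.2) p.2) v w

lemma star_dirDeriv (hΩ : UniqueDiffOn ℝ Ω) (v : E) (f : smoothAlg Ω) :
    star (dirDeriv hΩ v f) = dirDeriv hΩ v (star f) := by
  refine smoothAlg_ext fun p => ?_
  rw [evalAt_dirDeriv hΩ v (star f) (F := fun x => star (rep f x))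
    (fun q => by rw [map_star, evalAt_eq_rep]), map_star,
    evalAt_dirDeriv hΩ v f (evalAt_eq_rep f)]
  have h := (((starL' ℝ (A := ℂ)).toContinuousLinearMap.hasFDerivAt
      (x := rep f p)).comp_hasFDerivWithinAt
    (p : E) (differentiableWithinAt_rep f p).hasFDerivWithinAt).fderivWithin (hΩ p p.2)
  have h2 := congrArg (fun L => L v) h
  exact h2.symm

lemma isUnit_smoothAlg (f : smoothAlg Ω) (hf : ∀ p, evalAt p f ≠ 0) : IsUnit f := by
  have hinv : ContDiffOn ℝ ∞ (fun x => (rep f x)⁻¹) Ω :=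
    (contDiffOn_rep f).inv fun x hx => by
      have := hf ⟨x, hx⟩
      rwa [evalAt_eq_rep] at this
  refine IsUnit.of_mul_eq_one (mkSmooth hinv) (smoothAlg_ext fun p => ?_)
  rw [map_mul, evalAt_mkSmooth, ← evalAt_eq_rep, map_one, mul_inv_cancel₀ (hf p)]

end SmoothAlgebra

section FlowDomain

variable {n : ℕ} {T : ℝ} {V : Set (Cn n)}

lemma uniqueDiffOn_cylinder (hT : 0 < T) (hV : IsOpen V) :
    UniqueDiffOn ℝ (Set.Icc 0 T ×ˢ V : Set (ℝ × Cn n)) :=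
  (uniqueDiffOn_Icc hT).prod hV.uniqueDiffOn

lemma cylinder_subset (hT : 0 < T) (hV : IsOpen V) :
    (Set.Icc 0 T ×ˢ V : Set (ℝ × Cn n)) ⊆ closure (interior (Set.Icc 0 T ×ˢ V)) := by
  rw [interior_prod_eq, closure_prod_eq, interior_Icc, closure_Ioo hT.ne, hV.interior_eq]
  exact Set.prod_mono le_rfl subset_closure

/-- The smooth functions on the cylinder `[0, T] × V`. -/
abbrev Cyl (T : ℝ) (V : Set (Cn n)) := smoothAlg (Set.Icc 0 T ×ˢ V : Set (ℝ × Cn n))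

/-- The spatial derivative in the direction `v` on the cylinder. -/
def spaceDeriv (hT : 0 < T) (hV : IsOpen V) (v : Cn n) : Derivation ℂ (Cyl T V) (Cyl T V) :=
  dirDeriv (uniqueDiffOn_cylinder hT hV) (0, v)

/-- The operators `∂_i`, `∂_{\bar i}` and `∂_t` on the smooth functions on `[0, T] × V`. -/
def cylOps (hT : 0 < T) (hV : IsOpen V) : DiffOps n (Cyl T V) :=
  DiffOps.ofReal (fun i => spaceDeriv hT hV (coordVec i))
    (fun i => spaceDeriv hT hV (Complex.I • coordVec i))
    (dirDeriv (uniqueDiffOn_cylinder hT hV) (1, 0))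
    (fun _ _ => dirDeriv_comm _ (cylinder_subset hT hV) _ _)
    (fun _ _ => dirDeriv_comm _ (cylinder_subset hT hV) _ _)
    (fun _ _ => dirDeriv_comm _ (cylinder_subset hT hV) _ _)
    (fun _ => dirDeriv_comm _ (cylinder_subset hT hV) _ _)
    (fun _ => dirDeriv_comm _ (cylinder_subset hT hV) _ _)
    (fun _ => star_dirDeriv _ _) (fun _ => star_dirDeriv _ _) (star_dirDeriv _ _)

end FlowDomain

end

/-! ### Derivatives on the cylinder and the second derivative test -/

noncomputable section

section Cylinder

variable {n : ℕ} {T : ℝ} {V : Set (Cn n)} (hT : 0 < T) (hV : IsOpen V)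

lemma hasFDerivWithinAt_cyl (f : Cyl T V) {F : ℝ × Cn n → ℂ}
    (hF : ∀ p : (Set.Icc 0 T ×ˢ V : Set (ℝ × Cn n)), evalAt p f = F p)
    (p : (Set.Icc 0 T ×ˢ V : Set (ℝ × Cn n))) :
    HasFDerivWithinAt F (fderivWithin ℝ F (Set.Icc 0 T ×ˢ V) p) (Set.Icc 0 T ×ˢ V) p := by
  refine DifferentiableWithinAt.hasFDerivWithinAt ?_
  refine (differentiableWithinAt_rep f p).congr (fun x hx => ?_) ?_
  · rw [← hF ⟨x, hx⟩, evalAt_eq_rep]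
  · rw [← hF, evalAt_eq_rep]

include hV in
/-- The time slices of a smooth function are differentiable in the usual sense. -/
lemma hasFDerivAt_slice (f : Cyl T V) {F : ℝ × Cn n → ℂ}
    (hF : ∀ p : (Set.Icc 0 T ×ˢ V : Set (ℝ × Cn n)), evalAt p f = F p)
    (p : (Set.Icc 0 T ×ˢ V : Set (ℝ × Cn n))) :
    HasFDerivAt (fun y => F (p.1.1, y))
      ((fderivWithin ℝ F (Set.Icc 0 T ×ˢ V) p).comp
        (ContinuousLinearMap.inr ℝ ℝ (Cn n))) p.1.2 := by
  have h := (hasFDerivWithinAt_cyl f hF p)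
  have h2 : HasFDerivWithinAt (fun y : Cn n => (p.1.1, y)) (ContinuousLinearMap.inr ℝ ℝ (Cn n)) V
      p.1.2 := (hasFDerivAt_prodMk_right _ _).hasFDerivWithinAt
  have h3 := h.comp (t := Set.Icc 0 T ×ˢ V) (s := V) p.1.2 h2 (fun y hy => ⟨p.2.1, hy⟩)
  exact h3.hasFDerivAt (hV.mem_nhds p.2.2)

lemma evalAt_spaceDeriv (v : Cn n) (f : Cyl T V) {F : ℝ × Cn n → ℂ}
    (hF : ∀ p : (Set.Icc 0 T ×ˢ V : Set (ℝ × Cn n)), evalAt p f = F p)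
    (p : (Set.Icc 0 T ×ˢ V : Set (ℝ × Cn n))) :
    evalAt p (spaceDeriv hT hV v f) = fderiv ℝ (fun y => F (p.1.1, y)) p.1.2 v := by
  rw [(hasFDerivAt_slice hV f hF p).fderiv]
  exact evalAt_dirDeriv _ _ f hF p

lemma evalAt_d (f : Cyl T V) {F : ℝ × Cn n → ℂ}
    (hF : ∀ p : (Set.Icc 0 T ×ˢ V : Set (ℝ × Cn n)), evalAt p f = F p)
    (p : (Set.Icc 0 T ×ˢ V : Set (ℝ × Cn n))) (i : Fin n) :
    evalAt p ((cylOps hT hV).d i f) = dz i (fun y => F (p.1.1, y)) p.1.2 := by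
  rw [dz, ← evalAt_spaceDeriv hT hV _ f hF p, ← evalAt_spaceDeriv hT hV _ f hF p]
  simp [cylOps, DiffOps.ofReal]

lemma evalAt_db (f : Cyl T V) {F : ℝ × Cn n → ℂ}
    (hF : ∀ p : (Set.Icc 0 T ×ˢ V : Set (ℝ × Cn n)), evalAt p f = F p)
    (p : (Set.Icc 0 T ×ˢ V : Set (ℝ × Cn n))) (i : Fin n) :
    evalAt p ((cylOps hT hV).db i f) = dzbar i (fun y => F (p.1.1, y)) p.1.2 := by
  rw [dzbar, ← evalAt_spaceDeriv hT hV _ f hF p, ← evalAt_spaceDeriv hT hV _ f hF p]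
  simp [cylOps, DiffOps.ofReal, mul_add]

lemma hasDerivWithinAt_dt (f : Cyl T V) {F : ℝ × Cn n → ℂ}
    (hF : ∀ p : (Set.Icc 0 T ×ˢ V : Set (ℝ × Cn n)), evalAt p f = F p)
    (p : (Set.Icc 0 T ×ˢ V : Set (ℝ × Cn n))) :
    HasDerivWithinAt (fun t => F (t, p.1.2)) (evalAt p ((cylOps hT hV).dt f))
      (Set.Icc 0 T) p.1.1 := by
  have h := (hasFDerivWithinAt_cyl f hF p)
  have h2 : HasDerivWithinAt (fun t : ℝ => (t, p.1.2)) ((1 : ℝ), (0 : Cn n)) (Set.Icc 0 T) p.1.1 :=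
    ((hasDerivAt_id _).prodMk (hasDerivAt_const _ _)).hasDerivWithinAt
  have h3 := h.comp_hasDerivWithinAt (t := Set.Icc 0 T ×ˢ V) p.1.1 h2 (fun t ht => ⟨ht, p.2.2⟩)
  have h4 : evalAt p ((cylOps hT hV).dt f)
      = fderivWithin ℝ F (Set.Icc 0 T ×ˢ V) p ((1 : ℝ), (0 : Cn n)) := evalAt_dirDeriv _ _ f hF p
  rw [h4]
  exact h3

lemma continuousOn_rep {Ω : Set (ℝ × Cn n)} (f : smoothAlg Ω) : ContinuousOn (rep f) Ω :=
  (contDiffOn_rep f).continuousOn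

lemma contDiffOn_comp_snd {F : Cn n → ℂ} (hF : ContDiffOn ℝ ∞ F V) :
    ContDiffOn ℝ ∞ (fun p : ℝ × Cn n => F p.2) (Set.Icc 0 T ×ˢ V) :=
  hF.comp contDiff_snd.contDiffOn fun _ hp => hp.2

end Cylinder

section SecondDerivativeTest

lemma deriv_deriv_nonpos_of_isLocalMax {φ ψ : ℝ → ℝ} {c : ℝ}
    (hmax : IsLocalMax φ 0) (hφ : ∀ᶠ x in nhds 0, HasDerivAt φ (ψ x) x) (hψ : HasDerivAt ψ c 0) :
    c ≤ 0 := by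
  by_contra! hc
  have hd : deriv φ =ᶠ[nhds 0] ψ := hφ.mono fun x hx => hx.deriv
  have hdd : deriv (deriv φ) 0 = c := by rw [hd.deriv_eq]; exact hψ.deriv
  have hmin : IsLocalMin φ 0 := isLocalMin_of_deriv_deriv_pos (by rw [hdd]; exact hc)
    hmax.deriv_eq_zero hφ.self_of_nhds.continuousAt
  have hconst : φ =ᶠ[nhds 0] fun _ => φ 0 := by
    filter_upwards [hmax, hmin] with x h1 h2 using le_antisymm h1 h2
  have h1 := hconst.deriv.deriv_eq
  simp at h1
  linarith

variable {n : ℕ} {T : ℝ} {V : Set (Cn n)} (hT : 0 < T) (hV : IsOpen V)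

/-- `p` is a maximum of the real part of `f`, at a positive time, among the points which are
spatially close. -/
def IsSpaceLocalMax (f : Cyl T V) (p : (Set.Icc 0 T ×ˢ V : Set (ℝ × Cn n))) : Prop :=
  0 < p.1.1 ∧ ∀ᶠ y in nhds p.1.2, ∀ q : (Set.Icc 0 T ×ˢ V : Set (ℝ × Cn n)), q.1.2 = y →
    (evalAt q f).re ≤ (evalAt p f).re

variable {f : Cyl T V} {p : (Set.Icc 0 T ×ˢ V : Set (ℝ × Cn n))}

lemma IsSpaceLocalMax.dt_nonneg (h : IsSpaceLocalMax f p) :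
    0 ≤ (evalAt p ((cylOps hT hV).dt f)).re := by
  have h1 := hasDerivWithinAt_dt hT hV f (evalAt_eq_rep f) p
  have h2 : HasDerivWithinAt (fun t => (rep f (t, p.1.2)).re)
      (evalAt p ((cylOps hT hV).dt f)).re (Set.Icc 0 T) p.1.1 :=
    Complex.reCLM.hasFDerivAt.comp_hasDerivWithinAt p.1.1 h1
  have hmax : IsLocalMaxOn (fun t => (rep f (t, p.1.2)).re) (Set.Icc 0 T) p.1.1 := by
    filter_upwards [self_mem_nhdsWithin] with t ht
    have := h.2.self_of_nhds ⟨(t, p.1.2), ht, p.2.2⟩ rfl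
    rwa [evalAt_eq_rep, evalAt_eq_rep] at this
  have hcone : (-p.1.1) ∈ posTangentConeAt (Set.Icc 0 T) p.1.1 := by
    apply mem_posTangentConeAt_of_segment_subset
    have : p.1.1 + -p.1.1 = 0 := by ring
    rw [this]
    exact (convex_Icc 0 T).segment_subset p.2.1 ⟨le_rfl, hT.le⟩
  have h3 := hmax.hasFDerivWithinAt_nonpos h2.hasFDerivWithinAt hcone
  simp only [ContinuousLinearMap.toSpanSingleton_apply, smul_eq_mul] at h3
  have := h.1
  nlinarith

lemma hasDerivAt_line (f : Cyl T V) (p : (Set.Icc 0 T ×ˢ V : Set (ℝ × Cn n))) (v : Cn n) :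
    ∀ᶠ ε : ℝ in nhds 0, HasDerivAt (fun ε : ℝ => (rep f (p.1.1, p.1.2 + ε • v)).re)
      (rep (spaceDeriv hT hV v f) (p.1.1, p.1.2 + ε • v)).re ε := by
  have hc : Continuous fun ε : ℝ => p.1.2 + ε • v := by fun_prop
  have hmem : ∀ᶠ ε : ℝ in nhds 0, p.1.2 + ε • v ∈ V := by
    refine hc.continuousAt.eventually_mem (hV.mem_nhds ?_)
    simpa using p.2.2
  filter_upwards [hmem] with ε hε
  set q : (Set.Icc 0 T ×ˢ V : Set (ℝ × Cn n)) := ⟨(p.1.1, p.1.2 + ε • v), p.2.1, hε⟩ with hq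
  have h1 := hasFDerivAt_slice hV f (evalAt_eq_rep f) q
  have h2 : HasDerivAt (fun ε : ℝ => p.1.2 + ε • v) v ε := by
    simpa using ((hasDerivAt_id ε).smul_const v).const_add p.1.2
  have h3 := Complex.reCLM.hasFDerivAt.comp_hasDerivAt ε (h1.comp_hasDerivAt ε h2)
  have h4 := evalAt_spaceDeriv hT hV v f (evalAt_eq_rep f) q
  rw [evalAt_eq_rep, h1.fderiv] at h4
  rw [h4]
  exact h3

lemma IsSpaceLocalMax.isLocalMax_line (h : IsSpaceLocalMax f p) (hV : IsOpen V) (v : Cn n) :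
    IsLocalMax (fun ε : ℝ => (rep f (p.1.1, p.1.2 + ε • v)).re) 0 := by
  have hc : Continuous fun ε : ℝ => p.1.2 + ε • v := by fun_prop
  have ht : Filter.Tendsto (fun ε : ℝ => p.1.2 + ε • v) (nhds 0) (nhds p.1.2) := by
    simpa using hc.tendsto 0
  filter_upwards [ht.eventually h.2, ht.eventually_mem (hV.mem_nhds p.2.2)] with ε h1 h2
  have := h1 ⟨(p.1.1, p.1.2 + ε • v), p.2.1, h2⟩ rfl
  rw [evalAt_eq_rep, evalAt_eq_rep] at this
  simpa using this

lemma IsSpaceLocalMax.spaceDeriv_eq_zero (h : IsSpaceLocalMax f p) (v : Cn n) :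
    (evalAt p (spaceDeriv hT hV v f)).re = 0 := by
  have h1 := (h.isLocalMax_line hV v).hasDerivAt_eq_zero (hasDerivAt_line hT hV f p v).self_of_nhds
  rw [evalAt_eq_rep]
  simpa using h1

lemma IsSpaceLocalMax.spaceDeriv_spaceDeriv_nonpos (h : IsSpaceLocalMax f p) (v : Cn n) :
    (evalAt p (spaceDeriv hT hV v (spaceDeriv hT hV v f))).re ≤ 0 := by
  refine deriv_deriv_nonpos_of_isLocalMax (h.isLocalMax_line hV v) (hasDerivAt_line hT hV f p v) ?_
  have := (hasDerivAt_line hT hV (spaceDeriv hT hV v f) p v).self_of_nhds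
  rw [evalAt_eq_rep]
  simpa using this

lemma IsSpaceLocalMax.d_eq_zero (h : IsSpaceLocalMax f p) (hf : star f = f) (i : Fin n) :
    evalAt p ((cylOps hT hV).d i f) = 0 := by
  have hreal : ∀ v, evalAt p (spaceDeriv hT hV v f) = 0 := by
    intro v
    have h1 : star (evalAt p (spaceDeriv hT hV v f)) = evalAt p (spaceDeriv hT hV v f) := by
      rw [← map_star, spaceDeriv, star_dirDeriv, hf]
    refine Complex.ext (h.spaceDeriv_eq_zero hT hV v) ?_
    exact Complex.conj_eq_iff_im.mp h1
  have : (cylOps hT hV).d i f = (1 / 2 : ℂ) • (spaceDeriv hT hV (coordVec i) f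
    - Complex.I • spaceDeriv hT hV (Complex.I • coordVec i) f) := rfl
  rw [this, map_smul, map_sub, map_smul, hreal, hreal]
  simp

lemma spaceDeriv_apply (v : Cn n) (f : Cyl T V) :
    spaceDeriv hT hV v f = ∑ i, (((v i).re : ℂ) • spaceDeriv hT hV (coordVec i) f
      + ((v i).im : ℂ) • spaceDeriv hT hV (Complex.I • coordVec i) f) := by
  have hv : v = ∑ i, ((v i).re • coordVec i + (v i).im • (Complex.I • coordVec i)) := by
    ext j
    simp only [coordVec, WithLp.ofLp_sum, Finset.sum_apply, PiLp.add_apply, PiLp.smul_apply,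
      PiLp.single_apply, Complex.real_smul, smul_eq_mul]
    rw [Finset.sum_eq_single j (fun i _ hi => by simp [hi.symm]) (by simp)]
    simp [Complex.re_add_im]
  refine smoothAlg_ext fun p => ?_
  rw [map_sum, evalAt_spaceDeriv hT hV v f (evalAt_eq_rep f)]
  conv_lhs => rw [hv]
  rw [map_sum]
  refine Finset.sum_congr rfl fun i _ => ?_
  rw [map_add, map_add, map_smul (evalAt p), map_smul (evalAt p), map_smul, map_smul,
    evalAt_spaceDeriv hT hV _ f (evalAt_eq_rep f), evalAt_spaceDeriv hT hV _ f (evalAt_eq_rep f)]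
  simp

lemma sum_smul_d (v : Cn n) (f : Cyl T V) :
    ∑ i, v i • (cylOps hT hV).d i f = (1 / 2 : ℂ) • (spaceDeriv hT hV v f
      - Complex.I • spaceDeriv hT hV (Complex.I • v) f) := by
  have hd : ∀ i, (cylOps hT hV).d i f = (1 / 2 : ℂ) • (spaceDeriv hT hV (coordVec i) f
    - Complex.I • spaceDeriv hT hV (Complex.I • coordVec i) f) := fun _ => rfl
  rw [spaceDeriv_apply hT hV v, spaceDeriv_apply hT hV (Complex.I • v), Finset.smul_sum,
    ← Finset.sum_sub_distrib, Finset.smul_sum]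
  refine Finset.sum_congr rfl fun i _ => ?_
  rw [hd]
  have h1 : (Complex.I • v) i = Complex.I * v i := rfl
  rw [h1]
  conv_lhs => rw [← Complex.re_add_im (v i)]
  simp only [Complex.mul_re, Complex.mul_im, Complex.I_re, Complex.I_im]
  push_cast
  match_scalars
  · ring
  · linear_combination (-(v i).im / 2 : ℂ) * Complex.I_sq

lemma sum_smul_db (v : Cn n) (f : Cyl T V) :
    ∑ i, star (v i) • (cylOps hT hV).db i f = (1 / 2 : ℂ) • (spaceDeriv hT hV v f
      + Complex.I • spaceDeriv hT hV (Complex.I • v) f) := by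
  have h := congrArg star (sum_smul_d hT hV v (star f))
  simp only [star_sum, star_smul, (cylOps hT hV).star_d, star_star, star_sub, spaceDeriv,
    star_dirDeriv] at h
  rw [h]
  simp [spaceDeriv]

open scoped MatrixOrder Matrix.Norms.L2Operator in
lemma exists_conjTranspose_mul_self {A : Matrix (Fin n) (Fin n) ℂ} (hA : A.PosSemidef) :
    ∃ B : Matrix (Fin n) (Fin n) ℂ, A = B.conjTranspose * B :=
  CStarAlgebra.nonneg_iff_eq_star_mul_self.mp hA.nonneg

lemma IsSpaceLocalMax.lap_nonpos (h : IsSpaceLocalMax f p) {W : Matrix (Fin n) (Fin n) (Cyl T V)}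
    (hW : (W.map (evalAt p)).PosSemidef) : (evalAt p ((cylOps hT hV).lap W f)).re ≤ 0 := by
  obtain ⟨B, hB⟩ := exists_conjTranspose_mul_self hW
  have hquad : ∀ v : Cn n, (∑ i, ∑ j, v i * star (v j)
      * evalAt p ((cylOps hT hV).d i ((cylOps hT hV).db j f))).re ≤ 0 := by
    intro v
    have e1 : ∑ i, v i • (cylOps hT hV).d i (∑ j, star (v j) • (cylOps hT hV).db j f)
        = (1 / 4 : ℂ) • (spaceDeriv hT hV v (spaceDeriv hT hV v f)
          + spaceDeriv hT hV (Complex.I • v) (spaceDeriv hT hV (Complex.I • v) f)) := by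
      have hcomm : spaceDeriv hT hV v (spaceDeriv hT hV (Complex.I • v) f)
          = spaceDeriv hT hV (Complex.I • v) (spaceDeriv hT hV v f) :=
        dirDeriv_comm _ (cylinder_subset hT hV) _ _ _
      rw [sum_smul_d, sum_smul_db]
      simp only [Derivation.map_smul, Derivation.map_add, hcomm]
      match_scalars
      · norm_num
      · ring
      · linear_combination (-1 / 4 : ℂ) * Complex.I_sq
    have e2 := congrArg (fun F => (evalAt p F).re) e1
    simp only [map_sum, map_smul, Derivation.map_smul, smul_eq_mul, Finset.mul_sum, map_add] at e2
    have h1 := h.spaceDeriv_spaceDeriv_nonpos hT hV v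
    have h2 := h.spaceDeriv_spaceDeriv_nonpos hT hV (Complex.I • v)
    have e3 : ((1 / 4 : ℂ) * (evalAt p (spaceDeriv hT hV v (spaceDeriv hT hV v f))
          + evalAt p (spaceDeriv hT hV (Complex.I • v) (spaceDeriv hT hV (Complex.I • v) f)))).re
        = 1 / 4 * ((evalAt p (spaceDeriv hT hV v (spaceDeriv hT hV v f))).re
          + (evalAt p (spaceDeriv hT hV (Complex.I • v)
            (spaceDeriv hT hV (Complex.I • v) f))).re) := by
      rw [show (1 / 4 : ℂ) = ((1 / 4 : ℝ) : ℂ) by push_cast; rfl, Complex.re_ofReal_mul,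
        Complex.add_re]
    rw [e3] at e2
    simp only [mul_assoc]
    rw [e2]
    linarith
  have e : evalAt p ((cylOps hT hV).lap W f) = ∑ m, ∑ i, ∑ j, B m i * star (B m j)
      * evalAt p ((cylOps hT hV).d i ((cylOps hT hV).db j f)) := by
    have hWB : ∀ q p', evalAt p (W q p') = ∑ m, star (B m q) * B m p' := by
      intro q p'
      have := congrFun (congrFun hB q) p'
      simpa [Matrix.mul_apply] using this
    simp only [DiffOps.lap, map_sum, map_mul, hWB, Finset.sum_mul]
    calc _ = ∑ i, ∑ m, ∑ j, B m i * star (B m j)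
          * evalAt p ((cylOps hT hV).d i ((cylOps hT hV).db j f)) := by
          refine Finset.sum_congr rfl fun i _ => ?_
          rw [Finset.sum_comm]
          refine Finset.sum_congr rfl fun m _ => Finset.sum_congr rfl fun j _ => by ring
      _ = _ := Finset.sum_comm
  rw [e, Complex.re_sum]
  exact Finset.sum_nonpos fun m _ => hquad (WithLp.toLp 2 (B m))

lemma IsSpaceLocalMax.heat_nonneg (h : IsSpaceLocalMax f p)
    {W : Matrix (Fin n) (Fin n) (Cyl T V)} (hW : (W.map (evalAt p)).PosSemidef) :
    0 ≤ (evalAt p ((cylOps hT hV).heat W f)).re := by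
  rw [DiffOps.heat, map_sub, Complex.sub_re]
  linarith [h.dt_nonneg hT hV, h.lap_nonpos hT hV hW]

end SecondDerivativeTest

end

/-! ### The maximum principle at a point -/

section CutoffEstimate

lemma le_of_quartic_le {y q s : ℝ} (hs : 0 ≤ s) (hq : 1 ≤ q)
    (h : y ^ 4 ≤ 10 * q * s * y ^ 3 + 26 * q * s ^ 2 * y ^ 2 + 2 * q * s ^ 4) : y ≤ 30 * q * s := by
  by_contra! hlt
  have hs1 : s ≤ q * s := by nlinarith
  have hy0 : 0 < y := lt_of_le_of_lt (by positivity) hlt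
  have h1 : q * s * y ^ 3 ≤ y ^ 4 / 30 := by
    have : 30 * q * s * y ^ 3 ≤ y * y ^ 3 := by gcongr
    linarith [this, show y * y ^ 3 = y ^ 4 by ring]
  have hsy : 30 * s ≤ y := by linarith
  have h2 : q * s ^ 2 * y ^ 2 ≤ y ^ 4 / 900 := by
    have : (30 * q * s) * (30 * s) * y ^ 2 ≤ y * y * y ^ 2 := by gcongr
    linarith [this, show y * y * y ^ 2 = y ^ 4 by ring,
      show (30 * q * s) * (30 * s) * y ^ 2 = 900 * (q * s ^ 2 * y ^ 2) by ring]
  have h3 : q * s ^ 4 ≤ y ^ 4 / 810000 := by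
    have : (30 * q * s) * (30 * s) * (30 * s) * (30 * s) ≤ y * y * y * y := by gcongr
    linarith [this, show y * y * y * y = y ^ 4 by ring,
      show (30 * q * s) * (30 * s) * (30 * s) * (30 * s) = 810000 * (q * s ^ 4) by ring]
  have h4 : 0 < y ^ 4 := by positivity
  linarith

/-- At the maximum of the quotient `X = e² t² / (2A - u)`, with `e` the cutoff function, the good
term `-A⁻¹ t²` wins. -/
lemma quotient_le {A e t s X : ℝ} (hA : 1 ≤ A) (he : 0 < e) (he1 : e ≤ 1) (ht : 0 ≤ t) (hs : 0 ≤ s)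
    (hX : A * X ≤ e ^ 2 * t ^ 2) (hX' : e ^ 2 * t ^ 2 ≤ 2 * A * X)
    (h : 0 ≤ 4 * A ^ 3 * s ^ 2 * t ^ 2 + e ^ 2 * (A * (s * t ^ 3 + s ^ 4))
      + 4 * A ^ 3 * s * (e * t ^ 3 + 2 * t ^ 2 * s) + X * (-A⁻¹ * t ^ 2 + A * s ^ 2)) :
    X ≤ 900 * A ^ 9 * s ^ 2 := by
  have hA0 : 0 < A := by linarith
  set y := e * t with hy
  have hy0 : 0 ≤ y := by positivity
  have hyy : e ^ 2 * t ^ 2 = y ^ 2 := by rw [hy]; ring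
  rw [hyy] at hX hX'
  have h1 := mul_nonneg (show 0 ≤ 2 * A ^ 2 * e ^ 2 by positivity) h
  have e1 : 2 * A ^ 2 * e ^ 2 * (4 * A ^ 3 * s ^ 2 * t ^ 2 + e ^ 2 * (A * (s * t ^ 3 + s ^ 4))
      + 4 * A ^ 3 * s * (e * t ^ 3 + 2 * t ^ 2 * s) + X * (-A⁻¹ * t ^ 2 + A * s ^ 2))
      = 2 * A ^ 2 * (12 * A ^ 3 * s ^ 2 * y ^ 2 + e * (A * s * y ^ 3) + e ^ 4 * (A * s ^ 4)
        + 4 * A ^ 3 * s * y ^ 3 + e ^ 2 * (A * X * s ^ 2)) - 2 * A * X * y ^ 2 := by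
    rw [hy]; field_simp; ring
  rw [e1] at h1
  have h2 : y ^ 2 * y ^ 2 ≤ 2 * A * X * y ^ 2 := by gcongr
  have he4 : e ^ 4 ≤ 1 := pow_le_one₀ he.le he1
  have he2 : e ^ 2 ≤ 1 := pow_le_one₀ he.le he1
  have h3 : e * (A * s * y ^ 3) ≤ A ^ 3 * s * y ^ 3 := by
    calc e * (A * s * y ^ 3) ≤ 1 * (A ^ 3 * s * y ^ 3) := by
          gcongr; exact le_self_pow₀ hA (by norm_num)
      _ = _ := one_mul _
  have h4 : e ^ 4 * (A * s ^ 4) ≤ A ^ 3 * s ^ 4 := by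
    calc e ^ 4 * (A * s ^ 4) ≤ 1 * (A ^ 3 * s ^ 4) := by
          gcongr; exact le_self_pow₀ hA (by norm_num)
      _ = _ := one_mul _
  have h5 : e ^ 2 * (A * X * s ^ 2) ≤ A ^ 3 * s ^ 2 * y ^ 2 := by
    calc e ^ 2 * (A * X * s ^ 2) ≤ e ^ 2 * (y ^ 2 * s ^ 2) := by gcongr
      _ ≤ 1 * (y ^ 2 * s ^ 2) := by gcongr
      _ ≤ A ^ 3 * (y ^ 2 * s ^ 2) := by gcongr; exact one_le_pow₀ hA
      _ = _ := by ring
  have h6 : 2 * A ^ 2 * (12 * A ^ 3 * s ^ 2 * y ^ 2 + e * (A * s * y ^ 3) + e ^ 4 * (A * s ^ 4)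
        + 4 * A ^ 3 * s * y ^ 3 + e ^ 2 * (A * X * s ^ 2))
      ≤ 2 * A ^ 2 * (12 * A ^ 3 * s ^ 2 * y ^ 2 + A ^ 3 * s * y ^ 3 + A ^ 3 * s ^ 4
        + 4 * A ^ 3 * s * y ^ 3 + A ^ 3 * s ^ 2 * y ^ 2) := by gcongr
  have h7 : y ≤ 30 * A ^ 5 * s := le_of_quartic_le hs (one_le_pow₀ hA) (by nlinarith)
  have h8 : A * X ≤ A * (900 * A ^ 9 * s ^ 2) := by
    calc A * X ≤ y ^ 2 := hX
      _ ≤ (30 * A ^ 5 * s) ^ 2 := by gcongr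
      _ = _ := by ring
  exact le_of_mul_le_mul_left h8 hA0

lemma norm_sum_sum_le {n : ℕ} {A b : ℝ} (hn : (n : ℝ) ≤ A) (hb : 0 ≤ b) (f : Fin n → Fin n → ℂ)
    (hf : ∀ p q, ‖f p q‖ ≤ b) : ‖∑ p, ∑ q, f p q‖ ≤ A ^ 2 * b := by
  have h1 : ∀ p, ‖∑ q, f p q‖ ≤ n * b := fun p =>
    (norm_sum_le_of_le _ fun q _ => hf p q).trans (by simp)
  calc _ ≤ n * (n * b) := (norm_sum_le_of_le _ fun p _ => h1 p).trans (by simp)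
    _ ≤ A * (A * b) := by
        have : (0 : ℝ) ≤ n := Nat.cast_nonneg n
        have : 0 ≤ A := this.trans hn
        gcongr
    _ = _ := by ring

variable {n : ℕ} {R : Type*} [CommRing R] [StarRing R] [Algebra ℂ R] {𝒟 : DiffOps n R}
  {ev : R →⋆ₐ[ℂ] ℂ} {W : Matrix (Fin n) (Fin n) R}

lemma ev_eq_re {f : R} (hf : star f = f) : ev f = ((ev f).re : ℂ) := by
  have : star (ev f) = ev f := by rw [← map_star, hf]
  exact (Complex.conj_eq_iff_re.mp this).symm

lemma norm_ev_db {f : R} (hf : star f = f) (q : Fin n) :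
    ‖ev (𝒟.db q f)‖ = ‖ev (𝒟.d q f)‖ := by
  rw [← norm_star (ev (𝒟.d q f)), ← map_star, 𝒟.star_d, hf]

lemma heat_smul (c : ℂ) (f : R) : 𝒟.heat W (c • f) = c • 𝒟.heat W f := by
  simp only [DiffOps.heat, DiffOps.lap, Derivation.map_smul, smul_sub, Finset.smul_sum,
    mul_smul_comm]

lemma heat_add (f h : R) : 𝒟.heat W (f + h) = 𝒟.heat W f + 𝒟.heat W h := by
  simp only [DiffOps.heat, DiffOps.lap, map_add, mul_add, Finset.sum_add_distrib]
  ring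

lemma heat_algebraMap (c : ℂ) : 𝒟.heat W (algebraMap ℂ R c) = 0 := by
  simp [DiffOps.heat, DiffOps.lap]

lemma star_quotient [StarModule ℂ R] {η u S : R} (sη : star η = η) (su : star u = u)
    (sS : star S = S) (A X : ℝ) : star (η * η * S + (X : ℂ) • u - algebraMap ℂ R (2 * A * X))
      = η * η * S + (X : ℂ) • u - algebraMap ℂ R (2 * A * X) := by
  have : star (algebraMap ℂ R (2 * A * X)) = algebraMap ℂ R (2 * A * X) := by
    rw [← algebraMap_star_comm]
    simp
  rw [star_sub, star_add, star_smul, star_mul, star_mul, sη, sS, su, this, mul_comm S]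
  simp

lemma ev_quotient {η u S : R} (sη : star η = η) (su : star u = u) (sS : star S = S) (A X : ℝ) :
    (ev (η * η * S + (X : ℂ) • u - algebraMap ℂ R (2 * A * X))).re
      = (ev η).re ^ 2 * (ev S).re - X * (2 * A - (ev u).re) := by
  have e1 : ev (η * η * S + (X : ℂ) • u - algebraMap ℂ R (2 * A * X))
      = (((ev η).re ^ 2 * (ev S).re - X * (2 * A - (ev u).re) : ℝ) : ℂ) := by
    rw [map_sub, map_add, map_mul, map_mul, map_smul, ev_eq_re sη, ev_eq_re sS,
      ev_eq_re su, AlgHomClass.commutes]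
    simp only [Complex.ofReal_re, smul_eq_mul, Algebra.algebraMap_self, RingHom.id_apply]
    push_cast
    ring
  rw [e1, Complex.ofReal_re]

/-- Pointwise form of the maximum principle, at a maximum of `η² S / (2A - u)`: the function
`η² S - X (2A - u)` has vanishing gradient there and is a supersolution. -/
lemma quotient_le_of_critical {η u S : R} {A s X : ℝ} (hA : 1 ≤ A) (hn : (n : ℝ) ≤ A) (hs : 0 ≤ s)
    (hW : ∀ q p, ‖ev (W q p)‖ ≤ A) (sη : star η = η) (sS : star S = S)
    (η0 : 0 < (ev η).re) (η1 : (ev η).re ≤ 1) (dη : ∀ p, ‖ev (𝒟.d p η)‖ ≤ s)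
    (ddη : ∀ p q, ‖ev (𝒟.d p (𝒟.db q η))‖ ≤ s ^ 2) (dtη : 𝒟.dt η = 0)
    (u0 : 0 ≤ (ev u).re) (uA : (ev u).re ≤ A) (S0 : 0 ≤ (ev S).re)
    (hu : (ev (𝒟.heat W u)).re ≤ -A⁻¹ * (ev S).re + A * s ^ 2)
    (du : ∀ p, ‖ev (𝒟.d p u)‖ ≤ A * √(ev S).re)
    (hS : (ev (𝒟.heat W S)).re ≤ A * (s * (ev S).re * √(ev S).re + s ^ 4))
    (hX : (ev η).re ^ 2 * (ev S).re = X * (2 * A - (ev u).re))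
    (hd : ∀ p, ev (𝒟.d p (η * η * S + (X : ℂ) • u - algebraMap ℂ R (2 * A * X))) = 0)
    (hh : 0 ≤ (ev (𝒟.heat W (η * η * S + (X : ℂ) • u - algebraMap ℂ R (2 * A * X)))).re) :
    X ≤ 900 * A ^ 9 * s ^ 2 := by
  have hA0 : 0 < A := by linarith
  set e := (ev η).re with he
  set t := √(ev S).re with ht
  have ht0 : 0 ≤ t := Real.sqrt_nonneg _
  have hSt : (ev S).re = t ^ 2 := (Real.sq_sqrt S0).symm
  have hev : ev η = (e : ℂ) := ev_eq_re sη
  have hSv : ev S = ((t ^ 2 : ℝ) : ℂ) := by rw [← hSt]; exact ev_eq_re sS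
  rw [hSt] at hu hS hX
  have hXu : A * X ≤ e ^ 2 * t ^ 2 ∧ e ^ 2 * t ^ 2 ≤ 2 * A * X ∧ 0 ≤ X := by
    have hX0 : 0 ≤ X := by
      have h0 : 0 ≤ X * (2 * A - (ev u).re) := by rw [← hX]; positivity
      exact nonneg_of_mul_nonneg_left h0 (by linarith)
    exact ⟨by nlinarith, by nlinarith, hX0⟩
  obtain ⟨hX1, hX2, hX0⟩ := hXu
  have hdS : ∀ p, e * ‖ev (𝒟.d p S)‖ ≤ e * t ^ 3 + 2 * t ^ 2 * s := by
    intro p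
    have h1 := hd p
    simp only [map_add, map_sub, Derivation.map_smul, map_smul, Derivation.map_algebraMap, map_zero,
      Derivation.leibniz, smul_eq_mul, map_mul, hev, hSv] at h1
    have h2 : (e : ℂ) ^ 2 * ev (𝒟.d p S)
        = -(2 * e * (t ^ 2 : ℝ) * ev (𝒟.d p η) + X * ev (𝒟.d p u)) := by
      linear_combination h1
    have h3 : e ^ 2 * ‖ev (𝒟.d p S)‖ ≤ 2 * e * t ^ 2 * s + X * (A * t) := by
      calc e ^ 2 * ‖ev (𝒟.d p S)‖ = ‖(e : ℂ) ^ 2 * ev (𝒟.d p S)‖ := by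
            rw [norm_mul, norm_pow, Complex.norm_real, Real.norm_of_nonneg η0.le]
        _ ≤ ‖2 * (e : ℂ) * (t ^ 2 : ℝ) * ev (𝒟.d p η)‖ + ‖(X : ℂ) * ev (𝒟.d p u)‖ := by
            rw [h2, norm_neg]; exact norm_add_le _ _
        _ = 2 * e * t ^ 2 * ‖ev (𝒟.d p η)‖ + X * ‖ev (𝒟.d p u)‖ := by
            simp only [norm_mul, Complex.norm_real, Real.norm_of_nonneg η0.le,
              Real.norm_of_nonneg hX0, Real.norm_of_nonneg (sq_nonneg t), Complex.norm_ofNat]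
        _ ≤ _ := by
            gcongr
            exacts [dη p, du p]
    refine le_of_mul_le_mul_left (a := e) ?_ η0
    nlinarith
  set m := e * t ^ 3 + 2 * t ^ 2 * s with hm
  have hm0 : 0 ≤ m := by positivity
  have hη2 : ‖ev (𝒟.heat W (η * η))‖ ≤ 4 * A ^ 3 * s ^ 2 := by
    have h1 : ev (𝒟.heat W (η * η)) = -∑ p, ∑ q, ev (W q p) * (2 * (e : ℂ) * ev (𝒟.d p (𝒟.db q η))
        + (ev (𝒟.d p η) * ev (𝒟.db q η) + ev (𝒟.db q η) * ev (𝒟.d p η))) := by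
      rw [DiffOps.heat_mul, DiffOps.heat, dtη, DiffOps.lap]
      simp only [map_sub, map_add, map_neg, map_mul, map_sum, hev, zero_sub, mul_add,
        Finset.sum_add_distrib]
      have h2 : ∑ p, ∑ q, ev (W q p) * (2 * (e : ℂ) * ev (𝒟.d p (𝒟.db q η)))
          = 2 * (e : ℂ) * ∑ p, ∑ q, ev (W q p) * ev (𝒟.d p (𝒟.db q η)) := by
        simp only [Finset.mul_sum]
        exact Finset.sum_congr rfl fun p _ => Finset.sum_congr rfl fun q _ => by ring
      rw [h2]
      ring
    rw [h1, norm_neg]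
    have h2 := norm_sum_sum_le hn (b := A * (4 * s ^ 2)) (by positivity)
      (fun p q => ev (W q p) * (2 * (e : ℂ) * ev (𝒟.d p (𝒟.db q η))
        + (ev (𝒟.d p η) * ev (𝒟.db q η) + ev (𝒟.db q η) * ev (𝒟.d p η)))) ?_
    · refine h2.trans (le_of_eq (by ring))
    · intro p q
      have hdb : ‖ev (𝒟.db q η)‖ ≤ s := by rw [norm_ev_db sη]; exact dη q
      rw [norm_mul]
      refine mul_le_mul (hW q p) ?_ (norm_nonneg _) hA0.le
      have n1 : ‖2 * (e : ℂ) * ev (𝒟.d p (𝒟.db q η))‖ ≤ 2 * s ^ 2 := by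
        rw [norm_mul, norm_mul, Complex.norm_real, Real.norm_of_nonneg η0.le, Complex.norm_ofNat]
        calc 2 * e * ‖ev (𝒟.d p (𝒟.db q η))‖ ≤ 2 * 1 * s ^ 2 := by
              gcongr; exact ddη p q
          _ = _ := by ring
      have n2 : ‖ev (𝒟.d p η) * ev (𝒟.db q η)‖ ≤ s * s := by
        rw [norm_mul]; exact mul_le_mul (dη p) hdb (norm_nonneg _) hs
      have n3 : ‖ev (𝒟.db q η) * ev (𝒟.d p η)‖ ≤ s * s := by rw [mul_comm]; exact n2
      refine (norm_add_le _ _).trans ((add_le_add n1 ((norm_add_le _ _).trans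
        (add_le_add n2 n3))).trans (le_of_eq (by ring)))
  have hcross : ‖ev (∑ p, ∑ q, W q p * (𝒟.d p (η * η) * 𝒟.db q S + 𝒟.db q (η * η) * 𝒟.d p S))‖
      ≤ 4 * A ^ 3 * s * m := by
    simp only [map_sum]
    have h2 := norm_sum_sum_le hn (b := A * (4 * (s * m))) (by positivity)
      (fun p q => ev (W q p * (𝒟.d p (η * η) * 𝒟.db q S + 𝒟.db q (η * η) * 𝒟.d p S))) ?_
    · refine h2.trans (le_of_eq (by ring))
    · intro p q
      have e1 : ev (W q p * (𝒟.d p (η * η) * 𝒟.db q S + 𝒟.db q (η * η) * 𝒟.d p S))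
          = ev (W q p) * (2 * (ev (𝒟.d p η) * (e * ev (𝒟.db q S)))
            + 2 * (ev (𝒟.db q η) * (e * ev (𝒟.d p S)))) := by
        simp only [map_mul, map_add, Derivation.leibniz, smul_eq_mul, hev]
        ring
      have hdb : ‖ev (𝒟.db q η)‖ ≤ s := by rw [norm_ev_db sη]; exact dη q
      have n0 : ∀ z : ℂ, ‖(e : ℂ) * z‖ = e * ‖z‖ := fun z => by
        rw [norm_mul, Complex.norm_real, Real.norm_of_nonneg η0.le]
      have n1 : ‖2 * (ev (𝒟.d p η) * (e * ev (𝒟.db q S)))‖ ≤ 2 * (s * m) := by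
        rw [norm_mul, norm_mul, n0, Complex.norm_ofNat, norm_ev_db sS]
        gcongr
        exacts [dη p, hdS q]
      have n2 : ‖2 * (ev (𝒟.db q η) * (e * ev (𝒟.d p S)))‖ ≤ 2 * (s * m) := by
        rw [norm_mul, norm_mul, n0, Complex.norm_ofNat]
        gcongr
        exact hdS p
      rw [e1, norm_mul]
      refine mul_le_mul (hW q p) ?_ (norm_nonneg _) hA0.le
      exact (norm_add_le _ _).trans ((add_le_add n1 n2).trans (le_of_eq (by ring)))
  refine quotient_le hA η0 η1 ht0 hs hX1 hX2 ?_
  have e1 : 𝒟.heat W (η * η * S + (X : ℂ) • u - algebraMap ℂ R (2 * A * X))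
      = 𝒟.heat W (η * η) * S + η * η * 𝒟.heat W S
        - ∑ p, ∑ q, W q p * (𝒟.d p (η * η) * 𝒟.db q S + 𝒟.db q (η * η) * 𝒟.d p S)
        + (X : ℂ) • 𝒟.heat W u := by
    rw [sub_eq_add_neg, ← map_neg, heat_add, heat_add, heat_smul, heat_algebraMap, add_zero,
      DiffOps.heat_mul]
  rw [e1, map_add, map_sub, map_add, map_mul, map_mul, map_mul, map_smul, hev, hSv, smul_eq_mul,
    ← Complex.ofReal_mul, Complex.add_re, Complex.sub_re, Complex.add_re, Complex.re_mul_ofReal,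
    Complex.re_ofReal_mul, Complex.re_ofReal_mul] at hh
  have b1 : (ev (𝒟.heat W (η * η))).re * t ^ 2 ≤ 4 * A ^ 3 * s ^ 2 * t ^ 2 := by
    gcongr
    exact (Complex.re_le_norm _).trans hη2
  have b2 : e * e * (ev (𝒟.heat W S)).re ≤ e ^ 2 * (A * (s * t ^ 3 + s ^ 4)) := by
    rw [← sq]
    gcongr
    refine hS.trans (le_of_eq (by ring))
  have b3 := (abs_le.mp ((Complex.abs_re_le_norm _).trans hcross)).1
  have b4 : X * (ev (𝒟.heat W u)).re ≤ X * (-A⁻¹ * t ^ 2 + A * s ^ 2) := by gcongr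
  linarith

end CutoffEstimate

/-! ### The localized maximum principle -/

noncomputable section

section MaximumPrinciple

variable {n : ℕ} {T : ℝ} {V : Set (Cn n)} (hT : 0 < T) (hV : IsOpen V)

lemma evalAt_dt (f : Cyl T V) {F : ℝ × Cn n → ℂ}
    (hF : ∀ p : (Set.Icc 0 T ×ˢ V : Set (ℝ × Cn n)), evalAt p f = F p)
    (p : (Set.Icc 0 T ×ˢ V : Set (ℝ × Cn n))) :
    evalAt p ((cylOps hT hV).dt f) = derivWithin (fun t => F (t, p.1.2)) (Set.Icc 0 T) p.1.1 :=
  ((hasDerivWithinAt_dt hT hV f hF p).derivWithin (uniqueDiffOn_Icc hT _ p.2.1)).symm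

/-- A smooth function on `V`, as a function on the cylinder which does not depend on time. -/
def stationary {F : Cn n → ℂ} (hF : ContDiffOn ℝ ∞ F V) : Cyl T V :=
  mkSmooth (contDiffOn_comp_snd hF)

lemma evalAt_stationary {F : Cn n → ℂ} (hF : ContDiffOn ℝ ∞ F V)
    (p : (Set.Icc 0 T ×ˢ V : Set (ℝ × Cn n))) : evalAt p (stationary hF) = F p.1.2 := rfl

lemma dt_stationary {F : Cn n → ℂ} (hF : ContDiffOn ℝ ∞ F V) :
    (cylOps hT hV).dt (stationary hF) = 0 := by
  refine smoothAlg_ext fun p => ?_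
  rw [evalAt_dt hT hV _ (F := fun q => F q.2) (fun q => rfl), map_zero]
  exact congrFun (derivWithin_fun_const (𝕜 := ℝ) (Set.Icc 0 T) (F p.1.2)) _

/-- The `i`-th coordinate, as a real linear map. -/
def coordCLM (i : Fin n) : Cn n →L[ℝ] ℂ :=
  (EuclideanSpace.proj i : EuclideanSpace ℂ (Fin n) →L[ℂ] ℂ).restrictScalars ℝ

lemma contDiffOn_coord (i : Fin n) : ContDiffOn ℝ ∞ (fun x : Cn n => x i) V :=
  (coordCLM i).contDiff.contDiffOn

/-- The coordinate functions. -/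
def coordFun (T : ℝ) (V : Set (Cn n)) (i : Fin n) : Cyl T V := stationary (contDiffOn_coord i)

lemma fderiv_coord (i : Fin n) (x v : Cn n) : fderiv ℝ (fun y : Cn n => y i) x v = v i :=
  congrArg (fun L => L v) (coordCLM i).fderiv

lemma d_coordFun (i j : Fin n) : (cylOps hT hV).d i (coordFun T V j) = if i = j then 1 else 0 := by
  refine smoothAlg_ext fun p => ?_
  rw [evalAt_d hT hV _ (F := fun q => q.2 j) (fun q => rfl), dz, fderiv_coord, fderiv_coord]
  by_cases h : i = j
  · simp [h, coordVec]
    norm_num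
  · simp [h, coordVec, Ne.symm h]

lemma db_coordFun (i j : Fin n) : (cylOps hT hV).db i (coordFun T V j) = 0 := by
  refine smoothAlg_ext fun p => ?_
  rw [evalAt_db hT hV _ (F := fun q => q.2 j) (fun q => rfl), dzbar, fderiv_coord, fderiv_coord]
  by_cases h : i = j
  · simp [h, coordVec]
  · simp [coordVec, Ne.symm h]

/-- The cutoff function `1 - |z|² / r²`. -/
def cutoff (T : ℝ) (V : Set (Cn n)) (r : ℝ) : Cyl T V :=
  1 - (((r ^ 2)⁻¹ : ℝ) : ℂ) • ∑ i, star (coordFun T V i) * coordFun T V i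

lemma star_cutoff (r : ℝ) : star (cutoff T V r) = cutoff T V r := by
  simp [cutoff, star_smul, mul_comm]

lemma evalAt_cutoff (r : ℝ) (p : (Set.Icc 0 T ×ˢ V : Set (ℝ × Cn n))) :
    (evalAt p (cutoff T V r)).re = 1 - (r ^ 2)⁻¹ * ‖p.1.2‖ ^ 2 := by
  rw [cutoff, map_sub, map_one, map_smul, DiffOps.ev_sum_star_mul, smul_eq_mul,
    ← Complex.ofReal_mul,
    Complex.sub_re, Complex.ofReal_re, EuclideanSpace.norm_sq_eq]
  rfl

lemma d_cutoff (r : ℝ) (i : Fin n) : (cylOps hT hV).d i (cutoff T V r)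
    = -((((r ^ 2)⁻¹ : ℝ) : ℂ) • star (coordFun T V i)) := by
  have h : ∀ j, (cylOps hT hV).d i (star (coordFun T V j)) = 0 := fun j => by
    rw [← (cylOps hT hV).star_db, db_coordFun, star_zero]
  simp [cutoff, Derivation.leibniz, h, d_coordFun]

lemma db_cutoff (r : ℝ) (i : Fin n) : (cylOps hT hV).db i (cutoff T V r)
    = -((((r ^ 2)⁻¹ : ℝ) : ℂ) • coordFun T V i) := by
  have := congrArg star (d_cutoff hT hV r i)
  rw [(cylOps hT hV).star_d, star_cutoff] at this
  simpa [star_smul] using this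

lemma d_db_cutoff (r : ℝ) (i j : Fin n) : (cylOps hT hV).d i ((cylOps hT hV).db j (cutoff T V r))
    = -((((r ^ 2)⁻¹ : ℝ) : ℂ) • if i = j then 1 else 0) := by
  rw [db_cutoff, map_neg, Derivation.map_smul, d_coordFun]

lemma dt_cutoff (r : ℝ) : (cylOps hT hV).dt (cutoff T V r) = 0 := by
  have h : ∀ i, (cylOps hT hV).dt (coordFun T V i) = 0 := fun i => dt_stationary hT hV _
  have h' : ∀ i, (cylOps hT hV).dt (star (coordFun T V i)) = 0 := fun i => by
    rw [← (cylOps hT hV).star_dt, h, star_zero]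
  simp [cutoff, Derivation.leibniz, h, h']

lemma norm_coord_le (x : Cn n) (i : Fin n) : ‖x i‖ ≤ ‖x‖ := PiLp.norm_apply_le x i

lemma norm_d_cutoff_le {r : ℝ} (hr : 0 < r) {p : (Set.Icc 0 T ×ˢ V : Set (ℝ × Cn n))}
    (hp : ‖p.1.2‖ ≤ r) (i : Fin n) :
    ‖evalAt p ((cylOps hT hV).d i (cutoff T V r))‖ ≤ r⁻¹ := by
  rw [d_cutoff, map_neg, norm_neg, map_smul, map_star, norm_smul, norm_star, Complex.norm_real,
    Real.norm_of_nonneg (by positivity)]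
  calc (r ^ 2)⁻¹ * ‖evalAt p (coordFun T V i)‖ ≤ (r ^ 2)⁻¹ * r := by
        gcongr
        exact (norm_coord_le p.1.2 i).trans hp
    _ = r⁻¹ := by field_simp

lemma norm_d_db_cutoff_le (r : ℝ) (p : (Set.Icc 0 T ×ˢ V : Set (ℝ × Cn n))) (i j : Fin n) :
    ‖evalAt p ((cylOps hT hV).d i ((cylOps hT hV).db j (cutoff T V r)))‖ ≤ (r ^ 2)⁻¹ := by
  rw [d_db_cutoff, map_neg, norm_neg, map_smul, norm_smul, Complex.norm_real,
    Real.norm_of_nonneg (by positivity)]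
  refine mul_le_of_le_one_right (by positivity) ?_
  split_ifs <;> simp

set_option maxHeartbeats 800000 in
/-- The localized maximum principle behind both estimates. -/
theorem maximum_principle {r A s : ℝ} (hr : 0 < r) (hball : Metric.closedBall 0 r ⊆ V)
    (hrs : r⁻¹ ≤ s) (hA : 1 ≤ A) (hn : (n : ℝ) ≤ A) {W : Matrix (Fin n) (Fin n) (Cyl T V)}
    {u S : Cyl T V} (su : star u = u) (sS : star S = S)
    (H : ∀ p : (Set.Icc 0 T ×ˢ V : Set (ℝ × Cn n)), ‖p.1.2‖ ≤ r →
      (W.map (evalAt p)).PosSemidef ∧ (∀ i j, ‖evalAt p (W i j)‖ ≤ A) ∧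
      0 ≤ (evalAt p u).re ∧ (evalAt p u).re ≤ A ∧ 0 ≤ (evalAt p S).re ∧
      (evalAt p ((cylOps hT hV).heat W u)).re ≤ -A⁻¹ * (evalAt p S).re + A * s ^ 2 ∧
      (∀ i, ‖evalAt p ((cylOps hT hV).d i u)‖ ≤ A * √(evalAt p S).re) ∧
      (evalAt p ((cylOps hT hV).heat W S)).re
        ≤ A * (s * (evalAt p S).re * √(evalAt p S).re + s ^ 4))
    (h0 : ∀ p : (Set.Icc 0 T ×ˢ V : Set (ℝ × Cn n)), p.1.1 = 0 → ‖p.1.2‖ ≤ r →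
      (evalAt p S).re ≤ A * s ^ 2)
    (p : (Set.Icc 0 T ×ˢ V : Set (ℝ × Cn n))) (hp : 2 * ‖p.1.2‖ ^ 2 ≤ r ^ 2) :
    (evalAt p S).re ≤ 7200 * A ^ 10 * s ^ 2 := by
  have hA0 : 0 < A := by linarith
  have hri : 0 < r⁻¹ := inv_pos.mpr hr
  have hs : 0 < s := hri.trans_le hrs
  set η := cutoff T V r with hη
  set K : Set (ℝ × Cn n) := Set.Icc 0 T ×ˢ Metric.closedBall 0 r with hK
  have hKΩ : K ⊆ Set.Icc 0 T ×ˢ V := Set.prod_mono le_rfl hball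
  have hKc : IsCompact K := isCompact_Icc.prod (isCompact_closedBall _ _)
  have hmemK : ∀ q ∈ K, ‖q.2‖ ≤ r := fun q hq => by simpa using hq.2
  have hpr : ‖p.1.2‖ ≤ r := by
    refine le_of_sq_le_sq ?_ hr.le
    nlinarith [sq_nonneg ‖p.1.2‖]
  set Q : ℝ × Cn n → ℝ := fun q => (rep η q).re ^ 2 * (rep S q).re / (2 * A - (rep u q).re) with hQ
  have hpos : ∀ q : (Set.Icc 0 T ×ˢ V : Set (ℝ × Cn n)), ‖q.1.2‖ ≤ r →
      A ≤ 2 * A - (evalAt q u).re ∧ 2 * A - (evalAt q u).re ≤ 2 * A := by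
    intro q hq
    obtain ⟨-, -, h3, h4, -⟩ := H q hq
    constructor <;> linarith
  have hQe : ∀ q : (Set.Icc 0 T ×ˢ V : Set (ℝ × Cn n)), ‖q.1.2‖ ≤ r →
      (evalAt q η).re ^ 2 * (evalAt q S).re = Q q.1 * (2 * A - (evalAt q u).re) := by
    intro q hq
    have := (hpos q hq).1
    rw [hQ]
    simp only [← evalAt_eq_rep]
    rw [div_mul_cancel₀]
    linarith
  have hcont : ContinuousOn Q K := by
    have hre : ∀ f : Cyl T V, ContinuousOn (fun q => (rep f q).re) K := fun f =>
      Complex.continuous_re.comp_continuousOn ((continuousOn_rep f).mono hKΩ)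
    refine (((hre η).pow 2).mul (hre S)).div (continuousOn_const.sub (hre u)) fun q hq => ?_
    have := (hpos ⟨q, hKΩ hq⟩ (hmemK q hq)).1
    rw [evalAt_eq_rep] at this
    have h2 : 0 < 2 * A - (rep u q).re := by linarith
    exact h2.ne'
  obtain ⟨q0, hq0, hmax⟩ := hKc.exists_isMaxOn
    ⟨p.1, p.2.1, by simpa using hpr⟩ hcont
  set p0 : (Set.Icc 0 T ×ˢ V : Set (ℝ × Cn n)) := ⟨q0, hKΩ hq0⟩ with hp0
  have hp0r : ‖p0.1.2‖ ≤ r := hmemK q0 hq0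
  set X := Q q0 with hXdef
  have hle : ∀ q : (Set.Icc 0 T ×ˢ V : Set (ℝ × Cn n)), ‖q.1.2‖ ≤ r → Q q.1 ≤ X := fun q hq =>
    hmax ⟨q.2.1, by simpa using hq⟩
  have hXeq := hQe p0 hp0r
  change _ = X * _ at hXeq
  -- It is enough to bound the maximum, because `1 / 2 ≤ η` at `p`.
  suffices hX : X ≤ 900 * A ^ 9 * s ^ 2 by
    have h1 : 1 / 2 ≤ (evalAt p η).re := by
      rw [hη, evalAt_cutoff]
      have : (r ^ 2)⁻¹ * ‖p.1.2‖ ^ 2 ≤ 1 / 2 := by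
        rw [inv_mul_le_iff₀ (by positivity)]
        linarith
      linarith
    obtain ⟨-, -, -, -, hS0, -⟩ := H p hpr
    have h2 : (1 / 2) ^ 2 * (evalAt p S).re ≤ 900 * A ^ 9 * s ^ 2 * (2 * A) := by
      calc _ ≤ (evalAt p η).re ^ 2 * (evalAt p S).re := by gcongr
        _ = Q p.1 * (2 * A - (evalAt p u).re) := hQe p hpr
        _ ≤ 900 * A ^ 9 * s ^ 2 * (2 * A - (evalAt p u).re) := by
            have := (hpos p hpr).1
            have : 0 ≤ 2 * A - (evalAt p u).re := by linarith
            gcongr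
            exact (hle p hpr).trans hX
        _ ≤ _ := by
            gcongr
            exact (hpos p hpr).2
    have h3 : 900 * A ^ 9 * s ^ 2 * (2 * A) = 1800 * A ^ 10 * s ^ 2 := by ring
    rw [h3] at h2
    linarith
  obtain ⟨hW0, hWA, hu0, huA, hS0, hheatu, hdu, hheatS⟩ := H p0 hp0r
  obtain ⟨hlo, hhi⟩ := hpos p0 hp0r
  rcases le_or_gt X 0 with hX0 | hX0
  · exact hX0.trans (by positivity)
  have hηval := evalAt_cutoff (T := T) (V := V) r p0
  rw [← hη] at hηval
  have hη0 : 0 ≤ (evalAt p0 η).re := by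
    rw [hηval, sub_nonneg, inv_mul_le_iff₀ (by positivity), mul_one]
    gcongr
  have hη1 : (evalAt p0 η).re ≤ 1 := by
    rw [hηval]
    have : 0 ≤ (r ^ 2)⁻¹ * ‖p0.1.2‖ ^ 2 := by positivity
    linarith
  have hηpos : 0 < (evalAt p0 η).re := by
    refine lt_of_le_of_ne hη0 fun h => ?_
    rw [← h] at hXeq
    have : 0 < X * (2 * A - (evalAt p0 u).re) := mul_pos hX0 (by linarith)
    rw [← hXeq] at this
    norm_num at this
  have hlt : ‖p0.1.2‖ < r := by
    rw [hηval, sub_pos, inv_mul_lt_iff₀ (by positivity), mul_one] at hηpos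
    exact lt_of_pow_lt_pow_left₀ 2 hr.le hηpos
  have h9 : (1 : ℝ) ≤ A ^ 9 := one_le_pow₀ hA
  rcases eq_or_lt_of_le p0.2.1.1 with ht0 | ht0
  · have h1 := h0 p0 ht0.symm hp0r
    have h2 : A * X ≤ A * s ^ 2 := by
      calc A * X ≤ X * (2 * A - (evalAt p0 u).re) := by rw [mul_comm]; gcongr
        _ = (evalAt p0 η).re ^ 2 * (evalAt p0 S).re := hXeq.symm
        _ ≤ 1 * (evalAt p0 S).re := by gcongr; exact pow_le_one₀ hη0 hη1
        _ ≤ _ := by rw [one_mul]; exact h1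
    refine (le_of_mul_le_mul_left h2 hA0).trans ?_
    have : 0 ≤ s ^ 2 := by positivity
    nlinarith
  set Z : Cyl T V := η * η * S + (X : ℂ) • u - algebraMap ℂ (Cyl T V) (2 * A * X) with hZ
  have hηstar : star η = η := star_cutoff r
  have hstar : star Z = Z := star_quotient hηstar su sS A X
  have hZval : ∀ q, (evalAt q Z).re = (evalAt q η).re ^ 2 * (evalAt q S).re
      - X * (2 * A - (evalAt q u).re) := fun q => ev_quotient hηstar su sS A X
  have hloc : IsSpaceLocalMax Z p0 := by
    refine ⟨ht0, ?_⟩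
    have hnear : ∀ᶠ y : Cn n in nhds p0.1.2, ‖y‖ < r :=
      continuous_norm.continuousAt.eventually_lt continuousAt_const hlt
    filter_upwards [hnear] with y hy q hqy
    subst hqy
    rw [hZval, hZval, hXeq, sub_self, hQe q hy.le, ← sub_mul]
    exact mul_nonpos_of_nonpos_of_nonneg (sub_nonpos.mpr (hle q hy.le))
      (by linarith [(hpos q hy.le).1])
  have hrs2 : (r ^ 2)⁻¹ ≤ s ^ 2 := by
    rw [← inv_pow]; gcongr
  refine quotient_le_of_critical hA hn hs.le hWA hηstar sS hηpos hη1 (fun i => ?_) (fun i j => ?_)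
    (dt_cutoff hT hV r) hu0 huA hS0 hheatu hdu hheatS hXeq
    (fun i => hloc.d_eq_zero hT hV hstar i) (hloc.heat_nonneg hT hV hW0)
  · exact (norm_d_cutoff_le hT hV hr hp0r i).trans hrs
  · exact (norm_d_db_cutoff_le hT hV r p0 i j).trans hrs2

end MaximumPrinciple

end

/-! ### Bounds for matrices and for the initial metric -/

section MatrixBounds

open scoped MatrixOrder Matrix.Norms.L2Operator

variable {ι : Type*} [Fintype ι] [DecidableEq ι]

lemma norm_entry_le (A : Matrix ι ι ℂ) (i j : ι) : ‖A i j‖ ≤ ‖A‖ := by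
  have h := Matrix.l2_opNorm_mulVec A (EuclideanSpace.single j (1 : ℂ))
  rw [PiLp.norm_single, norm_one, mul_one] at h
  refine le_trans (le_of_eq ?_) ((PiLp.norm_apply_le _ i).trans h)
  simp

lemma inv_antitone {A B : Matrix ι ι ℂ} (hA : A.PosDef) (hB : B.PosDef) (h : A ≤ B) :
    B⁻¹ ≤ A⁻¹ := by
  obtain ⟨a, ha⟩ := hA.isUnit
  obtain ⟨b, hb⟩ := hB.isUnit
  have := CStarAlgebra.inv_le_inv (a := a) (b := b) (by rw [ha]; exact hA.posSemidef.nonneg)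
    (by rw [ha, hb]; exact h)
  rwa [Matrix.coe_units_inv, Matrix.coe_units_inv, ha, hb] at this

omit [Fintype ι] in
lemma posDef_smul_one {m : ℝ} (hm : 0 < m) : ((m : ℂ) • (1 : Matrix ι ι ℂ)).PosDef :=
  Matrix.PosDef.one.smul (by exact_mod_cast hm)

lemma inv_smul_one {m : ℝ} (hm : 0 < m) :
    ((m : ℂ) • (1 : Matrix ι ι ℂ))⁻¹ = ((m⁻¹ : ℝ) : ℂ) • (1 : Matrix ι ι ℂ) := by
  refine Matrix.inv_eq_left_inv ?_
  have : (m : ℂ) ≠ 0 := by exact_mod_cast hm.ne'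
  rw [Matrix.smul_mul, Matrix.one_mul, smul_smul, Complex.ofReal_inv,
    inv_mul_cancel₀ this, one_smul]

lemma norm_le_iff_le_smul_one {A : Matrix ι ι ℂ} (hA : A.PosDef) {m : ℝ} (hm : 0 ≤ m) :
    ‖A‖ ≤ m ↔ A ≤ (m : ℂ) • (1 : Matrix ι ι ℂ) := by
  rw [CStarAlgebra.norm_le_iff_le_algebraMap A hm hA.posSemidef.nonneg,
    Algebra.algebraMap_eq_smul_one]
  rfl

omit [Fintype ι] in
lemma smul_one_le_smul_one {a b : ℝ} (h : a ≤ b) :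
    (a : ℂ) • (1 : Matrix ι ι ℂ) ≤ (b : ℂ) • (1 : Matrix ι ι ℂ) := by
  rw [Matrix.le_iff, ← sub_smul]
  exact Matrix.PosSemidef.one.smul (by rw [sub_nonneg]; exact_mod_cast h)

/-- Two sided bounds on a positive definite matrix carry over to the inverse. -/
lemma bounds_of_le {G : Matrix ι ι ℂ} (hG : G.PosDef) {M : ℝ} (hM : 0 < M)
    (hlo : ((M⁻¹ : ℝ) : ℂ) • (1 : Matrix ι ι ℂ) ≤ G) (hhi : G ≤ (M : ℂ) • (1 : Matrix ι ι ℂ)) :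
    (∀ i j, ‖G i j‖ ≤ M) ∧ (∀ i j, ‖G⁻¹ i j‖ ≤ M) ∧
      (G - ((M⁻¹ : ℝ) : ℂ) • (1 : Matrix ι ι ℂ)).PosSemidef ∧
      (G⁻¹ - ((M⁻¹ : ℝ) : ℂ) • (1 : Matrix ι ι ℂ)).PosSemidef := by
  have hMi : 0 < M⁻¹ := inv_pos.mpr hM
  have h1 := inv_antitone hG (posDef_smul_one hM) hhi
  have h2 := inv_antitone (posDef_smul_one hMi) hG hlo
  rw [inv_smul_one hM] at h1
  rw [inv_smul_one hMi, inv_inv] at h2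
  exact ⟨fun i j => (norm_entry_le G i j).trans ((norm_le_iff_le_smul_one hG hM.le).mpr hhi),
    fun i j => (norm_entry_le G⁻¹ i j).trans ((norm_le_iff_le_smul_one hG.inv hM.le).mpr h2),
    Matrix.le_iff.mp hlo, Matrix.le_iff.mp h1⟩

lemma bounds_of_hermLE {n : ℕ} {A G : Matrix (Fin n) (Fin n) ℂ} (hA : A.PosDef) (hG : G.PosDef)
    {c N M : ℝ} (hc : 0 < c) (hN : 0 < N) (hAc : ‖A‖ ≤ c) (hAc' : ‖A⁻¹‖ ≤ c) (hM : c * N ≤ M)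
    (hlo : HermLE (((1 / N : ℝ) : ℂ) • A) G) (hhi : HermLE G ((N : ℂ) • A)) :
    (∀ i j, ‖G i j‖ ≤ M) ∧ (∀ i j, ‖G⁻¹ i j‖ ≤ M) ∧
      (G - ((M⁻¹ : ℝ) : ℂ) • (1 : Matrix (Fin n) (Fin n) ℂ)).PosSemidef ∧
      (G⁻¹ - ((M⁻¹ : ℝ) : ℂ) • (1 : Matrix (Fin n) (Fin n) ℂ)).PosSemidef := by
  have hM0 : 0 < M := lt_of_lt_of_le (by positivity) hM
  have hci : 0 < c⁻¹ := inv_pos.mpr hc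
  have smul_le : ∀ {a : ℝ} {X Y : Matrix (Fin n) (Fin n) ℂ}, 0 ≤ a → X ≤ Y →
      (a : ℂ) • X ≤ (a : ℂ) • Y := by
    intro a X Y ha h
    rw [Matrix.le_iff, ← smul_sub]
    exact (Matrix.le_iff.mp h).smul (by exact_mod_cast ha)
  have h1 := (norm_le_iff_le_smul_one hA hc.le).mp hAc
  have h2 := inv_antitone hA.inv (posDef_smul_one hc)
      ((norm_le_iff_le_smul_one hA.inv hc.le).mp hAc')
  rw [inv_smul_one hc, Matrix.nonsing_inv_nonsing_inv _
    ((Matrix.isUnit_iff_isUnit_det A).mp hA.isUnit)]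
    at h2
  refine bounds_of_le hG hM0 ?_ ?_
  · refine le_trans (smul_one_le_smul_one (b := 1 / N * c⁻¹) ?_)
      (le_trans (le_of_eq ?_) ((smul_le (by positivity) h2).trans (Matrix.le_iff.mpr hlo)))
    · rw [one_div, ← mul_inv, mul_comm]
      gcongr
    · rw [smul_smul]; push_cast; rfl
  · refine (Matrix.le_iff.mpr hhi).trans ((smul_le hN.le h1).trans (le_trans (le_of_eq ?_)
      (smul_one_le_smul_one (a := N * c) (by linarith))))
    rw [smul_smul]; push_cast; rfl

lemma exists_norm_bound {n : ℕ} {K : Set (Cn n)} (hK : IsCompact K) {g : MatField n}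
    (hg : ∀ i j, ContinuousOn (fun x => g x i j) K) (hpos : ∀ x ∈ K, (g x).PosDef) :
    ∃ c, ∀ x ∈ K, ‖g x‖ ≤ c ∧ ‖(g x)⁻¹‖ ≤ c := by
  have h1 : ContinuousOn g K := continuousOn_pi.mpr fun i => continuousOn_pi.mpr fun j => hg i j
  have h2 : ContinuousOn (fun x => (g x)⁻¹) K := by
    have hdet : ContinuousOn (fun x => (g x).det) K :=
      (continuous_id.matrix_det).comp_continuousOn h1
    have hadj : ContinuousOn (fun x => (g x).adjugate) K :=
      (continuous_id.matrix_adjugate).comp_continuousOn h1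
    refine ((hdet.inv₀ fun x hx => (hpos x hx).det_pos.ne').smul hadj).congr fun x hx => ?_
    rw [Matrix.inv_def, Ring.inverse_eq_inv']
    rfl
  obtain ⟨a, ha⟩ := hK.exists_bound_of_continuousOn h1
  obtain ⟨b, hb⟩ := hK.exists_bound_of_continuousOn h2
  exact ⟨max a b, fun x hx =>
    ⟨(ha x hx).trans (le_max_left _ _), (hb x hx).trans (le_max_right _ _)⟩⟩

end MatrixBounds

noncomputable section

section Stationary

variable {n : ℕ} {U V : Set (Cn n)} {T : ℝ}

/-- The first order operators `∂_i` (left summand) and `∂_{\bar i}` (right summand) on functions on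
`ℂⁿ`. -/
def wirt (α : Fin n ⊕ Fin n) (f : Cn n → ℂ) : Cn n → ℂ :=
  Sum.elim (fun i => dz i f) (fun i => dzbar i f) α

lemma contDiffOn_wirt (hU : IsOpen U) {f : Cn n → ℂ} (hf : ContDiffOn ℝ ∞ f U)
    (α : Fin n ⊕ Fin n) : ContDiffOn ℝ ∞ (wirt α f) U := by
  have h : ∀ v : Cn n, ContDiffOn ℝ ∞ (fun x => fderiv ℝ f x v) U := fun v =>
    (hf.fderiv_of_isOpen hU (m := ∞) (by simp)).clm_apply contDiffOn_const
  rcases α with i | i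
  · exact contDiffOn_const.mul ((h _).sub (contDiffOn_const.mul (h _)))
  · exact contDiffOn_const.mul ((h _).add (contDiffOn_const.mul (h _)))

lemma D_stationary (hT : 0 < T) (hV : IsOpen V) {f : Cn n → ℂ} (hf : ContDiffOn ℝ ∞ f V)
    (α : Fin n ⊕ Fin n) : (cylOps hT hV).D α (stationary (T := T) hf)
      = stationary (contDiffOn_wirt hV hf α) := by
  refine smoothAlg_ext fun p => ?_
  rcases α with i | i
  · exact evalAt_d hT hV _ (F := fun q => f q.2) (fun q => rfl) p i
  · exact evalAt_db hT hV _ (F := fun q => f q.2) (fun q => rfl) p i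

/-- The torsion of a metric on `ℂⁿ`. -/
def torsion (g : MatField n) (i k j : Fin n) (x : Cn n) : ℂ :=
  dz i (fun y => g y k j) x - dz k (fun y => g y i j) x

lemma contDiffOn_torsion (hU : IsOpen U) {g : MatField n} (hg : IsHermitianMetricOn U g)
    (i k j : Fin n) : ContDiffOn ℝ ∞ (torsion g i k j) U :=
  (contDiffOn_wirt hU (hg.smooth k j) (.inl i)).sub (contDiffOn_wirt hU (hg.smooth i j) (.inl k))

lemma exists_bound_family {ι : Type*} [Finite ι] {K : Set (Cn n)} (hK : IsCompact K)
    {f : ι → Cn n → ℂ} (hf : ∀ i, ContinuousOn (f i) K) : ∃ c, ∀ x ∈ K, ∀ i, ‖f i x‖ ≤ c := by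
  have := Fintype.ofFinite ι
  obtain ⟨c, hc⟩ := hK.exists_bound_of_continuousOn (f := fun x i => f i x) (continuousOn_pi.mpr hf)
  exact ⟨c, fun x hx i => (norm_le_pi_norm (fun i => f i x) i).trans (hc x hx)⟩

/-- Bounds at a point for the derivatives of the torsion up to order three. -/
structure TorsionBound (g : MatField n) (x : Cn n) (c : ℝ) : Prop where
  zero : ∀ i k j, ‖torsion g i k j x‖ ≤ c
  one : ∀ α i k j, ‖wirt α (torsion g i k j) x‖ ≤ c
  two : ∀ α β i k j, ‖wirt α (wirt β (torsion g i k j)) x‖ ≤ c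
  three : ∀ α β γ i k j, ‖wirt α (wirt β (wirt γ (torsion g i k j))) x‖ ≤ c

lemma TorsionBound.mono {g : MatField n} {x : Cn n} {c d : ℝ} (H : TorsionBound g x c) (h : c ≤ d) :
    TorsionBound g x d :=
  ⟨fun i k j => (H.zero i k j).trans h, fun α i k j => (H.one α i k j).trans h,
    fun α β i k j => (H.two α β i k j).trans h, fun α β γ i k j => (H.three α β γ i k j).trans h⟩

lemma exists_torsionBound (hU : IsOpen U) {K : Set (Cn n)} (hK : IsCompact K) (hKU : K ⊆ U)
    {g : MatField n} (hg : IsHermitianMetricOn U g) : ∃ c, ∀ x ∈ K, TorsionBound g x c := by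
  have h0 := contDiffOn_torsion hU hg
  have h1 := fun (α) i k j => contDiffOn_wirt hU (h0 i k j) α
  have h2 := fun (α β) i k j => contDiffOn_wirt hU (h1 β i k j) α
  have h3 := fun (α β γ) i k j => contDiffOn_wirt hU (h2 β γ i k j) α
  obtain ⟨c0, hc0⟩ := exists_bound_family hK
    (f := fun I : Fin n × Fin n × Fin n => torsion g I.1 I.2.1 I.2.2)
    fun I => (h0 I.1 I.2.1 I.2.2).continuousOn.mono hKU
  obtain ⟨c1, hc1⟩ := exists_bound_family hK
    (f := fun I : (Fin n ⊕ Fin n) × Fin n × Fin n × Fin n =>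
      wirt I.1 (torsion g I.2.1 I.2.2.1 I.2.2.2))
    fun I => (h1 I.1 I.2.1 I.2.2.1 I.2.2.2).continuousOn.mono hKU
  obtain ⟨c2, hc2⟩ := exists_bound_family hK
    (f := fun I : (Fin n ⊕ Fin n) × (Fin n ⊕ Fin n) × Fin n × Fin n × Fin n =>
      wirt I.1 (wirt I.2.1 (torsion g I.2.2.1 I.2.2.2.1 I.2.2.2.2)))
    fun I => (h2 I.1 I.2.1 I.2.2.1 I.2.2.2.1 I.2.2.2.2).continuousOn.mono hKU
  obtain ⟨c3, hc3⟩ := exists_bound_family hK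
    (f := fun I : (Fin n ⊕ Fin n) × (Fin n ⊕ Fin n) × (Fin n ⊕ Fin n) × Fin n × Fin n × Fin n =>
      wirt I.1 (wirt I.2.1 (wirt I.2.2.1 (torsion g I.2.2.2.1 I.2.2.2.2.1 I.2.2.2.2.2))))
    fun I => (h3 I.1 I.2.1 I.2.2.1 I.2.2.2.1 I.2.2.2.2.1 I.2.2.2.2.2).continuousOn.mono hKU
  refine ⟨max (max c0 c1) (max c2 c3), fun x hx => ⟨fun i k j => ?_, fun α i k j => ?_,
    fun α β i k j => ?_, fun α β γ i k j => ?_⟩⟩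
  · exact (hc0 x hx (i, k, j)).trans ((le_max_left _ _).trans (le_max_left _ _))
  · exact (hc1 x hx (α, i, k, j)).trans ((le_max_right _ _).trans (le_max_left _ _))
  · exact (hc2 x hx (α, β, i, k, j)).trans ((le_max_left _ _).trans (le_max_right _ _))
  · exact (hc3 x hx (α, β, γ, i, k, j)).trans ((le_max_right _ _).trans (le_max_right _ _))

end Stationary

end

/-! ### The flow over the ring of smooth functions -/

noncomputable section

section Bridge

variable {n : ℕ} {U V : Set (Cn n)} {T : ℝ} {h : MatField n} {g : ℝ → MatField n}

namespace IsChernRicciFlow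

/-- The solution as a matrix over the ring of smooth functions on the cylinder. -/
def metric (hg : IsChernRicciFlow V T h g) : Matrix (Fin n) (Fin n) (Cyl T V) :=
  fun i j => mkSmooth (hg.smooth i j)

variable (hg : IsChernRicciFlow V T h g) (hT : 0 < T) (hV : IsOpen V)
  (p : (Set.Icc 0 T ×ˢ V : Set (ℝ × Cn n)))

lemma evalAt_metric (i j : Fin n) : evalAt p (hg.metric i j) = g p.1.1 p.1.2 i j := rfl

lemma map_metric : hg.metric.map (evalAt p) = g p.1.1 p.1.2 := rfl

lemma evalAt_det : evalAt p hg.metric.det = (g p.1.1 p.1.2).det := by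
  rw [← hg.map_metric]
  exact RingHom.map_det (evalAt p : Cyl T V →+* ℂ) hg.metric

lemma isUnit_det : IsUnit hg.metric.det :=
  isUnit_smoothAlg _ fun p => by
    rw [evalAt_det]; exact (hg.posDef _ p.2.1 _ p.2.2).det_pos.ne'

lemma inv_mul : hg.metric⁻¹ * hg.metric = 1 := Matrix.nonsing_inv_mul _ hg.isUnit_det

lemma map_inv : hg.metric⁻¹.map (evalAt p) = (g p.1.1 p.1.2)⁻¹ := by
  refine (Matrix.inv_eq_left_inv ?_).symm
  have := congrArg (fun A => A.map (evalAt p)) hg.inv_mul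
  rw [← hg.map_metric, ← Matrix.map_mul]
  refine this.trans ?_
  exact Matrix.map_one _ (map_zero _) (map_one _)

lemma evalAt_inv (i j : Fin n) : evalAt p (hg.metric⁻¹ i j) = (g p.1.1 p.1.2)⁻¹ i j :=
  congrFun (congrFun (hg.map_inv p) i) j

lemma isHermitian : hg.metric.IsHermitian := by
  ext1 i j
  refine smoothAlg_ext fun p => ?_
  rw [Matrix.conjTranspose_apply, map_star]
  exact (hg.posDef _ p.2.1 _ p.2.2).isHermitian.apply i j

lemma isHermitian_inv : hg.metric⁻¹.IsHermitian := hg.isHermitian.inv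

/-- `∂_{\bar j} log det g = g^{\bar l k} ∂_{\bar j} g_{k \bar l}`. -/
lemma evalAt_logDet (j : Fin n) :
    evalAt p (∑ k, ∑ l, hg.metric⁻¹ l k * (cylOps hT hV).db j (hg.metric k l))
      = dzbar j (fun w => Complex.log (g p.1.1 w).det) p.1.2 := by
  set G := hg.metric with hG
  have hdet : ∀ q : (Set.Icc 0 T ×ˢ V : Set (ℝ × Cn n)), evalAt q G.det = (g q.1.1 q.1.2).det :=
    hg.evalAt_det
  have hpos := (hg.posDef _ p.2.1 _ p.2.2).det_pos
  have e1 : (cylOps hT hV).db j G.det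
      = G.det * ∑ k, ∑ l, G⁻¹ l k * (cylOps hT hV).db j (G k l) := by
    have hadj : G.adjugate = G.det • G⁻¹ := by
      rw [Matrix.inv_def, smul_smul, Ring.mul_inverse_cancel _ hg.isUnit_det, one_smul]
    rw [derivation_det, hadj, Matrix.smul_mul, Matrix.trace_smul, smul_eq_mul, Finset.sum_comm]
    rfl
  have e2 := congrArg (evalAt p) e1
  rw [map_mul, hdet, evalAt_db hT hV G.det (F := fun q => (g q.1 q.2).det) hdet] at e2
  have hd := hasFDerivAt_slice hV G.det (F := fun q => (g q.1 q.2).det) hdet p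
  have hlog := (Complex.hasStrictFDerivAt_log_real
    (Or.inl (Complex.pos_iff.mp hpos).1)).hasFDerivAt.comp p.1.2 hd
  have e3 : dzbar j (fun w => Complex.log (g p.1.1 w).det) p.1.2
      = (g p.1.1 p.1.2).det⁻¹ * dzbar j (fun w => (g p.1.1 w).det) p.1.2 := by
    have hlog' := hlog.fderiv
    simp only [Function.comp_def] at hlog'
    rw [dzbar, dzbar, hlog', hd.fderiv]
    simp only [ContinuousLinearMap.comp_apply, smul_apply,
      one_apply_eq_self, smul_eq_mul]
    ring
  rw [e3, e2, inv_mul_cancel_left₀ hpos.ne']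

lemma isFlow : (cylOps hT hV).IsFlow hg.metric hg.metric⁻¹ := by
  intro i j
  refine smoothAlg_ext fun p => ?_
  rw [evalAt_dt hT hV _ (F := fun q => g q.1 q.2 i j) (fun _ => rfl),
    (hg.evolution _ p.2.1 _ p.2.2 i j).derivWithin (uniqueDiffOn_Icc hT _ p.2.1),
      chernRicci, neg_neg,
    evalAt_d hT hV _ (F := fun q => dzbar j (fun w => Complex.log (g q.1 w).det) q.2)
      fun q => hg.evalAt_logDet hT hV q j]

lemma evalAt_gam (i k l : Fin n) :
    evalAt p ((cylOps hT hV).gam hg.metric hg.metric⁻¹ i k l)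
      = christoffel (g p.1.1) i k l p.1.2 := by
  rw [DiffOps.gam, Matrix.mul_apply, map_sum, christoffel]
  refine Finset.sum_congr rfl fun s _ => ?_
  rw [map_mul, evalAt_inv, matDeriv_apply,
    evalAt_d hT hV _ (F := fun q => g q.1 q.2 k s) (fun _ => rfl), mul_comm]

lemma evalAt_rm (i j k l : Fin n) :
    evalAt p ((cylOps hT hV).rm hg.metric hg.metric⁻¹ i j k l)
      = chernCurvatureUp (g p.1.1) i j k l p.1.2 := by
  rw [DiffOps.rm, Matrix.neg_apply, map_neg, matDeriv_apply,
    evalAt_db hT hV _ (F := fun q => christoffel (g q.1) i k l q.2)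
      (fun q => hg.evalAt_gam hT hV q i k l), chernCurvatureUp]

lemma evalAt_rm_mul (i j k l : Fin n) :
    evalAt p (((cylOps hT hV).rm hg.metric hg.metric⁻¹ i j * hg.metric) k l)
      = chernCurvature (g p.1.1) i j k l p.1.2 := by
  rw [Matrix.mul_apply, map_sum, chernCurvature]
  refine Finset.sum_congr rfl fun r _ => ?_
  rw [map_mul, evalAt_rm, evalAt_metric, mul_comm]

lemma evalAt_d_metric (i j k : Fin n) : evalAt p ((cylOps hT hV).d i (hg.metric j k))
    = dz i (fun y => g p.1.1 y j k) p.1.2 :=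
  evalAt_d hT hV _ (F := fun q => g q.1 q.2 j k) (fun _ => rfl) p i

/-- The torsion of the solution is that of the initial metric. -/
lemma tor_eq (hU : IsOpen U) (hh : IsHermitianMetricOn U h) (hVU : V ⊆ U) (i k j : Fin n) :
    (cylOps hT hV).tor hg.metric i k j
      = stationary ((contDiffOn_torsion hU hh i k j).mono hVU) := by
  have hs : ∀ i j, ContDiffOn ℝ ∞ (fun x => h x i j) V := fun i j => (hh.smooth i j).mono hVU
  set f := (cylOps hT hV).tor hg.metric i k j
    - stationary ((contDiffOn_torsion hU hh i k j).mono hVU) with hf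
  have hdt : (cylOps hT hV).dt f = 0 := by
    rw [hf, map_sub, (hg.isFlow hT hV).dt_tor, dt_stationary, sub_self]
  rw [← sub_eq_zero]
  change f = 0
  refine smoothAlg_ext fun p => ?_
  have h0 : (0 : ℝ) ∈ Set.Icc 0 T := ⟨le_rfl, hT.le⟩
  have hconst : rep f (p.1.1, p.1.2) = rep f (0, p.1.2) := by
    refine (convex_Icc 0 T).is_const_of_fderivWithin_eq_zero (𝕜 := ℝ)
      (f := fun t => rep f (t, p.1.2)) ?_ ?_ p.2.1 h0
    · exact fun t ht =>
        (hasDerivWithinAt_dt hT hV f (evalAt_eq_rep f)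
          ⟨(t, p.1.2), ht, p.2.2⟩).differentiableWithinAt
    · intro t ht
      have := hasDerivWithinAt_dt hT hV f (evalAt_eq_rep f) ⟨(t, p.1.2), ht, p.2.2⟩
      rw [hdt, map_zero] at this
      rw [this.hasFDerivWithinAt.fderivWithin (uniqueDiffOn_Icc hT t ht)]
      ext
      simp
  have hd : ∀ i k j, dz i (fun y => g 0 y k j) p.1.2 = dz i (fun y => h y k j) p.1.2 := by
    intro i k j
    have : (fun y => g 0 y k j) =ᶠ[nhds p.1.2] fun y => h y k j := by
      filter_upwards [hV.mem_nhds p.2.2] with y hy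
      rw [hg.initial y hy]
    rw [dz, dz, this.fderiv_eq]
  rw [evalAt_eq_rep, hconst, ← evalAt_eq_rep f ⟨(0, p.1.2), h0, p.2.2⟩, hf, map_sub,
    evalAt_stationary, DiffOps.tor, map_sub, evalAt_d_metric, evalAt_d_metric]
  simp only [hd]
  rw [torsion, sub_self, map_zero]

open scoped Matrix.Norms.L2Operator in
lemma metricBound (hU : IsOpen U) (hh : IsHermitianMetricOn U h) (hVU : V ⊆ U) {M c N : ℝ}
    (hc : 0 < c) (hN : 0 < N) (hM : c * N ≤ M) (hcM : c ≤ M) (h1 : ‖h p.1.2‖ ≤ c)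
    (h2 : ‖(h p.1.2)⁻¹‖ ≤ c) (h3 : TorsionBound h p.1.2 c)
    (hlo : HermLE (((1 / N : ℝ) : ℂ) • h p.1.2) (g p.1.1 p.1.2))
    (hhi : HermLE (g p.1.1 p.1.2) ((N : ℂ) • h p.1.2)) :
    (cylOps hT hV).MetricBound (evalAt p) M hg.metric hg.metric⁻¹ := by
  obtain ⟨b1, b2, b3, b4⟩ := bounds_of_hermLE (hh.posDef _ (hVU p.2.2)) (hg.posDef _ p.2.1 _ p.2.2)
    hc hN h1 h2 hM hlo hhi
  have hjet : ∀ {f : Cn n → ℂ} (hf : ContDiffOn ℝ ∞ f V), ‖f p.1.2‖ ≤ c →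
      DiffOps.Jet0 (evalAt p) M 1 1 (stationary (T := T) hf) := by
    intro f hf hle
    rw [DiffOps.Jet0, pow_one, mul_one, evalAt_stationary]
    exact hle.trans hcM
  refine ⟨hg.inv_mul, hg.isHermitian, hg.isHermitian_inv, hg.isFlow hT hV, fun i j => ?_,
    fun i j => ?_, ?_, ?_, fun i k j => ?_, fun α i k j => ?_⟩
  · rw [DiffOps.Jet0, pow_one, mul_one]
    exact b1 i j
  · rw [DiffOps.Jet0, pow_one, mul_one, evalAt_inv]
    exact b2 i j
  · rw [hg.map_metric]; exact b3
  · rw [hg.map_inv]; exact b4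
  · rw [hg.tor_eq hT hV hU hh hVU]
    refine ⟨hjet _ (h3.zero i k j), fun α => ?_⟩
    rw [D_stationary]
    exact hjet _ (h3.one α i k j)
  · rw [hg.tor_eq hT hV hU hh hVU, D_stationary]
    refine ⟨hjet _ (h3.one α i k j), fun β => ⟨?_, fun γ => ?_⟩⟩
    · rw [D_stationary]
      exact hjet _ (h3.two β α i k j)
    · rw [D_stationary, D_stationary]
      exact hjet _ (h3.three γ β α i k j)

end IsChernRicciFlow

end Bridge

end

/-! ### The initial time; norms of tensors -/

noncomputable section

section InitialMetric

variable {n : ℕ} {U V : Set (Cn n)} {T : ℝ} {h : MatField n} {g : ℝ → MatField n}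

/-- Bounds at a point for the inverse and for the first and second derivatives of a metric. -/
structure InitialBound (h : MatField n) (x : Cn n) (c : ℝ) : Prop where
  inv : ∀ i j, ‖(h x)⁻¹ i j‖ ≤ c
  one : ∀ α i j, ‖wirt α (fun y => h y i j) x‖ ≤ c
  two : ∀ α β i j, ‖wirt α (wirt β fun y => h y i j) x‖ ≤ c

lemma InitialBound.mono {x : Cn n} {c d : ℝ} (H : InitialBound h x c) (hcd : c ≤ d) :
    InitialBound h x d :=
  ⟨fun i j => (H.inv i j).trans hcd, fun α i j => (H.one α i j).trans hcd,
    fun α β i j => (H.two α β i j).trans hcd⟩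

lemma InitialBound.christoffel_le {x : Cn n} {c M : ℝ} (H : InitialBound h x c) (hn : (n : ℝ) ≤ M)
    (hM : c ≤ M) (i k l : Fin n) : ‖christoffel h i k l x‖ ≤ M ^ 3 := by
  have hM0 : 0 ≤ M := (Nat.cast_nonneg n).trans hn
  have h1 : ∀ s, ‖(h x)⁻¹ s l * dz i (fun y => h y k s) x‖ ≤ M * M := fun s => by
    rw [norm_mul]
    exact mul_le_mul ((H.inv s l).trans hM) ((H.one (.inl i) k s).trans hM) (norm_nonneg _) hM0
  calc _ ≤ n * (M * M) := (norm_sum_le_of_le _ fun s _ => h1 s).trans (by simp)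
    _ ≤ M * (M * M) := by gcongr
    _ = M ^ 3 := by ring

lemma wirt_congr {α : Fin n ⊕ Fin n} {f f' : Cn n → ℂ} {x : Cn n} (h : f =ᶠ[nhds x] f') :
    wirt α f x = wirt α f' x := by
  rcases α with i | i
  · simp only [wirt, Sum.elim_inl, dz, h.fderiv_eq]
  · simp only [wirt, Sum.elim_inr, dzbar, h.fderiv_eq]

lemma evalAt_D (hT : 0 < T) (hV : IsOpen V) (f : Cyl T V) {F : ℝ × Cn n → ℂ}
    (hF : ∀ p : (Set.Icc 0 T ×ˢ V : Set (ℝ × Cn n)), evalAt p f = F p)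
    (p : (Set.Icc 0 T ×ˢ V : Set (ℝ × Cn n))) (α : Fin n ⊕ Fin n) :
    evalAt p ((cylOps hT hV).D α f) = wirt α (fun y => F (p.1.1, y)) p.1.2 := by
  rcases α with i | i
  · exact evalAt_d hT hV f hF p i
  · exact evalAt_db hT hV f hF p i

lemma exists_initialBound (hU : IsOpen U) {K : Set (Cn n)} (hK : IsCompact K) (hKU : K ⊆ U)
    (hh : IsHermitianMetricOn U h) {a : ℝ} (ha : ∀ x ∈ K, ∀ i j, ‖(h x)⁻¹ i j‖ ≤ a) :
    ∃ c, ∀ x ∈ K, InitialBound h x c := by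
  have h1 := fun (α) i j => contDiffOn_wirt hU (hh.smooth i j) α
  have h2 := fun (α β) i j => contDiffOn_wirt hU (h1 β i j) α
  obtain ⟨c1, hc1⟩ := exists_bound_family hK
    (f := fun I : (Fin n ⊕ Fin n) × Fin n × Fin n => wirt I.1 fun y => h y I.2.1 I.2.2)
    fun I => (h1 I.1 I.2.1 I.2.2).continuousOn.mono hKU
  obtain ⟨c2, hc2⟩ := exists_bound_family hK
    (f := fun I : (Fin n ⊕ Fin n) × (Fin n ⊕ Fin n) × Fin n × Fin n =>
      wirt I.1 (wirt I.2.1 fun y => h y I.2.2.1 I.2.2.2))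
    fun I => (h2 I.1 I.2.1 I.2.2.1 I.2.2.2).continuousOn.mono hKU
  refine ⟨max a (max c1 c2), fun x hx => ⟨fun i j => ?_, fun α i j => ?_, fun α β i j => ?_⟩⟩
  · exact (ha x hx i j).trans (le_max_left _ _)
  · exact (hc1 x hx (α, i, j)).trans ((le_max_left _ _).trans (le_max_right _ _))
  · exact (hc2 x hx (α, β, i, j)).trans ((le_max_right _ _).trans (le_max_right _ _))

namespace IsChernRicciFlow

variable (hg : IsChernRicciFlow V T h g) (hT : 0 < T) (hV : IsOpen V)
  {p : (Set.Icc 0 T ×ˢ V : Set (ℝ × Cn n))}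

include hg hV in
lemma eventuallyEq_initial (hp : p.1.1 = 0) (i j : Fin n) :
    (fun y => g p.1.1 y i j) =ᶠ[nhds p.1.2] fun y => h y i j := by
  filter_upwards [hV.mem_nhds p.2.2] with y hy
  rw [hp, hg.initial y hy]

include hg hV in
lemma christoffel_initial (hp : p.1.1 = 0) (i k l : Fin n) :
    christoffel (g p.1.1) i k l p.1.2 = christoffel h i k l p.1.2 := by
  refine Finset.sum_congr rfl fun s _ => ?_
  have h1 : dz i (fun y => g p.1.1 y k s) p.1.2 = dz i (fun y => h y k s) p.1.2 :=
    wirt_congr (α := .inl i) (hg.eventuallyEq_initial hV hp k s)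
  rw [h1, hp, hg.initial _ p.2.2]

lemma evalAt_D_D_metric_initial (hp : p.1.1 = 0) (α β : Fin n ⊕ Fin n) (i j : Fin n) :
    evalAt p ((cylOps hT hV).D α ((cylOps hT hV).D β (hg.metric i j)))
      = wirt α (wirt β fun y => h y i j) p.1.2 := by
  rw [evalAt_D hT hV _ (F := fun q => wirt β (fun y => g q.1 y i j) q.2)
    (fun q => evalAt_D hT hV _ (F := fun q => g q.1 q.2 i j) (fun _ => rfl) q β)]
  refine wirt_congr ?_
  filter_upwards [hV.mem_nhds p.2.2] with y hy
  exact wirt_congr (hg.eventuallyEq_initial hV (p := ⟨(p.1.1, y), p.2.1, hy⟩) hp i j)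

end IsChernRicciFlow

end InitialMetric

section TensorNorms

variable {n : ℕ} {M : ℝ}

lemma norm_sum_fin_le (hn : (n : ℝ) ≤ M) {b : ℝ} (hb : 0 ≤ b) {f : Fin n → ℂ}
    (hf : ∀ i, ‖f i‖ ≤ b) : ‖∑ i, f i‖ ≤ M * b :=
  ((norm_sum_le_of_le _ fun i _ => hf i).trans (by simp)).trans
    (mul_le_mul_of_nonneg_right hn hb : (n : ℝ) * b ≤ M * b)

lemma normSq3_le (hn : (n : ℝ) ≤ M) {G : Matrix (Fin n) (Fin n) ℂ} (hG : ∀ i j, ‖G⁻¹ i j‖ ≤ M)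
    {A : Fin n → Fin n → Fin n → ℂ} {b : ℝ} (hb : 0 ≤ b) (hA : ∀ i j k, ‖A i j k‖ ≤ b) :
    normSq3 G A ≤ M ^ 9 * b ^ 2 := by
  have hM : 0 ≤ M := (Nat.cast_nonneg n).trans hn
  refine (Complex.re_le_norm _).trans ((le_of_le_of_eq (b := M * (M * (M * (M * (M * (M *
    (M * M * M * b * b))))))) ?_ (by ring)))
  refine norm_sum_fin_le hn (by positivity) fun i => norm_sum_fin_le hn (by positivity) fun a =>
    norm_sum_fin_le hn (by positivity) fun j => norm_sum_fin_le hn (by positivity) fun b =>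
    norm_sum_fin_le hn (by positivity) fun k => norm_sum_fin_le hn (by positivity) fun c => ?_
  simp only [norm_mul, RCLike.norm_conj]
  gcongr <;> first | apply hG | apply hA

lemma normSq4_le (hn : (n : ℝ) ≤ M) {G : Matrix (Fin n) (Fin n) ℂ} (hG : ∀ i j, ‖G⁻¹ i j‖ ≤ M)
    {A : Fin n → Fin n → Fin n → Fin n → ℂ} {b : ℝ} (hb : 0 ≤ b) (hA : ∀ i j k l, ‖A i j k l‖ ≤ b) :
    normSq4 G A ≤ M ^ 12 * b ^ 2 := by
  have hM : 0 ≤ M := (Nat.cast_nonneg n).trans hn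
  refine (Complex.re_le_norm _).trans ((le_of_le_of_eq (b := M * (M * (M * (M * (M * (M * (M * (M *
    (M * M * M * M * b * b))))))))) ?_ (by ring)))
  refine norm_sum_fin_le hn (by positivity) fun i => norm_sum_fin_le hn (by positivity) fun a =>
    norm_sum_fin_le hn (by positivity) fun j => norm_sum_fin_le hn (by positivity) fun b =>
    norm_sum_fin_le hn (by positivity) fun k => norm_sum_fin_le hn (by positivity) fun c =>
    norm_sum_fin_le hn (by positivity) fun l => norm_sum_fin_le hn (by positivity) fun d => ?_
  simp only [norm_mul, RCLike.norm_conj]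
  gcongr <;> first | apply hG | apply hA

end TensorNorms

end

/-! ### The local estimates -/

noncomputable section

section Estimates

namespace DiffOps

variable {n : ℕ} {R : Type*} [CommRing R] [StarRing R] [Algebra ℂ R] {𝒟 : DiffOps n R}
  {ev : R →⋆ₐ[ℂ] ℂ} {M s : ℝ} [hM : Fact (4 ≤ M)] [hn : Fact ((n : ℝ) ≤ M)]
  {g W : Matrix (Fin n) (Fin n) R}

lemma star_calabi (hg : g.IsHermitian) (hW : W.IsHermitian) :
    star (𝒟.calabi g W) = 𝒟.calabi g W := by
  have h : (row (𝒟.gam g W) * triple g W * (row (𝒟.gam g W)).conjTranspose).IsHermitian :=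
    Matrix.isHermitian_mul_mul_conjTranspose _ (triple_isHermitian hg hW)
  exact h.apply () ()

omit [Algebra ℂ R] in
lemma star_trace (hg : g.IsHermitian) : star g.trace = g.trace := by
  rw [← Matrix.trace_conjTranspose, hg.eq]

omit [Algebra ℂ R] in
lemma star_sum_star_mul {ι : Type*} (t : Finset ι) (f : ι → R) :
    star (∑ i ∈ t, star (f i) * f i) = ∑ i ∈ t, star (f i) * f i := by
  simp [mul_comm]

lemma star_gradSq : star (𝒟.gradSq g) = 𝒟.gradSq g := star_sum_star_mul _ _

lemma star_hessSq : star (𝒟.hessSq g) = 𝒟.hessSq g := star_sum_star_mul _ _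

lemma one_le_pow_of_fact (k : ℕ) : 1 ≤ M ^ k := one_le_pow₀ (by linarith [hM.out])

lemma pow_le_pow_of_fact {k l : ℕ} (h : k ≤ l) : M ^ k ≤ M ^ l :=
  pow_le_pow_right₀ (by linarith [hM.out]) h

namespace MetricBound

omit hn in
lemma posSemidef_W (H : 𝒟.MetricBound ev M g W) : (W.map ev).PosSemidef := by
  have hM4 := hM.out
  have h0 : (0 : ℂ) ≤ ((M⁻¹ : ℝ) : ℂ) := by
    have : 0 ≤ M⁻¹ := by positivity
    exact_mod_cast this
  have := H.W_ge.add (Matrix.PosSemidef.one.smul h0)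
  rwa [sub_add_cancel] at this

omit hn in
lemma posSemidef_g (H : 𝒟.MetricBound ev M g W) : (g.map ev).PosSemidef := by
  have hM4 := hM.out
  have h0 : (0 : ℂ) ≤ ((M⁻¹ : ℝ) : ℂ) := by
    have : 0 ≤ M⁻¹ := by positivity
    exact_mod_cast this
  have := H.g_ge.add (Matrix.PosSemidef.one.smul h0)
  rwa [sub_add_cancel] at this

omit hM hn in
lemma norm_W_le (H : 𝒟.MetricBound ev M g W) (i j : Fin n) : ‖ev (W i j)‖ ≤ M := by
  have := H.W_le i j
  rwa [Jet0, pow_one, mul_one] at this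

omit hM hn in
lemma norm_g_le (H : 𝒟.MetricBound ev M g W) (i j : Fin n) : ‖ev (g i j)‖ ≤ M := by
  have := H.g_le i j
  rwa [Jet0, pow_one, mul_one] at this

omit hn in
lemma trace_nonneg (H : 𝒟.MetricBound ev M g W) : 0 ≤ (ev g.trace).re := by
  have h := H.posSemidef_g.trace_nonneg
  have e : (g.map ev).trace = ev g.trace := by simp [Matrix.trace]
  rw [e] at h
  exact (Complex.le_def.mp h).1

lemma trace_le (H : 𝒟.MetricBound ev M g W) : (ev g.trace).re ≤ M ^ 2 := by
  refine (Complex.re_le_norm _).trans ?_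
  have hM4 := hM.out
  rw [Matrix.trace, map_sum, sq]
  exact norm_sum_fin_le hn.out (by linarith) fun i => H.norm_g_le i i

/-- The Chern curvature in terms of the first and second derivatives of the metric. -/
lemma norm_rm_mul_le (H : 𝒟.MetricBound ev M g W) {k : ℕ} {s : ℝ} (hk : 4 ≤ k) (hs : 0 ≤ s)
    (h1 : ∀ α i j, Jet0 ev M 0 s (𝒟.D α (g i j)))
    (h2 : ∀ α β i j, Jet0 ev M k (s ^ 2) (𝒟.D α (𝒟.D β (g i j)))) (i j a b : Fin n) :
    Jet0 ev M (k + 1) (s ^ 2) ((𝒟.rm g W i j * g) a b) := by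
  have hΓ : ∀ x y, Jet0 ev M 2 s (𝒟.gam g W i x y) :=
    Jet0.matMul_fin (k := 0) (l := 1) (fun x y => h1 (.inl i) x y) H.W_le (by linarith)
  have h3 : ∀ x y, Jet0 ev M 3 (s ^ 2) ((𝒟.gam g W i * matDeriv (𝒟.db j) g) x y) :=
    Jet0.matMul_fin (k := 2) (l := 0) hΓ (fun x y => h1 (.inr j) x y) (by nlinarith)
  rw [𝒟.rm_mul H.inv]
  exact Jet0.mono (Jet0.sub (h3 a b) (h2 (.inl i) (.inr j) a b))
    (by omega) le_rfl

end MetricBound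

end DiffOps

end Estimates

section LocalEstimates

variable {n : ℕ} {V : Set (Cn n)} {T : ℝ} {h : MatField n} {g : ℝ → MatField n} {M r : ℝ}
  [hM : Fact (4 ≤ M)] [hn : Fact ((n : ℝ) ≤ M)]

open DiffOps

namespace IsChernRicciFlow

variable (hg : IsChernRicciFlow V T h g) (hT : 0 < T) (hV : IsOpen V) (hr : 0 < r) (hr1 : r < 1)
  (hball : Metric.ball 0 r ⊆ V)
  (H : ∀ p : (Set.Icc 0 T ×ˢ V : Set (ℝ × Cn n)), ‖p.1.2‖ ≤ 3 * r / 4 →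
    (cylOps hT hV).MetricBound (evalAt p) M hg.metric hg.metric⁻¹ ∧ InitialBound h p.1.2 M)

include hr hr1 hball H in
/-- The maximum principle for `u = tr g` and `S = |Γ|²`, on the ball of radius `3 r / 4` and at
the scale `s = 2 / r`. -/
lemma calabi_bound (p : (Set.Icc 0 T ×ˢ V : Set (ℝ × Cn n))) (hp : ‖p.1.2‖ ≤ r / 2) :
    (evalAt p ((cylOps hT hV).calabi hg.metric hg.metric⁻¹)).re ≤ (M ^ 584 / r) ^ 2 := by
  have hM4 := hM.out
  have hM1 : 1 ≤ M := by linarith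
  have hM0 : 0 < M := by linarith
  have hs : 1 ≤ 2 / r := by rw [le_div_iff₀ hr]; linarith
  have key := maximum_principle hT hV (r := 3 * r / 4) (A := M ^ 116) (s := 2 / r)
    (W := hg.metric⁻¹) (u := hg.metric.trace)
    (S := (cylOps hT hV).calabi hg.metric hg.metric⁻¹) (by linarith)
    ((Metric.closedBall_subset_ball (by linarith)).trans hball)
    (by rw [inv_div, div_le_div_iff₀ (by linarith) hr]; linarith) (one_le_pow_of_fact _)
    (hn.out.trans (le_self_pow₀ hM1 (by norm_num))) (star_trace hg.isHermitian)
    (star_calabi hg.isHermitian hg.isHermitian_inv) ?_ ?_ p ?_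
  · refine key.trans ?_
    have h7 : (28800 : ℝ) ≤ M ^ 8 := by
      calc (28800 : ℝ) ≤ 4 ^ 8 := by norm_num
        _ ≤ M ^ 8 := by gcongr
    calc 7200 * (M ^ 116) ^ 10 * (2 / r) ^ 2 = 28800 * M ^ 1160 / r ^ 2 := by ring
      _ ≤ M ^ 8 * M ^ 1160 / r ^ 2 := by gcongr
      _ = (M ^ 584 / r) ^ 2 := by rw [div_pow, ← pow_mul, ← pow_add]
  · intro q hq
    obtain ⟨B, -⟩ := H q hq
    have hS := B.calabi_nonneg
    set S := (evalAt q ((cylOps hT hV).calabi hg.metric hg.metric⁻¹)).re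
    refine ⟨B.posSemidef_W, fun i j => (B.norm_W_le i j).trans (le_self_pow₀ hM1 (by norm_num)),
      B.trace_nonneg, B.trace_le.trans (pow_le_pow_of_fact (by norm_num)), hS, ?_, fun i => ?_,
      B.heat_calabi_le_rpow hs⟩
    · refine B.heat_trace_le.trans ?_
      have h1 : (M ^ 116)⁻¹ * S ≤ (M ^ 15)⁻¹ * S := by
        gcongr
        norm_num
      have h2 : M ^ 6 ≤ M ^ 116 * (2 / r) ^ 2 :=
        (pow_le_pow_of_fact (by norm_num)).trans
          (le_mul_of_one_le_right (by positivity) (one_le_pow₀ hs))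
      linarith
    · refine (B.d_trace_le i).trans ?_
      gcongr
      norm_num
  · intro q hq0 hq
    obtain ⟨B, I⟩ := H q hq
    have hΓ : ∀ i j l, Jet0 (evalAt q) M 3 1
        ((cylOps hT hV).gam hg.metric hg.metric⁻¹ i j l) := by
      intro i j l
      rw [Jet0, hg.evalAt_gam, hg.christoffel_initial hV hq0, mul_one]
      exact I.christoffel_le hn.out le_rfl i j l
    refine (B.calabi_le zero_le_one hΓ).trans ?_
    rw [one_pow, mul_one]
    exact (pow_le_pow_of_fact (by norm_num)).trans
      (le_mul_of_one_le_right (by positivity) (one_le_pow₀ hs))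
  · have : ‖p.1.2‖ ^ 2 ≤ (r / 2) ^ 2 := by gcongr
    nlinarith

include hr hr1 hball H in
/-- The first derivatives of the metric are of order `1 / r`. -/
lemma grad_bound (p : (Set.Icc 0 T ×ˢ V : Set (ℝ × Cn n))) (hp : ‖p.1.2‖ ≤ r / 2)
    (α : Fin n ⊕ Fin n) (i j : Fin n) :
    Jet0 (evalAt p) M 0 (M ^ 588 / r) ((cylOps hT hV).D α (hg.metric i j)) := by
  have hM4 := hM.out
  obtain ⟨B, -⟩ := H p (by linarith)
  have hS := hg.calabi_bound hT hV hr hr1 hball H p hp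
  have h1 : √(evalAt p ((cylOps hT hV).calabi hg.metric hg.metric⁻¹)).re ≤ M ^ 584 / r :=
    Real.sqrt_le_iff.mpr ⟨by positivity, hS⟩
  have h2 := B.D_g (by positivity) B.gam_le_sqrt_calabi α i j
  refine h2.trans ?_
  rw [pow_zero, one_mul]
  calc _ ≤ M ^ 2 * (M ^ 2 * (M ^ 584 / r)) := by gcongr
    _ = M ^ 588 / r := by ring

include hr hr1 hball H in
/-- The maximum principle for `u = ∑ |∂g|² / s²` and `S = ∑ |∂∂g|² / s²`, on the ball of radius
`r / 2`, where `s = M ^ 588 / r` bounds the first derivatives. -/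
lemma hess_bound (p : (Set.Icc 0 T ×ˢ V : Set (ℝ × Cn n))) (hp : ‖p.1.2‖ ≤ r / 4)
    (α β : Fin n ⊕ Fin n) (i j : Fin n) :
    Jet0 (evalAt p) M 514 ((M ^ 588 / r) ^ 2)
      ((cylOps hT hV).D α ((cylOps hT hV).D β (hg.metric i j))) := by
  have hM4 := hM.out
  have hM1 : 1 ≤ M := by linarith
  have hM0 : 0 < M := by linarith
  set s := M ^ 588 / r with hs_def
  have hs2 : 2 / r ≤ s := by
    rw [hs_def]
    gcongr
    exact (by linarith : (2 : ℝ) ≤ M).trans (le_self_pow₀ hM1 (by norm_num))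
  have hs : 1 ≤ s := le_trans (by rw [le_div_iff₀ hr]; linarith) hs2
  have hs0 : 0 < s := by linarith
  set c : ℂ := (((s ^ 2)⁻¹ : ℝ) : ℂ) with hc
  have hstarc : star c = c := Complex.conj_ofReal _
  set P := (cylOps hT hV).hessSq hg.metric with hP
  have hev : ∀ q (f : Cyl T V), (evalAt q (c • f)).re = (s ^ 2)⁻¹ * (evalAt q f).re := by
    intro q f
    rw [map_smul, smul_eq_mul, hc, Complex.re_ofReal_mul]
  have hsqrt : ∀ x : ℝ, √((s ^ 2)⁻¹ * x) = s⁻¹ * √x := fun x => by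
    rw [Real.sqrt_mul (by positivity), ← inv_pow, Real.sqrt_sq (by positivity)]
  have key := maximum_principle hT hV (r := r / 2) (A := M ^ 102) (s := s)
    (W := hg.metric⁻¹) (u := c • (cylOps hT hV).gradSq hg.metric)
    (S := c • P) (by linarith)
    ((Metric.closedBall_subset_ball (by linarith)).trans hball)
    (by rw [inv_div]; exact hs2) (one_le_pow_of_fact _)
    (hn.out.trans (le_self_pow₀ hM1 (by norm_num)))
    (by rw [star_smul, star_gradSq, hstarc]) (by rw [star_smul, star_hessSq, hstarc]) ?_ ?_ p ?_
  · rw [hev, inv_mul_le_iff₀ (by positivity)] at key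
    have h1 : ‖evalAt p ((cylOps hT hV).D α ((cylOps hT hV).D β (hg.metric i j)))‖
        ≤ √(evalAt p P).re :=
      norm_sq_le_of_ev_sum (fun I : ((Fin n ⊕ Fin n) × (Fin n ⊕ Fin n)) × Fin n × Fin n =>
        (cylOps hT hV).D I.1.1 ((cylOps hT hV).D I.1.2 (hg.metric I.2.1 I.2.2))) ((α, β), i, j)
    refine h1.trans (Real.sqrt_le_iff.mpr ⟨by positivity, key.trans ?_⟩)
    have h7 : (7200 : ℝ) ≤ M ^ 8 := by
      calc (7200 : ℝ) ≤ 4 ^ 8 := by norm_num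
        _ ≤ M ^ 8 := by gcongr
    calc s ^ 2 * (7200 * (M ^ 102) ^ 10 * s ^ 2) = 7200 * M ^ 1020 * s ^ 4 := by ring
      _ ≤ M ^ 8 * M ^ 1020 * s ^ 4 := by gcongr
      _ = (M ^ 514 * s ^ 2) ^ 2 := by rw [mul_pow, ← pow_mul, ← pow_mul, ← pow_add]
  · intro q hq
    obtain ⟨B, -⟩ := H q (by linarith)
    have hD := hg.grad_bound hT hV hr hr1 hball H q hq
    have hD' : ∀ I : (Fin n ⊕ Fin n) × Fin n × Fin n,
        ‖evalAt q ((cylOps hT hV).D I.1 (hg.metric I.2.1 I.2.2))‖ ^ 2 ≤ s ^ 2 := by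
      intro I
      have := hD I.1 I.2.1 I.2.2
      rw [Jet0, pow_zero, one_mul] at this
      gcongr
    have hgrad : (evalAt q ((cylOps hT hV).gradSq hg.metric)).re
        = ∑ I : (Fin n ⊕ Fin n) × Fin n × Fin n,
          ‖evalAt q ((cylOps hT hV).D I.1 (hg.metric I.2.1 I.2.2))‖ ^ 2 := by
      rw [gradSq, ev_sum_star_mul, Complex.ofReal_re]
    have hP0 : 0 ≤ (evalAt q P).re := by
      rw [hP, hessSq, ev_sum_star_mul, Complex.ofReal_re]
      positivity
    rw [hev, hev, hsqrt]
    refine ⟨B.posSemidef_W, fun i j => (B.norm_W_le i j).trans (le_self_pow₀ hM1 (by norm_num)),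
      ?_, ?_, by positivity, ?_, fun i => ?_, ?_⟩
    · rw [hgrad]; positivity
    · rw [hgrad, inv_mul_le_iff₀ (by positivity)]
      calc _ ≤ ∑ I : (Fin n ⊕ Fin n) × Fin n × Fin n, s ^ 2 := Finset.sum_le_sum fun I _ => hD' I
        _ = (Fintype.card ((Fin n ⊕ Fin n) × Fin n × Fin n) : ℝ) * s ^ 2 := by simp
        _ ≤ M ^ 4 * s ^ 2 := by gcongr; exact card_grad_le
        _ ≤ s ^ 2 * M ^ 102 := by
            rw [mul_comm]; gcongr
            norm_num
    · rw [heat_smul, hev, inv_mul_le_iff₀ (by positivity)]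
      refine (B.heat_gradSq_le hs hD).trans ?_
      have h1 : (M ^ 102)⁻¹ * (evalAt q P).re ≤ (M ^ 2)⁻¹ * (evalAt q P).re := by
        gcongr
        norm_num
      have h2 : M ^ 94 * s ^ 4 ≤ M ^ 102 * s ^ 4 := by
        gcongr
        norm_num
      have e : s ^ 2 * (-(M ^ 102)⁻¹ * ((s ^ 2)⁻¹ * (evalAt q P).re) + M ^ 102 * s ^ 2)
          = -((M ^ 102)⁻¹ * (evalAt q P).re) + M ^ 102 * s ^ 4 := by
        field_simp
      rw [e]
      linarith
    · have h1 := MetricBound.d_gradSq_le hD hs0.le i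
      rw [Derivation.map_smul, map_smul, norm_smul, hc, Complex.norm_real,
        Real.norm_of_nonneg (by positivity)]
      calc _ ≤ (s ^ 2)⁻¹ * (M ^ 5 * (s * √(evalAt q P).re)) := by gcongr
        _ = M ^ 5 * (s⁻¹ * √(evalAt q P).re) := by field_simp
        _ ≤ M ^ 102 * (s⁻¹ * √(evalAt q P).re) := by
            gcongr
            norm_num
    · rw [heat_smul, hev]
      have h1 := B.heat_hessSq_le hs hD
      calc _ ≤ (s ^ 2)⁻¹ * (M ^ 102 * ((evalAt q P).re * √(evalAt q P).re + s ^ 6)) := by gcongr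
        _ = _ := by field_simp
  · intro q hq0 hq
    obtain ⟨-, I⟩ := H q (by linarith)
    rw [hev, inv_mul_le_iff₀ (by positivity), hP, hessSq, ev_sum_star_mul, Complex.ofReal_re]
    calc _ ≤ ∑ I : ((Fin n ⊕ Fin n) × (Fin n ⊕ Fin n)) × Fin n × Fin n, M ^ 2 := by
          refine Finset.sum_le_sum fun J _ => ?_
          rw [hg.evalAt_D_D_metric_initial hT hV hq0]
          have := I.two J.1.1 J.1.2 J.2.1 J.2.2
          gcongr
      _ = (Fintype.card (((Fin n ⊕ Fin n) × (Fin n ⊕ Fin n)) × Fin n × Fin n) : ℝ) * M ^ 2 := by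
          simp
      _ ≤ M ^ 6 * M ^ 2 := by gcongr; exact card_hess_le
      _ = M ^ 8 * 1 := by ring
      _ ≤ M ^ 102 * s ^ 4 := by
          gcongr
          · norm_num
          · exact one_le_pow₀ hs
      _ = _ := by ring
  · have : ‖p.1.2‖ ^ 2 ≤ (r / 4) ^ 2 := by gcongr
    nlinarith

include hr hr1 hball H in
lemma calabiNormSq_le (p : (Set.Icc 0 T ×ˢ V : Set (ℝ × Cn n))) (hp : ‖p.1.2‖ ≤ r / 2) :
    calabiNormSq h (g p.1.1) p.1.2 ≤ M ^ 1187 / r ^ 2 := by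
  have hM4 := hM.out
  have hM1 : 1 ≤ M := by linarith
  obtain ⟨B, I⟩ := H p (by linarith)
  have hG : ∀ i j, ‖(g p.1.1 p.1.2)⁻¹ i j‖ ≤ M := fun i j => by
    rw [← hg.evalAt_inv]; exact B.norm_W_le i j
  have hA : ∀ i j k, ‖nabla h (g p.1.1) i j k p.1.2‖ ≤ M ^ 589 / r := by
    intro i j k
    have h1 : ‖dz i (fun y => g p.1.1 y j k) p.1.2‖ ≤ M ^ 588 / r := by
      have := hg.grad_bound hT hV hr hr1 hball H p hp (.inl i) j k
      rw [Jet0, pow_zero, one_mul] at this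
      rwa [← hg.evalAt_d_metric hT hV]
    have h2 : ‖∑ l, christoffel h i j l p.1.2 * g p.1.1 p.1.2 l k‖ ≤ M * (M ^ 3 * M) := by
      refine norm_sum_fin_le hn.out (by positivity) fun l => ?_
      rw [norm_mul]
      gcongr
      · exact I.christoffel_le hn.out le_rfl i j l
      · exact B.norm_g_le l k
    have h3 : M * (M ^ 3 * M) ≤ M ^ 588 / r := by
      rw [le_div_iff₀ hr]
      calc M * (M ^ 3 * M) * r ≤ M * (M ^ 3 * M) * 1 := by gcongr
        _ = M ^ 5 := by ring
        _ ≤ M ^ 588 := pow_le_pow_of_fact (by norm_num)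
    calc _ ≤ M ^ 588 / r + M ^ 588 / r := (norm_sub_le _ _).trans (add_le_add h1 (h2.trans h3))
      _ = 2 * (M ^ 588 / r) := by ring
      _ ≤ M * (M ^ 588 / r) := by gcongr; linarith
      _ = M ^ 589 / r := by ring
  refine (normSq3_le hn.out hG (by positivity) hA).trans (le_of_eq ?_)
  rw [div_pow, ← pow_mul, mul_div_assoc', ← pow_add]

include hr hr1 hball H in
lemma curvatureNormSq_le (p : (Set.Icc 0 T ×ˢ V : Set (ℝ × Cn n))) (hp : ‖p.1.2‖ ≤ r / 4) :
    curvatureNormSq (g p.1.1) p.1.2 ≤ M ^ 3394 / r ^ 4 := by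
  have hM4 := hM.out
  obtain ⟨B, -⟩ := H p (by linarith)
  have hG : ∀ i j, ‖(g p.1.1 p.1.2)⁻¹ i j‖ ≤ M := fun i j => by
    rw [← hg.evalAt_inv]; exact B.norm_W_le i j
  have hA : ∀ i j k l, ‖chernCurvature (g p.1.1) i j k l p.1.2‖ ≤ M ^ 515 * (M ^ 588 / r) ^ 2 := by
    intro i j k l
    rw [← hg.evalAt_rm_mul hT hV]
    exact B.norm_rm_mul_le (k := 514) (by norm_num) (by positivity)
      (hg.grad_bound hT hV hr hr1 hball H p (by linarith))
      (hg.hess_bound hT hV hr hr1 hball H p hp) i j k l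
  refine (normSq4_le hn.out hG (by positivity) hA).trans (le_of_eq ?_)
  simp only [mul_pow, div_pow, ← pow_mul]
  rw [mul_div_assoc', mul_div_assoc', ← pow_add, ← pow_add]

end IsChernRicciFlow

end LocalEstimates

/-- There is a compact subset of `U` which contains all the balls of radius `3 r / 4` for which
`B_r ⊆ U` and `r < 1`. -/
lemma exists_compact_balls {n : ℕ} {U : Set (Cn n)} :
    ∃ K ⊆ U, IsCompact K ∧ ∀ r : ℝ, 0 < r → r < 1 → Metric.ball 0 r ⊆ U →
      Metric.closedBall 0 (3 * r / 4) ⊆ K := by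
  set A : Set ℝ := {r | 0 < r ∧ r < 1 ∧ Metric.ball (0 : Cn n) r ⊆ U} with hA
  rcases A.eq_empty_or_nonempty with hE | ⟨r0, hr0⟩
  · refine ⟨∅, Set.empty_subset _, isCompact_empty, fun r h0 h1 hb => ?_⟩
    exact absurd (show r ∈ A from ⟨h0, h1, hb⟩) (by rw [hE]; exact Set.notMem_empty r)
  · have hbdd : BddAbove A := ⟨1, fun r hr => hr.2.1.le⟩
    have hpos : 0 < sSup A := hr0.1.trans_le (le_csSup hbdd hr0)
    refine ⟨Metric.closedBall 0 (3 * sSup A / 4), fun x hx => ?_, isCompact_closedBall _ _,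
      fun r h0 h1 hb => Metric.closedBall_subset_closedBall ?_⟩
    · have hx' : ‖x‖ ≤ 3 * sSup A / 4 := by simpa using hx
      obtain ⟨r, hr, hxr⟩ := exists_lt_of_lt_csSup ⟨r0, hr0⟩ (show ‖x‖ < sSup A by linarith)
      exact hr.2.2 (by simpa using hxr)
    · have := le_csSup hbdd (show r ∈ A from ⟨h0, h1, hb⟩)
      linarith

end

end ChernRicci

theorem theorem1p1 (n : ℕ) (U : Set (ChernRicci.Cn n)) (hU : IsOpen U)
    (ghat : ChernRicci.MatField n) (hghat : ChernRicci.IsHermitianMetricOn U ghat) :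
    ∃ C α β : ℝ, 0 < C ∧ 0 < α ∧ 0 < β ∧
      ∀ r : ℝ, 0 < r → r < 1 →
      ∀ V : Set (ChernRicci.Cn n), IsOpen V → Metric.ball 0 r ⊆ V → V ⊆ U →
      ∀ T : ℝ, 0 < T →
      ∀ g : ℝ → ChernRicci.MatField n, ChernRicci.IsChernRicciFlow V T ghat g →
      ∀ N : ℝ, 1 < N →
      (∀ t ∈ Set.Icc 0 T, ∀ x ∈ Metric.ball (0 : ChernRicci.Cn n) r,
        ChernRicci.HermLE (((1 / N : ℝ) : ℂ) • ghat x) (g t x) ∧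
        ChernRicci.HermLE (g t x) ((N : ℂ) • ghat x)) →
      (∀ t ∈ Set.Icc 0 T, ∀ x ∈ Metric.ball (0 : ChernRicci.Cn n) (r / 2),
        ChernRicci.calabiNormSq ghat (g t) x ≤ C * N ^ α / r ^ 2) ∧
      (∀ t ∈ Set.Icc 0 T, ∀ x ∈ Metric.ball (0 : ChernRicci.Cn n) (r / 4),
        ChernRicci.curvatureNormSq (g t) x ≤ C * N ^ β / r ^ 4) := by
  obtain ⟨K, hKU, hK, hball⟩ := ChernRicci.exists_compact_balls (U := U)
  obtain ⟨c1, hc1⟩ := ChernRicci.exists_norm_bound hK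
    (fun i j => (hghat.smooth i j).continuousOn.mono hKU) fun x hx => hghat.posDef x (hKU hx)
  obtain ⟨c2, hc2⟩ := ChernRicci.exists_torsionBound hU hK hKU hghat
  obtain ⟨c3, hc3⟩ := ChernRicci.exists_initialBound hU hK hKU hghat fun x hx i j =>
    (ChernRicci.norm_entry_le _ i j).trans (hc1 x hx).2
  set c := max (max 4 (n : ℝ)) (max c1 (max c2 c3)) with hc
  have h4 : 4 ≤ c := (le_max_left _ _).trans (le_max_left _ _)
  have hn : (n : ℝ) ≤ c := (le_max_right _ _).trans (le_max_left _ _)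
  have h1 : c1 ≤ c := (le_max_left _ _).trans (le_max_right _ _)
  have h2 : c2 ≤ c := (le_max_left _ _).trans ((le_max_right _ _).trans (le_max_right _ _))
  have h3 : c3 ≤ c := (le_max_right _ _).trans ((le_max_right _ _).trans (le_max_right _ _))
  have hc0 : 0 < c := by linarith
  refine ⟨c ^ 3394, 1187, 3394, by positivity, by norm_num, by norm_num, ?_⟩
  intro r hr hr1 V hV hrV hVU T hT g hg N hN hbd
  have hcM : c ≤ c * N := le_mul_of_one_le_right hc0.le hN.le
  have : Fact (4 ≤ c * N) := ⟨h4.trans hcM⟩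
  have : Fact ((n : ℝ) ≤ c * N) := ⟨hn.trans hcM⟩
  have H : ∀ p : (Set.Icc 0 T ×ˢ V : Set (ℝ × ChernRicci.Cn n)), ‖p.1.2‖ ≤ 3 * r / 4 →
      (ChernRicci.cylOps hT hV).MetricBound (ChernRicci.evalAt p) (c * N) hg.metric hg.metric⁻¹ ∧
        ChernRicci.InitialBound ghat p.1.2 (c * N) := by
    intro p hp
    have hpK : p.1.2 ∈ K := hball r hr hr1 (hrV.trans hVU) (by simpa using hp)
    have hpr : p.1.2 ∈ Metric.ball (0 : ChernRicci.Cn n) r := by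
      rw [mem_ball_zero_iff]; linarith
    obtain ⟨hlo, hhi⟩ := hbd p.1.1 p.2.1 p.1.2 hpr
    exact ⟨hg.metricBound hT hV p hU hghat hVU hc0 (by linarith) le_rfl hcM
      ((hc1 _ hpK).1.trans h1) ((hc1 _ hpK).2.trans h1) ((hc2 _ hpK).mono h2) hlo hhi,
      (hc3 _ hpK).mono (h3.trans hcM)⟩
  refine ⟨fun t ht x hx => ?_, fun t ht x hx => ?_⟩
  · have hx' : ‖x‖ < r / 2 := by simpa using hx
    have hxV : x ∈ V := hrV (by rw [mem_ball_zero_iff]; linarith)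
    refine (hg.calabiNormSq_le hT hV hr hr1 hrV H ⟨(t, x), ht, hxV⟩ hx'.le).trans ?_
    have : N ^ (1187 : ℝ) = N ^ 1187 := by exact_mod_cast Real.rpow_natCast N 1187
    rw [this, mul_pow]
    gcongr
    · linarith
    · norm_num
  · have hx' : ‖x‖ < r / 4 := by simpa using hx
    have hxV : x ∈ V := hrV (by rw [mem_ball_zero_iff]; linarith)
    refine (hg.curvatureNormSq_le hT hV hr hr1 hrV H ⟨(t, x), ht, hxV⟩ hx'.le).trans ?_
    have : N ^ (3394 : ℝ) = N ^ 3394 := by exact_mod_cast Real.rpow_natCast N 3394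
    rw [this, mul_pow]
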